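/- **Setting.** Let $X$ be a locally compact separable metric space, $\mu$ a nonnegative Radon measure on $X$ with full support, and $(\mathcal E,\mathcal F)$ a strongly local regular symmetric Dirichlet form on the real space $L_2(X,\mu)$. This means that $\mathcal C:=C_c(X)\cap\mathcal F$ is uniformly dense in $C_c(X)$ and $\mathcal E_1$-dense in $\mathcal F$, and that $\mathcal E(f,g)=0$ whenever $f\in\mathcal C$ is constant on a neighbourhood of $\operatorname{supp} g$, $g\in\mathcal C$. For $f\in\mathcal C$ let $\Gamma(f)$ be the energy measure of $f$, i.e. the Radon measure with $\int\varphi\,d\Gamma(f)=\mathcal E(\varphi f,f)-\tfrac12\mathcal E(\varphi,f^2)$ for all $\varphi\in\mathcal C$. Let $\mathcal F_{loc}$ be the space of $f\in L_{2,loc}(X,\mu)$ that agree $\mu$-a.e. on each compact set with an element of $\mathcal F$. For $f\in\mathcal F_{loc}\cap C(X)$ let $\Gamma(f)$ be the Radon measure that coincides with $\Gamma(w)$ on each relatively compact open set on which $f=w$, $w\in\mathcal C$. Let $\Gamma(f,g)=\tfrac14(\Gamma(f+g)-\Gamma(f-g))$ on compact sets. Let $m$ be an energy dominant measure, i.e.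 a Radon measure with full support such that $\Gamma(f)\ll m$ for all $f\in\mathcal C$. The intrinsic metric is $$d_{\Gamma,m}(x,y)=\sup\{f(x)-f(y)\;:\;f\in\mathcal F_{loc}\cap C(X),\ \Gamma(f)\ll m,\ d\Gamma(f)/dm\le 1\ m\text{-a.e.}\}\in[0,\infty].$$ For compact $K\subset X$ let $\mathcal H(K)$ be the Hilbert space obtained from $(\mathcal F_{loc}\cap C(X))\otimes\mathcal B_b(X)$, where $\mathcal B_b(X)$ denotes the bounded Borel functions, by factoring out zero seminorm elements and completing with respect to $$\Big\|\sum_i f_i\otimes g_i\Big\|_{\mathcal H(K)}^2=\sum_{i,j}\int_K g_ig_j\,d\Gamma(f_i,f_j).$$ It carries the action of $\mathcal B_b(X)$ given by $(f\otimes g)h=f\otimes(gh)$. Let $\mathcal H_{loc}$ be the inverse limit of the spaces $\mathcal H(K)$ under restriction, and let $\partial:\mathcal F_{loc}\cap C(X)\to\mathcal H_{loc}$, $\partial f=f\otimes\mathbf 1$. A *field of 1-form fibres* is a measurable field $\{\mathcal H_x\}_{x\in X}$ of real Hilbert spaces together with, for every compact $K$, an isometric isomorphism $\int_K^\oplus\mathcal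 H_x\,m(dx)\cong\mathcal H(K)$ that turns pointwise multiplication of sections by $h\in\mathcal B_b(X)$ into the action of $h$; these isomorphisms are required to be compatible with restriction to smaller compact sets. An element $w\in\mathcal H_{loc}$ is identified with a measurable section $(w_x)_{x\in X}$ whose class in each direct integral corresponds to the component of $w$ in $\mathcal H(K)$. Then $L_\infty(X,m,\{\mathcal H_x\})\subset\mathcal H_{loc}$ is the space of those $w$ with $\|w\|_{L_\infty(X,m,\{\mathcal H_x\})}:=\operatorname{ess\,sup}_{x}\|w_x\|_{\mathcal H_x}<\infty$, the essential supremum being taken with respect to $m$. **Theorem.** A field of 1-form fibres exists, and for every such field $\{\mathcal H_x\}_{x\in X}$ and all $x,y\in X$, $$d_{\Gamma,m}(x,y)=\sup\{f(x)-f(y)\;:\;f\in\mathcal F_{loc}\cap C(X),\ \partial f\in L_\infty(X,m,\{\mathcal H_x\}),\ \|\partial f\|_{L_\infty(X,m,\{\mathcal H_x\})}\le 1\}.$$ -/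

import Mathlib

open MeasureTheory TopologicalSpace Set Filter Topology
open scoped ENNReal TensorProduct

universe u v

noncomputable section

/-! ## Symmetric Dirichlet forms on `L²(X, μ)` -/

/-- A symmetric Dirichlet form `(𝓔, 𝓕)` on `L²(X, μ)`: a nonnegative definite symmetric bilinear form
on a dense subspace `𝓕` that is closed (`𝓕` is complete for `𝓔₁ = 𝓔 + ⟨·,·⟩`) and Markovian. -/
structure DirichletForm {X : Type u} [MeasurableSpace X] (μ : Measure X) where
  /-- the domain `𝓕` -/
  domain : Submodule ℝ (Lp ℝ 2 μ)
  /-- the form `𝓔` -/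
  form : domain →ₗ[ℝ] domain →ₗ[ℝ] ℝ
  dense_domain : Dense (domain : Set (Lp ℝ 2 μ))
  symm : ∀ f g : domain, form f g = form g f
  nonneg : ∀ f : domain, 0 ≤ form f f
  closed : ∀ f : ℕ → domain,
    (∀ ε > 0, ∃ N, ∀ i ≥ N, ∀ j ≥ N,
      form (f i - f j) (f i - f j) + ‖((f i - f j : domain) : Lp ℝ 2 μ)‖ ^ 2 < ε) →
    ∃ g : domain, Tendsto
      (fun i => form (f i - g) (f i - g) + ‖((f i - g : domain) : Lp ℝ 2 μ)‖ ^ 2) atTop (𝓝 0)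
  markov : ∀ f : domain, ∃ g : domain,
    ((g : Lp ℝ 2 μ) : X → ℝ) =ᵐ[μ] (fun x => min (max 0 (((f : Lp ℝ 2 μ) : X → ℝ) x)) 1) ∧
      form g g ≤ form f f

/-- The space `B_b(X)` of bounded Borel functions. -/
def boundedBorel (X : Type u) [MeasurableSpace X] : Submodule ℝ (X → ℝ) where
  carrier := {g | Measurable g ∧ ∃ C, ∀ x, |g x| ≤ C}
  add_mem' := by
    rintro f g ⟨hf, C, hC⟩ ⟨hg, D, hD⟩
    exact ⟨hf.add hg, C + D, fun x => (abs_add_le _ _).trans (add_le_add (hC x) (hD x))⟩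
  zero_mem' := ⟨measurable_const, 0, fun x => by simp⟩
  smul_mem' := by
    rintro c f ⟨hf, C, hC⟩
    refine ⟨hf.const_smul c, |c| * C, fun x => ?_⟩
    simpa [abs_mul] using mul_le_mul_of_nonneg_left (hC x) (abs_nonneg c)

/-- The constant function `𝟏` as an element of `B_b(X)`. -/
def boundedBorelOne (X : Type u) [MeasurableSpace X] : boundedBorel X :=
  ⟨fun _ => 1, measurable_const, 1, fun _ => by simp⟩

/-- Multiplication `g ↦ g h` by `h ∈ B_b(X)` on `B_b(X)`. -/
def boundedBorelMul {X : Type u} [MeasurableSpace X] (h : boundedBorel X) :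
    boundedBorel X →ₗ[ℝ] boundedBorel X where
  toFun g := ⟨fun x => (g : X → ℝ) x * (h : X → ℝ) x, by
    obtain ⟨g, hg, C, hC⟩ := g
    obtain ⟨h, hh, D, hD⟩ := h
    refine ⟨hg.mul hh, C * D, fun x => ?_⟩
    rw [abs_mul]
    exact mul_le_mul (hC x) (hD x) (abs_nonneg _) ((abs_nonneg _).trans (hC x))⟩
  map_add' f g := by ext x; simp [add_mul]
  map_smul' c f := by ext x; simp [mul_assoc]

namespace DirichletForm

section Basic

variable {X : Type u} [MeasurableSpace X] {μ : Measure X} (E : DirichletForm μ)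

/-- The function `f` (that is, its `μ`-class) belongs to `𝓕`. -/
def Mem (f : X → ℝ) : Prop :=
  ∃ w : E.domain, ((w : Lp ℝ 2 μ) : X → ℝ) =ᵐ[μ] f

open Classical in
/-- `𝓔(f, g)` for functions `f, g` whose classes belong to `𝓕` (and `0` otherwise). -/
def energy (f g : X → ℝ) : ℝ :=
  if h : E.Mem f ∧ E.Mem g then E.form h.1.choose h.2.choose else 0

variable [TopologicalSpace X]

/-- The Dirichlet algebra `𝓒 = C_c(X) ∩ 𝓕`. -/
def dirichletAlgebra : Set C(X, ℝ) :=
  {f | HasCompactSupport f ∧ E.Mem f}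

/-- Regularity: `𝓒` is uniformly dense in `C_c(X)` and `𝓔₁`-dense in `𝓕`. -/
def IsRegular : Prop :=
  (∀ f : C(X, ℝ), HasCompactSupport f → ∀ ε > 0,
    ∃ g ∈ E.dirichletAlgebra, ∀ x, |f x - g x| < ε) ∧
  (∀ f : E.domain, ∀ ε > 0, ∃ g : E.domain,
    (∃ c ∈ E.dirichletAlgebra, ((g : Lp ℝ 2 μ) : X → ℝ) =ᵐ[μ] c) ∧
      E.form (f - g) (f - g) + ‖((f - g : E.domain) : Lp ℝ 2 μ)‖ ^ 2 < ε)

/-- A strongly local (regular) Dirichlet form: `𝓔(f, g) = 0` whenever `f ∈ 𝓒` is constant on a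
neighbourhood of the support of `g ∈ 𝓒`. -/
def IsStronglyLocal : Prop :=
  E.IsRegular ∧
  ∀ f ∈ E.dirichletAlgebra, ∀ g ∈ E.dirichletAlgebra,
    (∃ c : ℝ, ∃ U : Set X, IsOpen U ∧ tsupport g ⊆ U ∧ ∀ x ∈ U, f x = c) → E.energy f g = 0

/-! ### Energy measures -/

/-- `ν` is the energy measure of `f ∈ 𝓒`: a Radon measure with
`∫ φ dν = 𝓔(φ f, f) - ½ 𝓔(φ, f²)` for all `φ ∈ 𝓒`
(`φ f` and `f²` belong to `𝓒` because `𝓒` is an algebra). -/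
def IsEnergyMeasure (f : C(X, ℝ)) (ν : Measure X) : Prop :=
  ν.Regular ∧ ∀ φ ∈ E.dirichletAlgebra,
    ∫ x, φ x ∂ν = E.energy (φ * f : C(X, ℝ)) f - 1 / 2 * E.energy φ (f * f : C(X, ℝ))

open Classical in
/-- The energy measure `Γ(f)` of `f ∈ 𝓒`, the unique measure with `IsEnergyMeasure`. -/
def energyMeasure (f : C(X, ℝ)) : Measure X :=
  if h : ∃ ν, E.IsEnergyMeasure f ν then h.choose else 0

/-- A Radon measure `m` with full support is energy dominant if `Γ(f) ≪ m` for all `f ∈ 𝓒`. -/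
def IsEnergyDominant (m : Measure X) : Prop :=
  m.Regular ∧ m.IsOpenPosMeasure ∧ ∀ f ∈ E.dirichletAlgebra, E.energyMeasure f ≪ m

/-- `𝓕_loc`: the functions in `L²_loc(X, μ)` that agree `μ`-a.e. on each compact set with an
element of `𝓕`. -/
def MemLoc (f : X → ℝ) : Prop :=
  AEStronglyMeasurable f μ ∧ ∀ K : Set X, IsCompact K →
    MemLp f 2 (μ.restrict K) ∧ ∃ w : E.domain, ((w : Lp ℝ 2 μ) : X → ℝ) =ᵐ[μ.restrict K] f

/-- `𝓕_loc ∩ C(X)` as a linear space. -/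
def locContinuous : Submodule ℝ C(X, ℝ) where
  carrier := {f | E.MemLoc f}
  add_mem' := by
    rintro f g ⟨hf, hf'⟩ ⟨hg, hg'⟩
    refine ⟨by simpa using hf.add hg, fun K hK => ?_⟩
    obtain ⟨h1, w1, hw1⟩ := hf' K hK
    obtain ⟨h2, w2, hw2⟩ := hg' K hK
    refine ⟨by simpa using h1.add h2, w1 + w2, ?_⟩
    filter_upwards [hw1, hw2, ae_restrict_of_ae (Lp.coeFn_add (w1 : Lp ℝ 2 μ) w2)] with x a b c
    simp only [Submodule.coe_add, ContinuousMap.coe_add, Pi.add_apply] at c ⊢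
    rw [c, a, b]
  zero_mem' := by
    refine ⟨aestronglyMeasurable_zero, fun K hK => ⟨MemLp.zero, 0, ?_⟩⟩
    filter_upwards [ae_restrict_of_ae (Lp.coeFn_zero ℝ 2 μ)] with x a
    simpa using a
  smul_mem' := by
    rintro c f ⟨hf, hf'⟩
    refine ⟨by simpa using hf.const_smul c, fun K hK => ?_⟩
    obtain ⟨h1, w1, hw1⟩ := hf' K hK
    refine ⟨by simpa using h1.const_smul c, c • w1, ?_⟩
    filter_upwards [hw1, ae_restrict_of_ae (Lp.coeFn_smul c (w1 : Lp ℝ 2 μ))] with x a b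
    simp only [Submodule.coe_smul, ContinuousMap.coe_smul, Pi.smul_apply] at b ⊢
    rw [b, a]

/-- `ν` is the energy measure of `f ∈ 𝓕_loc ∩ C(X)`: it is Radon and coincides with `Γ(w)` on each
relatively compact open set on which `f = w` with `w ∈ 𝓒`. By multiplication with cut-off functions
every `f ∈ 𝓕_loc ∩ C(X)` agrees on each relatively compact open set with some `w ∈ 𝓒`. -/
def IsLocalEnergyMeasure (f : C(X, ℝ)) (ν : Measure X) : Prop :=
  ν.Regular ∧ ∀ G : Set X, IsOpen G → IsCompact (closure G) →
    ∀ w ∈ E.dirichletAlgebra, (∀ x ∈ G, w x = f x) →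
      ν.restrict G = (E.energyMeasure w).restrict G

open Classical in
/-- The energy measure `Γ(f)` of `f ∈ 𝓕_loc ∩ C(X)`, the unique measure with
`IsLocalEnergyMeasure`. -/
def localEnergyMeasure (f : C(X, ℝ)) : Measure X :=
  if h : ∃ ν, E.IsLocalEnergyMeasure f ν then h.choose else 0

/-! ### The intrinsic metric -/

/-- `𝓐 = {f ∈ 𝓕_loc ∩ C(X) : Γ(f) ∈ L_∞(X, m)}`. -/
def lipschitzClass (m : Measure X) : Set C(X, ℝ) :=
  {f | f ∈ E.locContinuous ∧ E.localEnergyMeasure f ≪ m ∧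
    essSup ((E.localEnergyMeasure f).rnDeriv m) m < ∞}

/-- `Γ(f) ≤ m`: `Γ(f)` is absolutely continuous with respect to `m`, with density at most one
`m`-a.e. -/
def EnergyLe (m : Measure X) (f : C(X, ℝ)) : Prop :=
  E.localEnergyMeasure f ≪ m ∧ ∀ᵐ x ∂m, (E.localEnergyMeasure f).rnDeriv m x ≤ 1

/-- The intrinsic metric `d_{Γ,m}(x, y) = sup {f(x) - f(y) | f ∈ 𝓐, Γ(f) ≤ m}`, possibly `∞`. -/
def intrinsicMetric (m : Measure X) (x y : X) : EReal :=
  ⨆ f ∈ {f : C(X, ℝ) | f ∈ E.lipschitzClass m ∧ E.EnergyLe m f}, ((f x - f y : ℝ) : EReal)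

/-! ### The spaces `𝓗(K)` and `𝓗_loc` -/

/-- `∫_K h dΓ(f, g)` for the mutual energy measure
`Γ(f, g) = ¼ (Γ(f + g) - Γ(f - g))` of `f, g ∈ 𝓕_loc ∩ C(X)`. -/
def mutualIntegral (K : Compacts X) (h : X → ℝ) (f g : C(X, ℝ)) : ℝ :=
  1 / 4 * (∫ x in (K : Set X), h x ∂(E.localEnergyMeasure (f + g)) -
    ∫ x in (K : Set X), h x ∂(E.localEnergyMeasure (f - g)))

/-- `B` is the form `⟨∑ fᵢ ⊗ gᵢ, ∑ fⱼ ⊗ gⱼ⟩_{𝓗(K)} = ∑ ∑ ∫_K gᵢ gⱼ dΓ(fᵢ, fⱼ)` on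
`(𝓕_loc ∩ C(X)) ⊗ B_b(X)`, which is symmetric and nonnegative definite. -/
structure IsTensorForm (K : Compacts X)
    (B : LinearMap.BilinForm ℝ (E.locContinuous ⊗[ℝ] boundedBorel X)) : Prop where
  tmul : ∀ (f f' : E.locContinuous) (g g' : boundedBorel X),
    B (f ⊗ₜ g) (f' ⊗ₜ g') =
      E.mutualIntegral K (fun x => (g : X → ℝ) x * (g' : X → ℝ) x) (f : C(X, ℝ)) f'
  symm : ∀ s t, B s t = B t s
  nonneg : ∀ t, 0 ≤ B t t

open Classical in
/-- The form `⟨·,·⟩_{𝓗(K)}`, the unique bilinear form with `IsTensorForm`. -/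
def tensorForm (K : Compacts X) : LinearMap.BilinForm ℝ (E.locContinuous ⊗[ℝ] boundedBorel X) :=
  if h : ∃ B, E.IsTensorForm K B then h.choose else 0

theorem tensorForm_symm (K : Compacts X) (s t : E.locContinuous ⊗[ℝ] boundedBorel X) :
    E.tensorForm K s t = E.tensorForm K t s := by
  unfold tensorForm
  split_ifs with h
  · exact h.choose_spec.symm s t
  · rfl

theorem tensorForm_nonneg (K : Compacts X) (t : E.locContinuous ⊗[ℝ] boundedBorel X) :
    0 ≤ E.tensorForm K t t := by
  unfold tensorForm
  split_ifs with h
  · exact h.choose_spec.nonneg t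
  · exact le_rfl

/-- `(𝓕_loc ∩ C(X)) ⊗ B_b(X)`, carrying the seminorm `‖·‖_{𝓗(K)}`. -/
def TensorSpace (_K : Compacts X) : Type u := E.locContinuous ⊗[ℝ] boundedBorel X

instance (K : Compacts X) : AddCommGroup (E.TensorSpace K) :=
  inferInstanceAs (AddCommGroup (E.locContinuous ⊗[ℝ] boundedBorel X))

instance (K : Compacts X) : Module ℝ (E.TensorSpace K) :=
  inferInstanceAs (Module ℝ (E.locContinuous ⊗[ℝ] boundedBorel X))

/-- The semi-inner product `⟨·,·⟩_{𝓗(K)}`. -/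
@[reducible] def tensorCore (K : Compacts X) :
    PreInnerProductSpace.Core ℝ (E.TensorSpace K) where
  inner s t := E.tensorForm K s t
  conj_inner_symm s t := E.tensorForm_symm K t s
  re_inner_nonneg t := E.tensorForm_nonneg K t
  add_left s t r := LinearMap.map_add₂ (E.tensorForm K) s t r
  smul_left s t c := LinearMap.map_smul₂ (E.tensorForm K) c s t

instance (K : Compacts X) : SeminormedAddCommGroup (E.TensorSpace K) :=
  @InnerProductSpace.Core.toSeminormedAddCommGroup ℝ _ _ _ _ (E.tensorCore K)

instance (K : Compacts X) : InnerProductSpace ℝ (E.TensorSpace K) :=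
  InnerProductSpace.ofCore (E.tensorCore K)

/-- The Hilbert space `𝓗(K)`: the Hausdorff completion of `(𝓕_loc ∩ C(X)) ⊗ B_b(X)` with respect
to `‖·‖_{𝓗(K)}` (zero seminorm elements are factored out). -/
abbrev OneForms (K : Compacts X) : Type u := UniformSpace.Completion (E.TensorSpace K)

/-- The class in `𝓗(K)` of an element of `(𝓕_loc ∩ C(X)) ⊗ B_b(X)`. -/
def toOneForms (K : Compacts X) : (E.locContinuous ⊗[ℝ] boundedBorel X) →ₗ[ℝ] E.OneForms K :=
  (UniformSpace.Completion.toComplₗᵢ (𝕜 := ℝ) (E := E.TensorSpace K)).toLinearMap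

/-- The graph of the restriction `v ↦ v 𝟏_K` from `𝓗(K')` to `𝓗(K)`, `K ⊆ K'`: the closure of the
graph of the identity on `(𝓕_loc ∩ C(X)) ⊗ B_b(X)`. -/
def restrictionGraph (K K' : Compacts X) : Submodule ℝ (E.OneForms K' × E.OneForms K) :=
  (LinearMap.range ((E.toOneForms K').prod (E.toOneForms K))).topologicalClosure

/-- The right action `(f ⊗ g) h = f ⊗ (g h)` of `h ∈ B_b(X)` on `(𝓕_loc ∩ C(X)) ⊗ B_b(X)`. -/
def rightMul (h : boundedBorel X) :
    (E.locContinuous ⊗[ℝ] boundedBorel X) →ₗ[ℝ] (E.locContinuous ⊗[ℝ] boundedBorel X) :=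
  LinearMap.lTensor _ (boundedBorelMul h)

/-- The graph of the bounded right action of `h ∈ B_b(X)` on `𝓗(K)`. -/
def actionGraph (K : Compacts X) (h : boundedBorel X) :
    Submodule ℝ (E.OneForms K × E.OneForms K) :=
  (LinearMap.range
    ((E.toOneForms K).prod ((E.toOneForms K).comp (E.rightMul h)))).topologicalClosure

/-- `𝓗_loc`, the inverse limit of the spaces `𝓗(K)`, `K ⊆ X` compact, under restriction. -/
def OneFormsLoc : Submodule ℝ (∀ K : Compacts X, E.OneForms K) where
  carrier := {w | ∀ K K' : Compacts X, K ≤ K' → (w K', w K) ∈ E.restrictionGraph K K'}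
  add_mem' := fun ha hb K K' h => (E.restrictionGraph K K').add_mem (ha K K' h) (hb K K' h)
  zero_mem' := fun K K' _ => (E.restrictionGraph K K').zero_mem
  smul_mem' := fun c _ ha K K' h => (E.restrictionGraph K K').smul_mem c (ha K K' h)

/-- The gradient `∂ : 𝓕_loc ∩ C(X) → 𝓗_loc`, `∂f = f ⊗ 𝟏`. -/
def gradient : E.locContinuous →ₗ[ℝ] E.OneFormsLoc where
  toFun f := ⟨fun K => E.toOneForms K (f ⊗ₜ boundedBorelOne X), fun K K' _ =>
    Submodule.le_topologicalClosure _ ⟨f ⊗ₜ boundedBorelOne X, rfl⟩⟩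
  map_add' f g := by
    ext K
    simp [TensorProduct.add_tmul]
  map_smul' c f := by
    ext K
    simp only [← TensorProduct.smul_tmul', map_smul]
    rfl

end Basic

end DirichletForm

/-! ## Measurable fields of Hilbert spaces and direct integrals -/

/-- A measurable field of (real) Hilbert spaces over `X`, together with its linear space of
measurable sections: norms of measurable sections are measurable, a section all of whose inner
products with measurable sections are measurable is measurable, and there is a sequence of
measurable sections that is total in every fibre. -/
structure HilbertField (X : Type u) [MeasurableSpace X] where
  /-- the fibre `𝓗_x` -/
  fibre : X → Type v
  [normed : ∀ x, NormedAddCommGroup (fibre x)]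
  [inner : ∀ x, InnerProductSpace ℝ (fibre x)]
  [complete : ∀ x, CompleteSpace (fibre x)]
  /-- the measurable sections -/
  sections : Submodule ℝ (∀ x, fibre x)
  measurable_norm : ∀ a ∈ sections, Measurable fun x => ‖a x‖
  mem_sections : ∀ b : ∀ x, fibre x,
    (∀ a ∈ sections, Measurable fun x => Inner.inner ℝ (b x) (a x)) → b ∈ sections
  total : ∃ e : ℕ → ∀ x, fibre x, (∀ n, e n ∈ sections) ∧
    ∀ x, Dense (Submodule.span ℝ (range fun n => e n x) : Set (fibre x))

attribute [instance] HilbertField.normed HilbertField.inner HilbertField.complete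

namespace HilbertField

section Integral

variable {X : Type u} [MeasurableSpace X] (H : HilbertField.{u, v} X)

theorem measurable_inner {a b : ∀ x, H.fibre x} (ha : a ∈ H.sections) (hb : b ∈ H.sections) :
    Measurable fun x => Inner.inner ℝ (a x) (b x) := by
  have h : (fun x => Inner.inner ℝ (a x) (b x)) =
      fun x => (‖(a + b) x‖ * ‖(a + b) x‖ - ‖a x‖ * ‖a x‖ - ‖b x‖ * ‖b x‖) / 2 := by
    ext x
    exact real_inner_eq_norm_add_mul_self_sub_norm_mul_self_sub_norm_mul_self_div_two _ _
  rw [h]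
  have h1 := H.measurable_norm _ (H.sections.add_mem ha hb)
  have h2 := H.measurable_norm _ ha
  have h3 := H.measurable_norm _ hb
  exact (((h1.mul h1).sub (h2.mul h2)).sub (h3.mul h3)).div_const 2

variable [TopologicalSpace X] (m : Measure X)

/-- The measurable sections that are square integrable on `K`. -/
def l2 (K : Compacts X) : Submodule ℝ (∀ x, H.fibre x) where
  carrier := {a | a ∈ H.sections ∧ IntegrableOn (fun x => ‖a x‖ ^ 2) K m}
  add_mem' := by
    rintro a b ⟨ha, ha'⟩ ⟨hb, hb'⟩
    have hab := H.sections.add_mem ha hb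
    refine ⟨hab, Integrable.mono' ((ha'.const_mul 2).add (hb'.const_mul 2))
      ((H.measurable_norm _ hab).pow_const 2).aestronglyMeasurable (ae_of_all _ fun x => ?_)⟩
    have h1 : ‖(a + b) x‖ ≤ ‖a x‖ + ‖b x‖ := norm_add_le _ _
    have h2 : ‖(a + b) x‖ ^ 2 ≤ (‖a x‖ + ‖b x‖) ^ 2 := by gcongr
    rw [Real.norm_of_nonneg (by positivity)]
    simp only [Pi.add_apply] at h2 ⊢
    nlinarith [sq_nonneg (‖a x‖ - ‖b x‖)]
  zero_mem' := ⟨H.sections.zero_mem, by simp⟩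
  smul_mem' := by
    rintro c a ⟨ha, ha'⟩
    refine ⟨H.sections.smul_mem c ha, ?_⟩
    simpa [norm_smul, mul_pow, IntegrableOn] using Integrable.const_mul ha' (c ^ 2)

theorem l2_mono {K K' : Compacts X} (h : K ≤ K') : H.l2 m K' ≤ H.l2 m K :=
  fun _ ha => ⟨ha.1, ha.2.mono_set h⟩

/-- The space of sections square integrable on `K`, with the seminorm `(∫_K ‖a_x‖² m(dx))^{1/2}`. -/
def L2Sections (K : Compacts X) : Type (max u v) := H.l2 m K

instance (K : Compacts X) : AddCommGroup (H.L2Sections m K) :=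
  inferInstanceAs (AddCommGroup (H.l2 m K))

instance (K : Compacts X) : Module ℝ (H.L2Sections m K) :=
  inferInstanceAs (Module ℝ (H.l2 m K))

theorem integrable_inner {K : Compacts X} (a b : H.l2 m K) :
    IntegrableOn (fun x => Inner.inner ℝ (a.1 x) (b.1 x)) K m := by
  refine Integrable.mono' (a.2.2.add b.2.2)
    (H.measurable_inner a.2.1 b.2.1).aestronglyMeasurable (ae_of_all _ fun x => ?_)
  have h := norm_inner_le_norm (𝕜 := ℝ) (a.1 x) (b.1 x)
  simp only [Pi.add_apply]
  nlinarith [sq_nonneg (‖a.1 x‖ - ‖b.1 x‖), sq_nonneg ‖a.1 x‖, sq_nonneg ‖b.1 x‖]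

/-- The semi-inner product `∫_K ⟨a_x, b_x⟩ m(dx)`. -/
@[reducible] def l2Core (K : Compacts X) : PreInnerProductSpace.Core ℝ (H.L2Sections m K) where
  inner a b := ∫ x in (K : Set X), Inner.inner ℝ ((a : H.l2 m K).1 x) ((b : H.l2 m K).1 x) ∂m
  conj_inner_symm a b := integral_congr_ae (ae_of_all _ fun x => real_inner_comm _ _)
  re_inner_nonneg a := integral_nonneg fun x => real_inner_self_nonneg
  add_left a b c := by
    rw [← integral_add (H.integrable_inner m a c) (H.integrable_inner m b c)]
    exact integral_congr_ae (ae_of_all _ fun x => inner_add_left _ _ _)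
  smul_left a b c := by
    rw [← integral_const_mul]
    exact integral_congr_ae (ae_of_all _ fun x => inner_smul_left _ _ _)

instance (K : Compacts X) : SeminormedAddCommGroup (H.L2Sections m K) :=
  @InnerProductSpace.Core.toSeminormedAddCommGroup ℝ _ _ _ _ (H.l2Core m K)

instance (K : Compacts X) : InnerProductSpace ℝ (H.L2Sections m K) :=
  InnerProductSpace.ofCore (H.l2Core m K)

/-- The direct integral `∫_K^⊕ 𝓗_x m(dx)`: sections square integrable on `K`, modulo equality
`m`-a.e. on `K`. -/
abbrev DirectIntegral (K : Compacts X) : Type (max u v) := SeparationQuotient (H.L2Sections m K)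

/-- The class in `∫_K^⊕ 𝓗_x m(dx)` of a section that is square integrable on `K`. -/
def toDirectIntegral (K : Compacts X) (a : H.l2 m K) : H.DirectIntegral m K :=
  SeparationQuotient.mk (X := H.L2Sections m K) a

/-- The section `x ↦ h(x) a_x`, for `h ∈ B_b(X)`. -/
def l2Mul {K : Compacts X} (h : boundedBorel X) (a : H.l2 m K) : H.l2 m K :=
  ⟨fun x => (h : X → ℝ) x • a.1 x, by
    obtain ⟨h, hh, C, hC⟩ := h
    have hs : (fun x => h x • a.1 x) ∈ H.sections := by
      refine H.mem_sections _ fun b hb => ?_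
      simp only [real_inner_smul_left]
      exact hh.mul (H.measurable_inner a.2.1 hb)
    refine ⟨hs, Integrable.mono' (Integrable.const_mul a.2.2 (C ^ 2))
      ((H.measurable_norm _ hs).pow_const 2).aestronglyMeasurable (ae_of_all _ fun x => ?_)⟩
    have h2 : |h x| ^ 2 ≤ C ^ 2 := pow_le_pow_left₀ (abs_nonneg _) (hC x) 2
    rw [Real.norm_of_nonneg (by positivity)]
    simp only [norm_smul, mul_pow, Real.norm_eq_abs]
    exact mul_le_mul_of_nonneg_right h2 (by positivity)⟩

end Integral

end HilbertField

/-! ## The field of 1-form fibres and bounded vector fields -/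

/-- A measurable field of Hilbert modules `{𝓗_x}` representing the 1-forms of `(𝓔, 𝓕)` with respect
to `m`: for each compact `K` an isometric isomorphism of `∫_K^⊕ 𝓗_x m(dx)` onto `𝓗(K)` which carries
the pointwise multiplication of sections by `h ∈ B_b(X)` to the action of `h` on `𝓗(K)`, and these
isomorphisms are compatible with restriction to smaller compact sets. -/
structure OneFormField {X : Type u} [TopologicalSpace X] [MeasurableSpace X] {μ : Measure X}
    (E : DirichletForm μ) (m : Measure X) extends HilbertField.{u, v} X where
  /-- the isometric isomorphism `∫_K^⊕ 𝓗_x m(dx) ≅ 𝓗(K)` -/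
  iso : ∀ K : Compacts X, toHilbertField.DirectIntegral m K ≃ₗᵢ[ℝ] E.OneForms K
  iso_mul : ∀ (K : Compacts X) (h : boundedBorel X) (a : toHilbertField.l2 m K),
    (iso K (toHilbertField.toDirectIntegral m K a),
      iso K (toHilbertField.toDirectIntegral m K (toHilbertField.l2Mul m h a))) ∈ E.actionGraph K h
  iso_restrict : ∀ (K K' : Compacts X) (hK : K ≤ K') (a : toHilbertField.l2 m K'),
    (iso K' (toHilbertField.toDirectIntegral m K' a),
      iso K (toHilbertField.toDirectIntegral m K ⟨a.1, toHilbertField.l2_mono m hK a.2⟩)) ∈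
      E.restrictionGraph K K'

namespace OneFormField

variable {X : Type u} [TopologicalSpace X] [MeasurableSpace X] {μ : Measure X}
  {E : DirichletForm μ} {m : Measure X} (H : OneFormField.{u, v} E m)

/-- The section `a = (a_x)` is identified with the element `w` of `𝓗_loc`: it is square integrable
on each compact `K` and its class corresponds to the component of `w` in `𝓗(K)`. -/
def Represents (a : ∀ x, H.fibre x) (w : E.OneFormsLoc) : Prop :=
  ∀ K : Compacts X, ∃ ha : a ∈ H.toHilbertField.l2 m K,
    H.iso K (H.toHilbertField.toDirectIntegral m K ⟨a, ha⟩) = w.1 K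

/-- The norm of `w ∈ 𝓗_loc` in the space `L_∞(X, m, {𝓗_x}) ⊆ 𝓗_loc` of bounded vector fields:
`ess sup_x ‖a_x‖` where the section `a` represents `w` (`a` is unique up to equality `m`-a.e.);
it is `∞` if `w` is not a bounded vector field. -/
def lInftyNorm (w : E.OneFormsLoc) : ℝ≥0∞ :=
  ⨅ a ∈ {a : ∀ x, H.fibre x | H.Represents a w}, essSup (fun x => ‖a x‖ₑ) m

end OneFormField

end

set_option linter.unusedSectionVars false

/-! A field of 1-form fibres disintegrates the seminorm of `𝓗(K)` pointwise. Let the section `a`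
represent `∂f`. The isomorphisms are isometric and commute with multiplication by `𝟏_s`, so `∫_{K ∩
s} ‖a_x‖² dm = ‖f ⊗ 𝟏_s‖² = Γ(f)(K ∩ s)` for every compact `K` and Borel `s`. Hence `‖a_x‖²` is the
density `dΓ(f)/dm` almost everywhere (`norm_sq_eq_of_represents`). Every `∂f` does have a
representing section, glued over a countable compact covering (`exists_represents`). So `‖∂f‖_∞ ≤ 1`
says exactly that `dΓ(f)/dm ≤ 1` a.e., and the two suprema run over the same functions
(`lInftyNorm_gradient_le_one_iff`).

For existence, take a sequence `f_i` in `𝓒` that is dense for the energy seminorm. Off a null set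
the densities of `Γ(f_i, f_j)` form a symmetric nonnegative definite matrix, and `𝓗_x` is the
Hilbert space with this Gram matrix (`exists_gramMatrix`, `gramField`). Sending `h e_i` to `f_i ⊗ h`
preserves inner products and relates total families, so it extends to the required isometry
(`dense_of_total`, `dense_of_dirichletAlgebra`, `exists_iso`). Compatibility with the action and
with restriction is a closed relation, checked on these generators (`mem_of_total`).

Both arguments need the energy measures, which are built here from the axioms of a Dirichlet form.
Bounded elements of `𝓕` form an algebra (`Mem.mul_self_of_unit`). The functional `φ ↦ 𝓔(φ f, f) - ½
𝓔(φ, f²)` is positive, by approximating `𝓔` through the resolvent (`energy_functional_nonneg`), and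
extends to a Radon measure (`exists_isEnergyMeasure`). Strong locality makes these measures local,
so they can be glued for `f ∈ 𝓕_loc ∩ C(X)` (`exists_isLocalEnergyMeasure`). Quadratic identities
then pass to measures and to densities (`sum_energyDensity_eq_zero`). This gives the semi-inner
product on tensors (`exists_isTensorForm`) and makes restriction and action single-valued. -/

noncomputable section

/-! ## The Hilbert space `(𝓕, t𝓔 + ⟨·,·⟩)` and the resolvent -/

namespace DirichletForm

section Hilbert

variable {X : Type u} [MeasurableSpace X] {μ : Measure X} (E : DirichletForm μ)

/-- The domain `𝓕`, carrying the scalar product `t 𝓔 + ⟨·,·⟩`. -/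
def FormDomain (_t : NNReal) : Type u := E.domain

instance (t : NNReal) : AddCommGroup (E.FormDomain t) := inferInstanceAs (AddCommGroup E.domain)

instance (t : NNReal) : Module ℝ (E.FormDomain t) := inferInstanceAs (Module ℝ E.domain)

/-- The identity, as a linear equivalence of `𝓕` with its scalar product and `𝓕`. -/
def formEquiv (t : NNReal) : E.FormDomain t ≃ₗ[ℝ] E.domain := LinearEquiv.refl ℝ E.domain

/-- The scalar product `t 𝓔 + ⟨·,·⟩` on `𝓕`. -/
@[reducible] def formCore (t : NNReal) : InnerProductSpace.Core ℝ (E.FormDomain t) where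
  inner f g := t * E.form (E.formEquiv t f) (E.formEquiv t g) +
    Inner.inner ℝ (E.formEquiv t f : Lp ℝ 2 μ) (E.formEquiv t g : Lp ℝ 2 μ)
  conj_inner_symm f g := by
    simp only [conj_trivial]
    rw [E.symm, real_inner_comm]
  re_inner_nonneg f := by
    simp only [RCLike.re_to_real]
    exact add_nonneg (mul_nonneg t.2 (E.nonneg _)) real_inner_self_nonneg
  add_left f g h := by
    simp only [map_add, LinearMap.add_apply, Submodule.coe_add, inner_add_left]
    ring
  smul_left f g r := by
    simp only [map_smul, LinearMap.smul_apply, Submodule.coe_smul, real_inner_smul_left,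
      smul_eq_mul, conj_trivial]
    ring
  definite f h := by
    have h1 : 0 ≤ (t : ℝ) * _ := mul_nonneg t.2 (E.nonneg (E.formEquiv t f))
    have h2 : 0 ≤ Inner.inner ℝ (E.formEquiv t f : Lp ℝ 2 μ) (E.formEquiv t f : Lp ℝ 2 μ) :=
      real_inner_self_nonneg
    have h3 : Inner.inner ℝ (E.formEquiv t f : Lp ℝ 2 μ) (E.formEquiv t f : Lp ℝ 2 μ) = 0 := by
      linarith
    exact (E.formEquiv t).map_eq_zero_iff.1 (Subtype.ext (inner_self_eq_zero.1 h3))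

instance (t : NNReal) : NormedAddCommGroup (E.FormDomain t) :=
  @InnerProductSpace.Core.toNormedAddCommGroup ℝ _ _ _ _ (E.formCore t)

instance (t : NNReal) : InnerProductSpace ℝ (E.FormDomain t) :=
  InnerProductSpace.ofCore (E.formCore t).toCore

variable {E} in
theorem formDomain_inner {t : NNReal} (f g : E.FormDomain t) :
    Inner.inner ℝ f g = t * E.form (E.formEquiv t f) (E.formEquiv t g) +
      Inner.inner ℝ (E.formEquiv t f : Lp ℝ 2 μ) (E.formEquiv t g : Lp ℝ 2 μ) := rfl

variable {E} in
theorem formDomain_norm_sq {t : NNReal} (f : E.FormDomain t) :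
    ‖f‖ ^ 2 = t * E.form (E.formEquiv t f) (E.formEquiv t f) +
      ‖(E.formEquiv t f : Lp ℝ 2 μ)‖ ^ 2 := by
  rw [← real_inner_self_eq_norm_sq, formDomain_inner, real_inner_self_eq_norm_sq]

/-- The inclusion of `𝓕` into `L²(X, μ)`. -/
def formIncl (t : NNReal) : E.FormDomain t →L[ℝ] Lp ℝ 2 μ :=
  LinearMap.mkContinuous (E.domain.subtype ∘ₗ (E.formEquiv t).toLinearMap) 1 (fun f => by
    have h := formDomain_norm_sq f
    have h1 : 0 ≤ (t : ℝ) * _ := mul_nonneg t.2 (E.nonneg (E.formEquiv t f))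
    rw [one_mul]
    refine (sq_le_sq₀ (norm_nonneg _) (norm_nonneg _)).1 ?_
    rw [h]
    simpa using h1)

/-- For `t > 0` the norms of `t 𝓔 + ⟨·,·⟩` and `𝓔 + ⟨·,·⟩` are equivalent, with constants `1/t + 1`
and `t + 1` between their squares, so closedness of the form is completeness for every such `t`. -/
theorem complete_formDomain {t : NNReal} (ht : 0 < t) : CompleteSpace (E.FormDomain t) := by
  have ht' : (0 : ℝ) < t := ht
  refine Metric.complete_of_cauchySeq_tendsto fun f hf => ?_
  have key : ∀ f : E.FormDomain t, E.form (E.formEquiv t f) (E.formEquiv t f) +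
      ‖(E.formEquiv t f : Lp ℝ 2 μ)‖ ^ 2 ≤ (1 / t + 1) * ‖f‖ ^ 2 := fun f => by
    rw [formDomain_norm_sq]
    set f := E.formEquiv t f
    have h1 := E.nonneg f
    have h2 := sq_nonneg ‖(f : Lp ℝ 2 μ)‖
    have h3 : (1 / (t : ℝ) + 1) * (t * E.form f f + ‖(f : Lp ℝ 2 μ)‖ ^ 2) =
      E.form f f + ‖(f : Lp ℝ 2 μ)‖ ^ 2 + t * E.form f f + ‖(f : Lp ℝ 2 μ)‖ ^ 2 / t := by
      field_simp
      ring
    have h4 : 0 ≤ t * E.form f f := by positivity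
    have h5 : 0 ≤ ‖(f : Lp ℝ 2 μ)‖ ^ 2 / t := by positivity
    linarith
  obtain ⟨g, hg⟩ := E.closed (fun i => E.formEquiv t (f i)) fun ε hε => by
    obtain ⟨N, hN⟩ := Metric.cauchySeq_iff.1 hf (√(ε / (1 / t + 1))) (by positivity)
    refine ⟨N, fun i hi j hj => ?_⟩
    rw [← map_sub]
    refine (key _).trans_lt ?_
    have := hN i hi j hj
    rw [dist_eq_norm] at this
    have h2 := (Real.lt_sqrt (norm_nonneg _)).1 this
    rw [lt_div_iff₀ (by positivity), mul_comm] at h2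
    exact h2
  refine ⟨(E.formEquiv t).symm g, ?_⟩
  rw [tendsto_iff_norm_sub_tendsto_zero]
  have h0 : Tendsto (fun i => ‖f i - (E.formEquiv t).symm g‖ ^ 2) atTop (𝓝 0) := by
    have hg' := hg.const_mul (t + 1 : ℝ)
    rw [mul_zero] at hg'
    refine squeeze_zero (fun i => sq_nonneg _) (fun i => ?_) hg'
    rw [formDomain_norm_sq, map_sub, LinearEquiv.apply_symm_apply]
    set f := E.formEquiv t (f i)
    have h1 := E.nonneg (f - g)
    have h2 := sq_nonneg ‖((f - g : E.domain) : Lp ℝ 2 μ)‖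
    have h3 := mul_nonneg ht'.le h2
    nlinarith
  have h1 := h0.sqrt
  simpa [Real.sqrt_sq (norm_nonneg _)] using h1

/-- The operator `u ↦ w` with `t 𝓔(w, v) + ⟨w, v⟩ = ⟨u, v⟩` for all `v ∈ 𝓕`. -/
theorem exists_resolvent {t : NNReal} (ht : 0 < t) :
    ∃ G : Lp ℝ 2 μ →L[ℝ] E.FormDomain t, ∀ u v,
      Inner.inner ℝ (G u) v = Inner.inner ℝ u (E.formEquiv t v : Lp ℝ 2 μ) := by
  have := E.complete_formDomain ht
  -- The resolvent is the adjoint of the inclusion of `𝓕` into `L²`.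
  exact ⟨(E.formIncl t).adjoint, fun u v => ContinuousLinearMap.adjoint_inner_left _ _ _⟩

/-- `t`-resolvent: `(1 + t A)⁻¹`, where `A` is the operator of the form. -/
def resolvent (t : NNReal) (ht : 0 < t) : Lp ℝ 2 μ →ₗ[ℝ] E.domain :=
  (E.formEquiv t).toLinearMap ∘ₗ (E.exists_resolvent ht).choose.toLinearMap

theorem resolvent_spec {t : NNReal} (ht : 0 < t) (u : Lp ℝ 2 μ) (v : E.domain) :
    t * E.form (E.resolvent t ht u) v +
      Inner.inner ℝ (E.resolvent t ht u : Lp ℝ 2 μ) (v : Lp ℝ 2 μ) =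
      Inner.inner ℝ u (v : Lp ℝ 2 μ) :=
  (E.exists_resolvent ht).choose_spec u ((E.formEquiv t).symm v)

/-- The range of the resolvent is dense in `𝓕`. -/
theorem dense_range_resolvent {t : NNReal} (ht : 0 < t) :
    DenseRange (fun u => (E.formEquiv t).symm (E.resolvent t ht u)) := by
  have := E.complete_formDomain ht
  let V : Submodule ℝ (E.FormDomain t) :=
    LinearMap.range ((E.formEquiv t).symm.toLinearMap ∘ₗ E.resolvent t ht)
  change Dense (V : Set (E.FormDomain t))
  rw [Submodule.dense_iff_topologicalClosure_eq_top, Submodule.topologicalClosure_eq_top_iff,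
    Submodule.eq_bot_iff]
  intro v hv
  rw [Submodule.mem_orthogonal] at hv
  -- A vector orthogonal to the range is tested against the resolvent of itself, which leaves its
  -- `L²` norm.
  have h := hv ((E.formEquiv t).symm (E.resolvent t ht (E.formIncl t v))) ⟨_, rfl⟩
  have h2 := E.resolvent_spec ht (E.formIncl t v) (E.formEquiv t v)
  rw [formDomain_inner, LinearEquiv.apply_symm_apply] at h
  rw [h] at h2
  exact (E.formEquiv t).map_eq_zero_iff.1 (Subtype.ext (inner_self_eq_zero.1 h2.symm))

/-- Variational characterization of the resolvent. -/
theorem resolvent_variational {t : NNReal} (ht : 0 < t) (u : Lp ℝ 2 μ) (v : E.domain) :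
    t * E.form v v + ‖(v : Lp ℝ 2 μ) - u‖ ^ 2 =
      t * E.form (E.resolvent t ht u) (E.resolvent t ht u) +
        ‖(E.resolvent t ht u : Lp ℝ 2 μ) - u‖ ^ 2 +
      (t * E.form (v - E.resolvent t ht u) (v - E.resolvent t ht u) +
        ‖((v - E.resolvent t ht u : E.domain) : Lp ℝ 2 μ)‖ ^ 2) := by
  set w := E.resolvent t ht u
  have h := E.resolvent_spec ht u (v - w)
  have e1 : E.form v v = E.form w w + 2 * E.form w (v - w) + E.form (v - w) (v - w) := by
    have : v = w + (v - w) := by abel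
    conv_lhs => rw [this]
    simp only [map_add, LinearMap.add_apply, map_sub, LinearMap.sub_apply]
    rw [E.symm v w]
    ring
  have e2 : (v : Lp ℝ 2 μ) - u = ((v - w : E.domain) : Lp ℝ 2 μ) + ((w : Lp ℝ 2 μ) - u) := by
    simp
  rw [e1, e2, norm_add_sq_real]
  have e3 : Inner.inner ℝ ((v - w : E.domain) : Lp ℝ 2 μ) ((w : Lp ℝ 2 μ) - u) =
      Inner.inner ℝ (w : Lp ℝ 2 μ) ((v - w : E.domain) : Lp ℝ 2 μ) -
      Inner.inner ℝ u ((v - w : E.domain) : Lp ℝ 2 μ) := by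
    rw [inner_sub_right, real_inner_comm, real_inner_comm _ u]
  change (t : ℝ) * E.form w (v - w) +
    Inner.inner ℝ (w : Lp ℝ 2 μ) ((v - w : E.domain) : Lp ℝ 2 μ) = _ at h
  rw [e3]
  linarith

theorem form_cauchy_schwarz (f g : E.domain) : E.form f g ^ 2 ≤ E.form f f * E.form g g := by
  have h : discrim (E.form g g) (2 * E.form f g) (E.form f f) ≤ 0 := by
    refine discrim_le_zero fun s => ?_
    have h := E.nonneg (f + s • g)
    simp only [map_add, LinearMap.add_apply, map_smul, LinearMap.smul_apply, smul_eq_mul] at h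
    rw [E.symm g f] at h
    nlinarith
  rw [discrim] at h
  nlinarith

/-- `𝓔(R_t u, v) → 𝓔(u, v)` as `t → 0`. -/
theorem tendsto_form_resolvent (t : ℕ → NNReal) (ht : ∀ n, 0 < t n) (ht0 : Tendsto t atTop (𝓝 0))
    (u v : E.domain) :
    Tendsto (fun n => E.form (E.resolvent (t n) (ht n) u) v) atTop (𝓝 (E.form u v)) := by
  -- Comparison with the competitor `u`, at distance zero from `u`. It yields both the uniform
  -- energy bound `hE` and the `L²` convergence `hL`.
  have hmin : ∀ n, t n * E.form (E.resolvent (t n) (ht n) u) (E.resolvent (t n) (ht n) u) +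
      ‖(E.resolvent (t n) (ht n) u : Lp ℝ 2 μ) - u‖ ^ 2 ≤ t n * E.form u u := fun n => by
    have h := E.resolvent_variational (ht n) u u
    have h1 : 0 ≤ (t n : ℝ) * E.form (u - E.resolvent (t n) (ht n) u)
      (u - E.resolvent (t n) (ht n) u) := mul_nonneg (t n).2 (E.nonneg _)
    have h2 := sq_nonneg ‖((u - E.resolvent (t n) (ht n) u : E.domain) : Lp ℝ 2 μ)‖
    simp only [sub_self, norm_zero] at h
    linarith
  have hE : ∀ n, E.form (E.resolvent (t n) (ht n) u) (E.resolvent (t n) (ht n) u) ≤ E.form u u :=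
    fun n => by
      have h := hmin n
      have h2 := sq_nonneg ‖(E.resolvent (t n) (ht n) u : Lp ℝ 2 μ) - u‖
      have h3 : (0 : ℝ) < t n := ht n
      nlinarith
  have hL : Tendsto (fun n => ‖(E.resolvent (t n) (ht n) u : Lp ℝ 2 μ) - u‖) atTop (𝓝 0) := by
    have h0 : Tendsto (fun n => (t n : ℝ) * E.form u u) atTop (𝓝 0) := by
      have : Tendsto (fun n => (t n : ℝ)) atTop (𝓝 0) := by
        simpa using NNReal.tendsto_coe.2 ht0
      simpa using this.mul_const (E.form u u)
    have h1 : Tendsto (fun n => ‖(E.resolvent (t n) (ht n) u : Lp ℝ 2 μ) - u‖ ^ 2) atTop (𝓝 0) :=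
      squeeze_zero (fun n => sq_nonneg _) (fun n => by
        have h := hmin n
        have h3 := mul_nonneg (t n).2 (E.nonneg (E.resolvent (t n) (ht n) u))
        change 0 ≤ (t n : ℝ) * _ at h3
        linarith) h0
    simpa [Real.sqrt_sq (norm_nonneg _)] using h1.sqrt
  rw [Metric.tendsto_atTop]
  intro ε hε
  -- The vector `v` is replaced by a nearby `w` in the range of the resolvent. The error is at most
  -- `2 √𝓔(u,u) η`, because the energy of `R_t u - u` never exceeds `4 𝓔(u,u)`.
  obtain ⟨η, hη, hη'⟩ : ∃ η > 0, 2 * √(E.form u u) * η < ε / 2 :=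
    ⟨ε / (8 * (√(E.form u u) + 1)), by positivity, by
      rw [mul_div_assoc', div_lt_iff₀ (by positivity)]
      nlinarith [Real.sqrt_nonneg (E.form u u)]⟩
  obtain ⟨h, hw⟩ := (E.dense_range_resolvent one_pos).exists_dist_lt ((E.formEquiv 1).symm v) hη
  set w := E.resolvent 1 one_pos h with hwdef
  have hvw : E.form (v - w) (v - w) < η ^ 2 := by
    rw [dist_eq_norm, ← map_sub] at hw
    have h1 := formDomain_norm_sq ((E.formEquiv 1).symm (v - w))
    have h2 := sq_nonneg ‖((v - w : E.domain) : Lp ℝ 2 μ)‖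
    have h3 : ‖(E.formEquiv 1).symm (v - w)‖ ^ 2 < η ^ 2 := by
      have := norm_nonneg ((E.formEquiv 1).symm (v - w))
      gcongr
    rw [h1, LinearEquiv.apply_symm_apply] at h3
    simp only [NNReal.coe_one, one_mul] at h3
    linarith
  obtain ⟨N, hN⟩ := (Metric.tendsto_atTop.1 (hL.const_mul (‖h - (w : Lp ℝ 2 μ)‖))) (ε / 2)
    (by positivity)
  refine ⟨N, fun n hn => ?_⟩
  have hNn := hN n hn
  set p := E.resolvent (t n) (ht n) u with hp
  rw [mul_zero, Real.dist_0_eq_abs, abs_of_nonneg (by positivity)] at hNn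
  rw [Real.dist_eq, ← LinearMap.sub_apply, ← map_sub]
  have e : E.form (p - u) v = E.form (p - u) (v - w) + E.form (p - u) w := by
    rw [map_sub (E.form (p - u))]; ring
  have b1 : |E.form (p - u) (v - w)| ≤ 2 * √(E.form u u) * η := by
    have h1 := E.form_cauchy_schwarz (p - u) (v - w)
    have h2 : E.form (p - u) (p - u) ≤ 4 * E.form u u := by
      have h3 := E.nonneg (p + u)
      have h4 := hE n
      simp only [map_add, LinearMap.add_apply, map_sub, LinearMap.sub_apply] at h3 ⊢
      rw [← hp] at h4
      linarith
    refine abs_le_of_sq_le_sq ?_ (by positivity)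
    have h4 : (2 * √(E.form u u) * η) ^ 2 = 4 * E.form u u * η ^ 2 := by
      rw [mul_pow, mul_pow, Real.sq_sqrt (E.nonneg u)]; ring
    rw [h4]
    exact h1.trans (mul_le_mul h2 hvw.le (E.nonneg _) (by linarith [E.nonneg u]))
  -- Against `w = R_1 h` the form is an `L²` pairing with `h - w`, so `L²` convergence is enough.
  have b2 : |E.form (p - u) w| ≤ ‖h - (w : Lp ℝ 2 μ)‖ * ‖(p : Lp ℝ 2 μ) - u‖ := by
    have h1 := E.resolvent_spec one_pos h (p - u)
    rw [← hwdef, NNReal.coe_one, one_mul] at h1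
    have h2 : E.form (p - u) w = Inner.inner ℝ (h - (w : Lp ℝ 2 μ)) ((p : Lp ℝ 2 μ) - u) := by
      rw [E.symm, inner_sub_left]
      simp only [Submodule.coe_sub] at h1 
      linarith
    rw [h2]
    exact abs_real_inner_le_norm _ _
  rw [e]
  calc _ ≤ _ := abs_add_le _ _
    _ < ε := by linarith

/-- The resolvent is Markovian. -/
theorem resolvent_markov {t : NNReal} (ht : 0 < t) (u : Lp ℝ 2 μ)
    (hu : ∀ᵐ x ∂μ, u x ∈ Icc (0 : ℝ) 1) :
    ∀ᵐ x ∂μ, (E.resolvent t ht u : Lp ℝ 2 μ) x ∈ Icc (0 : ℝ) 1 := by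
  set w := E.resolvent t ht u with hw
  -- The truncation `v` of the minimiser `w` has no more energy and is no farther from `u`, as `u`
  -- already takes values in `[0, 1]`. By the variational identity the minimiser is unique, so `v =
  -- w`.
  obtain ⟨v, hv, hvw⟩ := E.markov w
  have h1 : ‖(v : Lp ℝ 2 μ) - u‖ ≤ ‖(w : Lp ℝ 2 μ) - u‖ := by
    refine Lp.norm_le_norm_of_ae_le ?_
    filter_upwards [hv, hu, Lp.coeFn_sub (v : Lp ℝ 2 μ) u, Lp.coeFn_sub (w : Lp ℝ 2 μ) u]
      with x h1 h2 h3 h4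
    rw [h3, h4, Pi.sub_apply, Pi.sub_apply, h1, Real.norm_eq_abs, Real.norm_eq_abs]
    have e : u x = min (max 0 (u x)) 1 := by
      rw [max_eq_right h2.1, min_eq_left h2.2]
    conv_lhs => rw [e]
    refine (abs_min_sub_min_le_max _ _ _ _).trans ?_
    rw [sub_self, abs_zero, max_eq_left (abs_nonneg _)]
    refine (abs_max_sub_max_le_max _ _ _ _).trans ?_
    rw [sub_self, abs_zero, max_eq_right (abs_nonneg _)]
  have h2 := E.resolvent_variational ht u v
  rw [← hw] at h2
  have h3 : ‖((v - w : E.domain) : Lp ℝ 2 μ)‖ ^ 2 ≤ 0 := by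
    have h4 := mul_le_mul_of_nonneg_left hvw t.2
    have h5 := mul_nonneg t.2 (E.nonneg (v - w))
    change (t : ℝ) * _ ≤ t * _ at h4
    change 0 ≤ (t : ℝ) * _ at h5
    have h6 : ‖(v : Lp ℝ 2 μ) - u‖ ^ 2 ≤ ‖(w : Lp ℝ 2 μ) - u‖ ^ 2 := by gcongr
    linarith
  have h4 : v = w := by
    have := norm_eq_zero.1 (pow_eq_zero_iff two_ne_zero |>.1 (le_antisymm h3 (sq_nonneg _)))
    exact sub_eq_zero.1 (Subtype.ext this)
  rw [h4] at hv
  filter_upwards [hv] with x hx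
  rw [hx]
  exact ⟨le_min (le_max_left _ _) zero_le_one, min_le_right _ _⟩

end Hilbert

end DirichletForm

/-! ## Calculus in the Dirichlet space -/

namespace DirichletForm

section Calculus

variable {X : Type u} [MeasurableSpace X] {μ : Measure X} (E : DirichletForm μ)

variable {E}

/-! ### Energy of functions through their classes in `𝓕` -/

theorem ext_of_ae {w v : E.domain} {f : X → ℝ} (hw : ((w : Lp ℝ 2 μ) : X → ℝ) =ᵐ[μ] f)
    (hv : ((v : Lp ℝ 2 μ) : X → ℝ) =ᵐ[μ] f) : w = v :=
  Subtype.ext (Lp.ext (hw.trans hv.symm))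

/-- Makes the representatives chosen in `energy` irrelevant: an element of `𝓕` is determined by its
values almost everywhere. -/
theorem energy_eq {f g : X → ℝ} {w v : E.domain} (hw : ((w : Lp ℝ 2 μ) : X → ℝ) =ᵐ[μ] f)
    (hv : ((v : Lp ℝ 2 μ) : X → ℝ) =ᵐ[μ] g) : E.energy f g = E.form w v := by
  have h : E.Mem f ∧ E.Mem g := ⟨⟨w, hw⟩, ⟨v, hv⟩⟩
  rw [energy, dif_pos h, ext_of_ae h.1.choose_spec hw, ext_of_ae h.2.choose_spec hv]

theorem add_ae {w v : E.domain} {f g : X → ℝ} (hw : ((w : Lp ℝ 2 μ) : X → ℝ) =ᵐ[μ] f)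
    (hv : ((v : Lp ℝ 2 μ) : X → ℝ) =ᵐ[μ] g) :
    (((w + v : E.domain) : Lp ℝ 2 μ) : X → ℝ) =ᵐ[μ] f + g := by
  rw [Submodule.coe_add]
  exact (Lp.coeFn_add _ _).trans (hw.add hv)

theorem sub_ae {w v : E.domain} {f g : X → ℝ} (hw : ((w : Lp ℝ 2 μ) : X → ℝ) =ᵐ[μ] f)
    (hv : ((v : Lp ℝ 2 μ) : X → ℝ) =ᵐ[μ] g) :
    (((w - v : E.domain) : Lp ℝ 2 μ) : X → ℝ) =ᵐ[μ] f - g := by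
  rw [Submodule.coe_sub]
  exact (Lp.coeFn_sub _ _).trans (hw.sub hv)

theorem smul_ae {w : E.domain} {f : X → ℝ} (c : ℝ) (hw : ((w : Lp ℝ 2 μ) : X → ℝ) =ᵐ[μ] f) :
    (((c • w : E.domain) : Lp ℝ 2 μ) : X → ℝ) =ᵐ[μ] c • f := by
  rw [Submodule.coe_smul]
  exact (Lp.coeFn_smul _ _).trans (hw.const_smul c)

theorem Mem.zero : E.Mem 0 := ⟨0, by simpa using Lp.coeFn_zero ℝ 2 μ⟩

theorem Mem.congr {f g : X → ℝ} (hf : E.Mem f) (h : f =ᵐ[μ] g) : E.Mem g :=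
  hf.imp fun _ hw => hw.trans h

theorem Mem.add {f g : X → ℝ} (hf : E.Mem f) (hg : E.Mem g) : E.Mem (f + g) := by
  obtain ⟨w, hw⟩ := hf
  obtain ⟨v, hv⟩ := hg
  exact ⟨w + v, add_ae hw hv⟩

theorem Mem.sub {f g : X → ℝ} (hf : E.Mem f) (hg : E.Mem g) : E.Mem (f - g) := by
  obtain ⟨w, hw⟩ := hf
  obtain ⟨v, hv⟩ := hg
  exact ⟨w - v, sub_ae hw hv⟩

theorem Mem.smul {f : X → ℝ} (c : ℝ) (hf : E.Mem f) : E.Mem (c • f) := by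
  obtain ⟨w, hw⟩ := hf
  exact ⟨c • w, smul_ae c hw⟩

theorem energy_comm (f g : X → ℝ) : E.energy f g = E.energy g f := by
  by_cases h : E.Mem f ∧ E.Mem g
  · obtain ⟨⟨w, hw⟩, v, hv⟩ := h
    rw [energy_eq hw hv, energy_eq hv hw, E.symm]
  · rw [energy, energy, dif_neg h, dif_neg fun h' => h h'.symm]

theorem energy_self_nonneg (f : X → ℝ) : 0 ≤ E.energy f f := by
  by_cases h : E.Mem f
  · obtain ⟨w, hw⟩ := h
    rw [energy_eq hw hw]
    exact E.nonneg w
  · rw [energy, dif_neg fun h' => h h'.1]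

theorem energy_add_left {f g h : X → ℝ} (hf : E.Mem f) (hg : E.Mem g) (hh : E.Mem h) :
    E.energy (f + g) h = E.energy f h + E.energy g h := by
  obtain ⟨w, hw⟩ := hf
  obtain ⟨v, hv⟩ := hg
  obtain ⟨z, hz⟩ := hh
  rw [energy_eq (add_ae hw hv) hz, energy_eq hw hz, energy_eq hv hz, map_add, LinearMap.add_apply]

theorem energy_sub_left {f g h : X → ℝ} (hf : E.Mem f) (hg : E.Mem g) (hh : E.Mem h) :
    E.energy (f - g) h = E.energy f h - E.energy g h := by
  obtain ⟨w, hw⟩ := hf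
  obtain ⟨v, hv⟩ := hg
  obtain ⟨z, hz⟩ := hh
  rw [energy_eq (sub_ae hw hv) hz, energy_eq hw hz, energy_eq hv hz, map_sub, LinearMap.sub_apply]

theorem energy_smul_left {f h : X → ℝ} (c : ℝ) (hf : E.Mem f) (hh : E.Mem h) :
    E.energy (c • f) h = c * E.energy f h := by
  obtain ⟨w, hw⟩ := hf
  obtain ⟨z, hz⟩ := hh
  rw [energy_eq (smul_ae c hw) hz, energy_eq hw hz, map_smul, LinearMap.smul_apply, smul_eq_mul]

theorem energy_add_right {f g h : X → ℝ} (hf : E.Mem f) (hg : E.Mem g) (hh : E.Mem h) :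
    E.energy h (f + g) = E.energy h f + E.energy h g := by
  rw [energy_comm, energy_add_left hf hg hh, energy_comm f, energy_comm g]

theorem energy_smul_right {f h : X → ℝ} (c : ℝ) (hf : E.Mem f) (hh : E.Mem h) :
    E.energy h (c • f) = c * E.energy h f := by
  rw [energy_comm, energy_smul_left c hf hh, energy_comm f]

/-! ### Truncation -/

/-- The Markov property at level `1` is applied to `c⁻¹ f` and scaled back; the factors `c²` and
`c⁻²` cancel in the energy. -/
theorem Mem.trunc {f : X → ℝ} (hf : E.Mem f) {c : ℝ} (hc : 0 < c) :
    E.Mem (fun x => min (max 0 (f x)) c) ∧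
      E.energy (fun x => min (max 0 (f x)) c) (fun x => min (max 0 (f x)) c) ≤ E.energy f f := by
  obtain ⟨w, hw⟩ := hf
  obtain ⟨v, hv, hvw⟩ := E.markov (c⁻¹ • w)
  have h : (((c • v : E.domain) : Lp ℝ 2 μ) : X → ℝ) =ᵐ[μ] fun x => min (max 0 (f x)) c := by
    filter_upwards [smul_ae c hv, smul_ae c⁻¹ hw] with x h1 h2
    rw [h1]
    simp only [Pi.smul_apply, smul_eq_mul] at h2 ⊢
    rw [h2, mul_min_of_nonneg _ _ hc.le, mul_max_of_nonneg _ _ hc.le]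
    congr 1
    · rw [mul_zero, mul_inv_cancel_left₀ hc.ne']
    · rw [mul_one]
  refine ⟨⟨_, h⟩, ?_⟩
  rw [energy_eq h h, energy_eq hw hw]
  simp only [map_smul, LinearMap.smul_apply, smul_eq_mul] at hvw ⊢
  have h2 := mul_le_mul_of_nonneg_left hvw (mul_pos hc hc).le
  have h3 : c * c * (c⁻¹ * (c⁻¹ * E.form w w)) = E.form w w := by field_simp
  linarith

theorem Mem.posPart {f : X → ℝ} (hf : E.Mem f) {C : ℝ} (hC : ∀ x, f x ≤ C) :
    E.Mem (fun x => max 0 (f x)) := by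
  have h := (hf.trunc (c := max C 1) (by positivity)).1
  convert h using 2 with x
  rw [min_eq_left]
  exact max_le (by positivity) ((hC x).trans (le_max_left _ _))

/-! ### Products -/

/-- The tent map on `[0, 1]`. -/
def tent (t : ℝ) : ℝ := 4 * min t (1 / 2) - 2 * t

theorem tent_mem {t : ℝ} (ht : t ∈ Icc (0 : ℝ) 1) : tent t ∈ Icc (0 : ℝ) 1 := by
  obtain ⟨h0, h1⟩ := ht
  rw [tent]
  rcases le_total t (1 / 2) with h | h
  · rw [min_eq_left h]; constructor <;> linarith
  · rw [min_eq_right h]; constructor <;> linarith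

theorem tent_abs_le {t : ℝ} (ht : t ∈ Icc (0 : ℝ) 1) : |tent t| ≤ 2 * |t| := by
  rw [abs_of_nonneg (tent_mem ht).1, abs_of_nonneg ht.1, tent]
  linarith [min_le_left t (1 / 2)]

theorem tent_iterate_mem {t : ℝ} (ht : t ∈ Icc (0 : ℝ) 1) (n : ℕ) :
    tent^[n] t ∈ Icc (0 : ℝ) 1 := by
  induction n with
  | zero => exact ht
  | succ n ih => rw [Function.iterate_succ_apply']; exact tent_mem ih

/-- Self-similarity of the parabola under the tent map. Iterated, it expands `t - t²` as the
Takagi-type series `∑ 4^{-k} tent^k(t)`, so squares are obtained from truncations and linear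
combinations alone. -/
theorem sub_sq_eq_tent {t : ℝ} :
    t - t * t = 1 / 4 * tent t + 1 / 4 * (tent t - tent t * tent t) := by
  rw [tent]
  rcases le_total t (1 / 2) with h | h
  · rw [min_eq_left h]; ring
  · rw [min_eq_right h]; ring

theorem sub_sq_eq_sum_tent {t : ℝ} (n : ℕ) :
    t - t * t = ∑ k ∈ Finset.range n, (1 / 4 : ℝ) ^ (k + 1) * tent^[k + 1] t +
      (1 / 4 : ℝ) ^ n * (tent^[n] t - tent^[n] t * tent^[n] t) := by
  induction n with
  | zero => simp
  | succ n ih =>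
    rw [ih, sub_sq_eq_tent (t := tent^[n] t), Finset.sum_range_succ,
      ← Function.iterate_succ_apply' tent n t]
    ring

theorem tendsto_sum_tent {t : ℝ} (ht : t ∈ Icc (0 : ℝ) 1) :
    Tendsto (fun n => ∑ k ∈ Finset.range n, (1 / 4 : ℝ) ^ (k + 1) * tent^[k + 1] t) atTop
      (𝓝 (t - t * t)) := by
  have h0 : Tendsto (fun n : ℕ => (1 / 4 : ℝ) ^ n) atTop (𝓝 0) :=
    tendsto_pow_atTop_nhds_zero_of_lt_one (by norm_num) (by norm_num)
  have h1 : Tendsto (fun n : ℕ => (1 / 4 : ℝ) ^ n * (tent^[n] t - tent^[n] t * tent^[n] t)) atTop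
      (𝓝 0) := by
    refine squeeze_zero (fun n => ?_) (fun n => ?_) h0
    · have := tent_iterate_mem ht n
      exact mul_nonneg (by positivity) (by nlinarith [this.1, this.2])
    · have := tent_iterate_mem ht n
      exact mul_le_of_le_one_right (by positivity) (by nlinarith [this.1, this.2])
  have h2 := (tendsto_const_nhds (x := t - t * t)).sub h1
  rw [sub_zero] at h2
  refine h2.congr fun n => ?_
  rw [sub_sq_eq_sum_tent n]
  ring

/-- If `f ≥ 0` then `𝓔(f ∧ c, (f - c)⁺) ≥ 0`. -/
theorem form_trunc_nonneg {f : X → ℝ} (hf0 : ∀ x, 0 ≤ f x) {c : ℝ} (hc : 0 < c) {w v : E.domain}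
    (hw : ((w : Lp ℝ 2 μ) : X → ℝ) =ᵐ[μ] f)
    (hv : ((v : Lp ℝ 2 μ) : X → ℝ) =ᵐ[μ] fun x => min (f x) c) : 0 ≤ E.form v (w - v) := by
  -- Truncating `f ∧ c + s (f - c)⁺` at height `c` gives back `f ∧ c`. Since truncation does not
  -- increase energy, expanding the square and dividing by `s` leaves this inequality; then `s → 0`.
  have key : ∀ s : ℝ, 0 < s → 0 ≤ 2 * E.form v (w - v) + s * E.form (w - v) (w - v) := by
    intro s hs
    have h1 := add_ae hv (smul_ae s (sub_ae hw hv))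
    have h2 := (Mem.trunc ⟨_, h1⟩ hc).2
    have h3 : (fun x => min (max 0 (((fun x => min (f x) c) +
        s • (f - fun x => min (f x) c) : X → ℝ) x)) c) = fun x => min (f x) c := by
      ext x
      simp only [Pi.add_apply, Pi.smul_apply, Pi.sub_apply, smul_eq_mul]
      rcases le_total (f x) c with h | h
      · rw [min_eq_left h, sub_self, mul_zero, add_zero, max_eq_right (hf0 x), min_eq_left h]
      · rw [min_eq_right h]
        have : 0 ≤ s * (f x - c) := mul_nonneg hs.le (by linarith)
        rw [max_eq_right (by linarith), min_eq_right (by linarith)]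
    rw [h3, energy_eq hv hv, energy_eq h1 h1] at h2
    simp only [map_add, LinearMap.add_apply, map_smul, LinearMap.smul_apply, smul_eq_mul] at h2
    rw [E.symm (w - v) v] at h2
    have h4 : 0 ≤ s * (2 * E.form v (w - v) + s * E.form (w - v) (w - v)) := by linarith
    exact nonneg_of_mul_nonneg_right h4 hs
  have hlim : Tendsto (fun s : ℝ => 2 * E.form v (w - v) + s * E.form (w - v) (w - v)) (𝓝[>] 0)
      (𝓝 (2 * E.form v (w - v) + 0 * E.form (w - v) (w - v))) :=
    (Continuous.tendsto (by fun_prop) 0).mono_left nhdsWithin_le_nhds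
  have := ge_of_tendsto hlim (eventually_nhdsWithin_of_forall key)
  linarith

/-- With `v = f ∧ ½` one has `tent f = 2 (v - (f - v))`, while `f = v + (f - v)`. The mixed term
`𝓔(v, f - v)` is nonnegative, so changing the sign of `f - v` does not raise the energy, and the
factor `2` is the only loss. -/
theorem exists_tent {f : X → ℝ} (hf : ∀ x, f x ∈ Icc (0 : ℝ) 1) (w : E.FormDomain 1)
    (hw : ((E.formEquiv 1 w : Lp ℝ 2 μ) : X → ℝ) =ᵐ[μ] f) :
    ∃ w' : E.FormDomain 1, ((E.formEquiv 1 w' : Lp ℝ 2 μ) : X → ℝ) =ᵐ[μ] (fun x => tent (f x)) ∧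
      ‖w'‖ ≤ 2 * ‖w‖ := by
  set z := E.formEquiv 1 w with hz
  obtain ⟨v, hv⟩ := (Mem.trunc ⟨z, hw⟩ (c := 1 / 2) (by norm_num)).1
  have hv' : ((v : Lp ℝ 2 μ) : X → ℝ) =ᵐ[μ] fun x => min (f x) (1 / 2) := by
    refine hv.trans (.of_forall fun x => ?_)
    simp only [max_eq_right (hf x).1]
  have h1 : (((((4 : ℝ) • v - (2 : ℝ) • z : E.domain)) : Lp ℝ 2 μ) : X → ℝ) =ᵐ[μ]
      fun x => tent (f x) :=
    sub_ae (smul_ae 4 hv') (smul_ae 2 hw)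
  refine ⟨(E.formEquiv 1).symm ((4 : ℝ) • v - (2 : ℝ) • z), by simpa using h1, ?_⟩
  refine (sq_le_sq₀ (norm_nonneg _) (by positivity)).1 ?_
  rw [mul_pow, formDomain_norm_sq, formDomain_norm_sq w, LinearEquiv.apply_symm_apply, ← hz,
    NNReal.coe_one, one_mul, one_mul]
  have hE : E.form ((4 : ℝ) • v - (2 : ℝ) • z) ((4 : ℝ) • v - (2 : ℝ) • z) ≤ 4 * E.form z z := by
    have h := form_trunc_nonneg (fun x => (hf x).1) (by norm_num) hw hv'
    simp only [map_sub, LinearMap.sub_apply, map_smul, LinearMap.smul_apply, smul_eq_mul] at h ⊢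
    rw [E.symm z v]
    linarith
  have hL : ‖(((4 : ℝ) • v - (2 : ℝ) • z : E.domain) : Lp ℝ 2 μ)‖ ≤ 2 * ‖(z : Lp ℝ 2 μ)‖ := by
    refine Lp.norm_le_mul_norm_of_ae_le_mul ?_
    filter_upwards [h1, hw] with x h1 h2
    rw [h1, h2, Real.norm_eq_abs, Real.norm_eq_abs]
    exact tent_abs_le (hf x)
  have hL' := pow_le_pow_left₀ (norm_nonneg _) hL 2
  rw [mul_pow] at hL'
  linarith

/-- Limits in `𝓕` that are also pointwise limits. -/
theorem ae_eq_of_tendsto {t : NNReal} {w : ℕ → E.FormDomain t} {v : E.FormDomain t}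
    (hwv : Tendsto w atTop (𝓝 v)) {f : ℕ → X → ℝ} {g : X → ℝ}
    (hf : ∀ n, ((E.formEquiv t (w n) : Lp ℝ 2 μ) : X → ℝ) =ᵐ[μ] f n)
    (hfg : ∀ x, Tendsto (fun n => f n x) atTop (𝓝 (g x))) :
    ((E.formEquiv t v : Lp ℝ 2 μ) : X → ℝ) =ᵐ[μ] g := by
  have h1 : Tendsto (fun n => E.formIncl t (w n)) atTop (𝓝 (E.formIncl t v)) :=
    ((E.formIncl t).continuous.tendsto v).comp hwv
  obtain ⟨ns, hns, h2⟩ := (tendstoInMeasure_of_tendsto_Lp h1).exists_seq_tendsto_ae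
  have h3 : ∀ᵐ x ∂μ, ∀ n, E.formIncl t (w n) x = f n x := ae_all_iff.2 hf
  filter_upwards [h2, h3] with x hx hx3
  refine tendsto_nhds_unique hx ?_
  simp only [hx3]
  exact (hfg x).comp hns.tendsto_atTop

/-- The `k`-th iterate of the tent map applied to `f` has `𝓔₁`-norm at most `2^k` times that of `f`,
against the coefficient `4^{-k}`. The series for `f - f²` thus converges absolutely in the Hilbert
space `𝓕`, and its limit there agrees with the pointwise one. -/
theorem Mem.mul_self_of_unit {f : X → ℝ} (hf : E.Mem f) (hf1 : ∀ x, f x ∈ Icc (0 : ℝ) 1) :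
    E.Mem (f * f) := by
  obtain ⟨w, hw⟩ := hf
  have h1 : ∀ k : ℕ, ∃ w' : E.FormDomain 1, ((E.formEquiv 1 w' : Lp ℝ 2 μ) : X → ℝ) =ᵐ[μ]
      (fun x => tent^[k] (f x)) ∧ ‖w'‖ ≤ 2 ^ k * ‖(E.formEquiv 1).symm w‖ := by
    intro k
    induction k with
    | zero => exact ⟨(E.formEquiv 1).symm w, by simpa using hw, by simp⟩
    | succ k ih =>
      obtain ⟨w', h1, h2⟩ := ih
      obtain ⟨w'', h3, h4⟩ := exists_tent (fun x => tent_iterate_mem (hf1 x) k) w' h1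
      refine ⟨w'', ?_, ?_⟩
      · simpa only [Function.iterate_succ_apply'] using h3
      · rw [pow_succ]
        linarith
  choose z hz hz' using h1
  have := E.complete_formDomain one_pos
  have hs : Summable fun k => (1 / 4 : ℝ) ^ (k + 1) • z (k + 1) := by
    refine Summable.of_norm_bounded (g := fun k : ℕ => (1 / 2 : ℝ) ^ (k + 1) *
      ‖(E.formEquiv 1).symm w‖) ?_ fun k => ?_
    · exact (((summable_nat_add_iff 1).2 summable_geometric_two)).mul_right _
    · rw [norm_smul, Real.norm_of_nonneg (by positivity)]
      calc (1 / 4 : ℝ) ^ (k + 1) * ‖z (k + 1)‖ ≤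
          (1 / 4 : ℝ) ^ (k + 1) * (2 ^ (k + 1) * ‖(E.formEquiv 1).symm w‖) := by
            gcongr
            exact hz' _
        _ = _ := by
          rw [← mul_assoc, ← mul_pow]
          norm_num
  have h2 := ae_eq_of_tendsto hs.hasSum.tendsto_sum_nat
    (f := fun n x => ∑ k ∈ Finset.range n, (1 / 4 : ℝ) ^ (k + 1) * tent^[k + 1] (f x))
    (g := f - f * f) (fun n => ?_) (fun x => tendsto_sum_tent (hf1 x))
  · have h3 := Mem.sub ⟨w, hw⟩ ⟨_, h2⟩
    rwa [sub_sub_cancel] at h3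
  · induction n with
    | zero =>
      simp only [Finset.range_zero, Finset.sum_empty, map_zero]
      exact Lp.coeFn_zero ℝ 2 μ
    | succ n ih =>
      simp only [Finset.sum_range_succ, map_add, map_smul]
      exact add_ae ih (smul_ae _ (hz (n + 1)))

/-- The positive and negative parts are rescaled to take values in `[0, 1]`; the square of `f` is
the sum of their squares. -/
theorem Mem.mul_self {f : X → ℝ} (hf : E.Mem f) {C : ℝ} (hC : ∀ x, |f x| ≤ C) :
    E.Mem (f * f) := by
  have pos : ∀ g : X → ℝ, E.Mem g → (∀ x, g x ≤ C) →
      E.Mem ((fun x => max 0 (g x)) * fun x => max 0 (g x)) := by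
    intro g hg hgC
    have hD : 0 < max C 1 := by positivity
    have h := ((hg.posPart hgC).smul (max C 1)⁻¹).mul_self_of_unit fun x => by
      simp only [Pi.smul_apply, smul_eq_mul]
      constructor
      · positivity
      · rw [inv_mul_le_one₀ hD]
        exact max_le (by positivity) ((hgC x).trans (le_max_left _ _))
    have h2 := h.smul (max C 1 * max C 1)
    convert h2 using 1
    ext x
    simp only [Pi.mul_apply, Pi.smul_apply, smul_eq_mul]
    field_simp
  have h1 := pos f hf fun x => (le_abs_self _).trans (hC x)
  have h2 := pos ((-1 : ℝ) • f) (hf.smul _) fun x => by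
    simpa using (neg_le_abs _).trans (hC x)
  convert h1.add h2 using 1
  ext x
  simp only [Pi.add_apply, Pi.mul_apply, Pi.smul_apply, smul_eq_mul]
  rcases le_total 0 (f x) with h | h
  · rw [max_eq_right h, max_eq_left (by linarith)]; ring
  · rw [max_eq_left h, max_eq_right (by linarith)]; ring

theorem Mem.mul {f g : X → ℝ} (hf : E.Mem f) (hg : E.Mem g) {C D : ℝ} (hC : ∀ x, |f x| ≤ C)
    (hD : ∀ x, |g x| ≤ D) : E.Mem (f * g) := by
  have h1 := (hf.add hg).mul_self (C := C + D) fun x =>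
    (abs_add_le _ _).trans (add_le_add (hC x) (hD x))
  have h2 := (hf.sub hg).mul_self (C := C + D) fun x =>
    (abs_sub _ _).trans (add_le_add (hC x) (hD x))
  convert (h1.sub h2).smul (1 / 4) using 1
  ext x
  simp only [Pi.add_apply, Pi.mul_apply, Pi.smul_apply, Pi.sub_apply, smul_eq_mul]
  ring

/-! ### Positivity of the energy functional -/

theorem resolvent_mem_Icc {t : NNReal} (ht : 0 < t) (u : Lp ℝ 2 μ) {c : ℝ} (hc : 0 ≤ c)
    (hu : ∀ᵐ x ∂μ, u x ∈ Icc (0 : ℝ) c) :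
    ∀ᵐ x ∂μ, (E.resolvent t ht u : Lp ℝ 2 μ) x ∈ Icc (0 : ℝ) c := by
  rcases hc.eq_or_lt with rfl | hc
  · have : u = 0 := by
      refine Lp.ext ?_
      filter_upwards [hu, Lp.coeFn_zero ℝ 2 μ] with x h1 h2
      rw [h2]
      exact le_antisymm h1.2 h1.1
    rw [this, map_zero]
    filter_upwards [Lp.coeFn_zero ℝ 2 μ] with x hx
    simp only [Submodule.coe_zero]
    rw [hx]
    simp
  · have h := E.resolvent_markov ht (c⁻¹ • u) (by
      filter_upwards [hu, Lp.coeFn_smul c⁻¹ u] with x h1 h2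
      rw [h2, Pi.smul_apply, smul_eq_mul]
      exact ⟨mul_nonneg (by positivity) h1.1, by rw [inv_mul_le_one₀ hc]; exact h1.2⟩)
    rw [map_smul, Submodule.coe_smul] at h
    filter_upwards [h, Lp.coeFn_smul c⁻¹ (E.resolvent t ht u : Lp ℝ 2 μ)] with x h1 h2
    rw [h2, Pi.smul_apply, smul_eq_mul] at h1
    refine ⟨?_, ?_⟩
    · have := mul_nonneg hc.le h1.1
      rwa [mul_inv_cancel_left₀ hc.ne'] at this
    · exact (inv_mul_le_one₀ hc).1 h1.2

/-- Apply the two-sided bound to the positive and the negative part separately: the image of the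
first is at most `c`, that of the second is nonnegative. The bound `M` serves only to bring the
negative part under that lemma. -/
theorem resolvent_le {t : NNReal} (ht : 0 < t) (u : Lp ℝ 2 μ) {c M : ℝ} (hc : 0 ≤ c)
    (hM : ∀ᵐ x ∂μ, |u x| ≤ M) (hu : ∀ᵐ x ∂μ, u x ≤ c) :
    ∀ᵐ x ∂μ, (E.resolvent t ht u : Lp ℝ 2 μ) x ≤ c := by
  have hdec : u = Lp.posPart u - Lp.negPart u := by
    refine Lp.ext ?_
    filter_upwards [Lp.coeFn_sub (Lp.posPart u) (Lp.negPart u), Lp.coeFn_posPart u,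
      Lp.coeFn_negPart u] with x h1 h2 h3
    rw [h1, Pi.sub_apply, h2, h3, sub_neg_eq_add, max_add_min, add_zero]
  have h1 := resolvent_mem_Icc (E := E) ht (Lp.posPart u) hc (by
    filter_upwards [hu, Lp.coeFn_posPart u] with x h1 h2
    rw [h2]
    exact ⟨le_max_right _ _, max_le h1 hc⟩)
  have h2 := resolvent_mem_Icc (E := E) ht (Lp.negPart u) (abs_nonneg M) (by
    filter_upwards [hM, Lp.coeFn_negPart u] with x h1 h2
    rw [h2]
    refine ⟨by linarith [min_le_right (u x) 0], ?_⟩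
    rw [neg_le]
    exact le_min (by linarith [neg_abs_le (u x), le_abs_self M]) (by linarith [abs_nonneg M]))
  rw [hdec, map_sub, Submodule.coe_sub]
  filter_upwards [h1, h2, Lp.coeFn_sub (E.resolvent t ht (Lp.posPart u) : Lp ℝ 2 μ)
    (E.resolvent t ht (Lp.negPart u))] with x h1 h2 h3
  rw [h3, Pi.sub_apply]
  linarith [h1.2, h2.1]

/-- The resolvent acts like a sub-Markov kernel, and this is the average of `(u(x) - u(·))²`, the
kernel's missing mass being counted in favour. No kernel is needed: apply the resolvent to `2au - u²
≤ a²` for rational `a`, collect the null sets, and take `a = u(x)` by density. -/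
theorem resolvent_sq {t : NNReal} (ht : 0 < t) {u v : Lp ℝ 2 μ} {C : ℝ}
    (hC : ∀ᵐ x ∂μ, |u x| ≤ C) (huv : ∀ᵐ x ∂μ, v x = u x * u x) :
    ∀ᵐ x ∂μ, 0 ≤ u x * u x - 2 * (u x * (E.resolvent t ht u : Lp ℝ 2 μ) x) +
      (E.resolvent t ht v : Lp ℝ 2 μ) x := by
  have key : ∀ a : ℚ, ∀ᵐ x ∂μ, 2 * a * (E.resolvent t ht u : Lp ℝ 2 μ) x -
      (E.resolvent t ht v : Lp ℝ 2 μ) x ≤ a ^ 2 := by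
    intro a
    have h := resolvent_le (E := E) ht ((2 * a : ℝ) • u - v) (c := (a : ℝ) ^ 2)
      (M := |2 * (a : ℝ)| * C + C * C) (sq_nonneg _) (by
        filter_upwards [hC, huv, Lp.coeFn_sub ((2 * a : ℝ) • u) v, Lp.coeFn_smul (2 * a : ℝ) u]
          with x h1 h2 h3 h4
        rw [h3, Pi.sub_apply, h4, h2, Pi.smul_apply, smul_eq_mul]
        refine (abs_sub _ _).trans (add_le_add ?_ ?_)
        · rw [abs_mul]; gcongr
        · rw [abs_mul]; gcongr; exact (abs_nonneg _).trans h1) (by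
        filter_upwards [huv, Lp.coeFn_sub ((2 * a : ℝ) • u) v, Lp.coeFn_smul (2 * a : ℝ) u]
          with x h2 h3 h4
        rw [h3, Pi.sub_apply, h4, h2, Pi.smul_apply, smul_eq_mul]
        nlinarith [sq_nonneg (a - u x)])
    rw [map_sub, map_smul, Submodule.coe_sub, Submodule.coe_smul] at h
    filter_upwards [h, Lp.coeFn_sub ((2 * a : ℝ) • (E.resolvent t ht u : Lp ℝ 2 μ))
      (E.resolvent t ht v), Lp.coeFn_smul (2 * a : ℝ) (E.resolvent t ht u : Lp ℝ 2 μ)]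
      with x h1 h2 h3
    rwa [h2, Pi.sub_apply, h3, Pi.smul_apply, smul_eq_mul] at h1
  filter_upwards [ae_all_iff.2 key] with x hx
  set p := (E.resolvent t ht u : Lp ℝ 2 μ) x
  set q := (E.resolvent t ht v : Lp ℝ 2 μ) x
  have : ∀ s : ℝ, 2 * s * p - q ≤ s ^ 2 := by
    intro s
    refine Rat.denseRange_cast.induction_on s
      (isClosed_le (by fun_prop) (by fun_prop)) hx
  have h := this (u x)
  linarith

/-- Replace `𝓔(u, ·)` by `t⁻¹ ⟨u - R_t u, ·⟩`, which converges to it as `t → 0`. At each stage the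
functional is `(2t)⁻¹ ∫ φ (u² - 2 u R_t u + R_t(u²)) dμ`, whose integrand is nonnegative by
`resolvent_sq`. -/
theorem energy_functional_nonneg {f φ : X → ℝ} (hf : E.Mem f) (hφ : E.Mem φ) {C D : ℝ}
    (hC : ∀ x, |f x| ≤ C) (hD : ∀ x, |φ x| ≤ D) (h0 : ∀ x, 0 ≤ φ x) :
    0 ≤ E.energy (φ * f) f - 1 / 2 * E.energy φ (f * f) := by
  obtain ⟨q, hq⟩ := hφ.mul hf hD hC
  obtain ⟨v, hv⟩ := hf.mul_self hC
  obtain ⟨u, hu⟩ := hf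
  obtain ⟨p, hp⟩ := hφ
  rw [energy_eq hq hu, energy_eq hp hv, E.symm q u, E.symm p v]
  let t : ℕ → NNReal := fun n => 1 / (n + 1 : NNReal)
  have ht : ∀ n, 0 < t n := fun n => by positivity
  have ht0 : Tendsto t atTop (𝓝 0) := tendsto_one_div_add_atTop_nhds_zero_nat (𝕜 := NNReal)
  refine ge_of_tendsto' ((E.tendsto_form_resolvent t ht ht0 u q).sub
    ((E.tendsto_form_resolvent t ht ht0 v p).const_mul (1 / 2))) fun n => ?_
  have htn : (0 : ℝ) < t n := ht n
  have h1 := E.resolvent_spec (ht n) u q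
  have h2 := E.resolvent_spec (ht n) v p
  set Pu := E.resolvent (t n) (ht n) u
  set Pv := E.resolvent (t n) (ht n) v
  refine nonneg_of_mul_nonneg_right (a := (t n : ℝ)) ?_ htn
  have h3 : (t n : ℝ) * (E.form Pu q - 1 / 2 * E.form Pv p) =
      Inner.inner ℝ ((u : Lp ℝ 2 μ) - Pu) (q : Lp ℝ 2 μ) -
        1 / 2 * Inner.inner ℝ ((v : Lp ℝ 2 μ) - Pv) (p : Lp ℝ 2 μ) := by
    rw [inner_sub_left, inner_sub_left]
    linarith
  rw [h3, L2.inner_def, L2.inner_def, ← integral_const_mul, ← integral_sub (L2.integrable_inner _ _)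
    ((L2.integrable_inner _ _).const_mul _)]
  refine integral_nonneg_of_ae ?_
  filter_upwards [hu, hp, hq, hv, Lp.coeFn_sub (u : Lp ℝ 2 μ) Pu, Lp.coeFn_sub (v : Lp ℝ 2 μ) Pv,
    resolvent_sq (E := E) (u := u) (v := v) (ht n) (C := C) (by
      filter_upwards [hu] with x h
      rw [h]
      exact hC x) (by
      filter_upwards [hu, hv] with x h h'
      rw [h, h', Pi.mul_apply])] with x h1 h2 h3 h4 h5 h6 h7
  rw [h5, h6, Pi.sub_apply, Pi.sub_apply, h1, h2, h3, h4, Pi.mul_apply, Pi.mul_apply]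
  rw [h1] at h7
  simp only [RCLike.inner_apply, conj_trivial, Pi.zero_apply]
  have h8 := mul_nonneg (h0 x) h7
  linarith

end Calculus

end DirichletForm

/-! ## The Dirichlet algebra and energy measures -/

namespace DirichletForm

section Algebra

variable {X : Type u} [MeasurableSpace X] [TopologicalSpace X] {μ : Measure X}
  {E : DirichletForm μ}

theorem exists_abs_le {f : C(X, ℝ)} (hf : HasCompactSupport f) : ∃ C, ∀ x, |f x| ≤ C :=
  hf.exists_bound_of_continuous f.continuous

theorem add_mem_dirichletAlgebra {f g : C(X, ℝ)} (hf : f ∈ E.dirichletAlgebra)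
    (hg : g ∈ E.dirichletAlgebra) : f + g ∈ E.dirichletAlgebra :=
  ⟨hf.1.add hg.1, hf.2.add hg.2⟩

theorem smul_mem_dirichletAlgebra {f : C(X, ℝ)} (c : ℝ) (hf : f ∈ E.dirichletAlgebra) :
    c • f ∈ E.dirichletAlgebra :=
  ⟨hf.1.smul_left (f := fun _ => c), hf.2.smul c⟩

theorem mul_mem_dirichletAlgebra {f g : C(X, ℝ)} (hf : f ∈ E.dirichletAlgebra)
    (hg : g ∈ E.dirichletAlgebra) : f * g ∈ E.dirichletAlgebra := by
  obtain ⟨C, hC⟩ := exists_abs_le hf.1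
  obtain ⟨D, hD⟩ := exists_abs_le hg.1
  exact ⟨hf.1.mul_right, hf.2.mul hg.2 hC hD⟩

variable (E) in
/-- The Dirichlet algebra as a linear space. -/
def algebraSubmodule : Submodule ℝ C(X, ℝ) where
  carrier := E.dirichletAlgebra
  add_mem' := add_mem_dirichletAlgebra
  zero_mem' := ⟨HasCompactSupport.zero, Mem.zero⟩
  smul_mem' c _ hf := smul_mem_dirichletAlgebra c hf

theorem sub_mem_dirichletAlgebra {f g : C(X, ℝ)} (hf : f ∈ E.dirichletAlgebra)
    (hg : g ∈ E.dirichletAlgebra) : f - g ∈ E.dirichletAlgebra :=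
  E.algebraSubmodule.sub_mem hf hg

variable (E) in
/-- The functional `φ ↦ 𝓔(φ f, f) - ½ 𝓔(φ, f²)`. -/
def energyFunctional (f φ : C(X, ℝ)) : ℝ :=
  E.energy (φ * f : C(X, ℝ)) f - 1 / 2 * E.energy φ (f * f : C(X, ℝ))

theorem energyFunctional_nonneg {f φ : C(X, ℝ)} (hf : f ∈ E.dirichletAlgebra)
    (hφ : φ ∈ E.dirichletAlgebra) (h0 : ∀ x, 0 ≤ φ x) : 0 ≤ E.energyFunctional f φ := by
  obtain ⟨C, hC⟩ := exists_abs_le hf.1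
  obtain ⟨D, hD⟩ := exists_abs_le hφ.1
  exact energy_functional_nonneg hf.2 hφ.2 hC hD h0

theorem energyFunctional_add {f φ ψ : C(X, ℝ)} (hf : f ∈ E.dirichletAlgebra)
    (hφ : φ ∈ E.dirichletAlgebra) (hψ : ψ ∈ E.dirichletAlgebra) :
    E.energyFunctional f (φ + ψ) = E.energyFunctional f φ + E.energyFunctional f ψ := by
  simp only [energyFunctional, add_mul, ContinuousMap.coe_add]
  rw [energy_add_left (mul_mem_dirichletAlgebra hφ hf).2 (mul_mem_dirichletAlgebra hψ hf).2 hf.2,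
    energy_add_left hφ.2 hψ.2 (mul_mem_dirichletAlgebra hf hf).2]
  ring

theorem energyFunctional_smul {f φ : C(X, ℝ)} (c : ℝ) (hf : f ∈ E.dirichletAlgebra)
    (hφ : φ ∈ E.dirichletAlgebra) :
    E.energyFunctional f (c • φ) = c * E.energyFunctional f φ := by
  simp only [energyFunctional, smul_mul_assoc, ContinuousMap.coe_smul]
  rw [energy_smul_left c (mul_mem_dirichletAlgebra hφ hf).2 hf.2,
    energy_smul_left c hφ.2 (mul_mem_dirichletAlgebra hf hf).2]
  ring

/-- The energy functional is quadratic in `f`. -/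
theorem exists_bilin_energyFunctional {φ : C(X, ℝ)} (hφ : φ ∈ E.dirichletAlgebra) :
    ∃ B : LinearMap.BilinForm ℝ E.algebraSubmodule,
      ∀ f : E.algebraSubmodule, B f f = E.energyFunctional f φ := by
  have m : ∀ f g : E.algebraSubmodule, E.Mem (f * g : C(X, ℝ)) :=
    fun f g => (mul_mem_dirichletAlgebra f.2 g.2).2
  have m' : ∀ f : E.algebraSubmodule, E.Mem (φ * f : C(X, ℝ)) :=
    fun f => (mul_mem_dirichletAlgebra hφ f.2).2
  refine ⟨LinearMap.mk₂ ℝ (fun f g => E.energy (φ * f : C(X, ℝ)) g -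
    1 / 2 * E.energy φ (f * g : C(X, ℝ))) (fun f f' g => ?_) (fun c f g => ?_)
    (fun f g g' => ?_) (fun c f g => ?_), fun f => rfl⟩
  · simp only [Submodule.coe_add, mul_add, add_mul, ContinuousMap.coe_add]
    rw [energy_add_left (m' f) (m' f') g.2.2, energy_add_right (m f g) (m f' g) hφ.2]
    ring
  · simp only [Submodule.coe_smul, smul_mul_assoc, mul_smul_comm, ContinuousMap.coe_smul,
      smul_eq_mul]
    rw [energy_smul_left c (m' f) g.2.2, energy_smul_right c (m f g) hφ.2]
    ring
  · simp only [Submodule.coe_add, mul_add, ContinuousMap.coe_add]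
    rw [energy_add_right g.2.2 g'.2.2 (m' f), energy_add_right (m f g) (m f g') hφ.2]
    ring
  · simp only [Submodule.coe_smul, mul_smul_comm, ContinuousMap.coe_smul, smul_eq_mul]
    rw [energy_smul_right c g.2.2 (m' f), energy_smul_right c (m f g) hφ.2]
    ring

end Algebra

/-! ### Cut-off functions, existence and locality of energy measures -/

section Topological

open scoped CompactlySupported

variable {X : Type u} [MetricSpace X] [LocallyCompactSpace X] [MeasurableSpace X]
  {μ : Measure X} {E : DirichletForm μ}

/-- Existence of cut-off functions in the Dirichlet algebra. -/
theorem exists_cutoff (hE : E.IsRegular) {K U : Set X} (hK : IsCompact K) (hU : IsOpen U)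
    (hKU : K ⊆ U) : ∃ χ ∈ E.dirichletAlgebra, (∀ x, χ x ∈ Icc (0 : ℝ) 1) ∧
      (∃ V, IsOpen V ∧ K ⊆ V ∧ ∀ x ∈ V, χ x = 1) ∧ tsupport χ ⊆ U := by
  obtain ⟨L, hL, hKL, hLU⟩ := exists_compact_between hK hU hKU
  obtain ⟨ψ, hψ1, hψc, hψU, hψ01⟩ := exists_continuousMap_one_of_isCompact_subset_isOpen hL hU hLU
  obtain ⟨g, hg, hgψ⟩ := hE.1 ψ hψc (1 / 4) (by norm_num)
  -- Since `g` is within `1/4` of `ψ`, it exceeds `3/4` where `ψ = 1` and stays below `1/4` where `ψ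
  -- = 0`. The difference of the truncations at these two levels is `1/2` on the former set and `0`
  -- on the latter; the factor `2` normalises it.
  let χ : C(X, ℝ) := ⟨fun x => 2 * (min (max 0 (g x)) (3 / 4) - min (max 0 (g x)) (1 / 4)),
    by fun_prop⟩
  have hχ : ∀ x, χ x = 2 * (min (max 0 (g x)) (3 / 4) - min (max 0 (g x)) (1 / 4)) := fun _ => rfl
  have h01 : ∀ x, χ x ∈ Icc (0 : ℝ) 1 := by
    intro x
    rw [hχ]
    have h0 : 0 ≤ max 0 (g x) := le_max_left _ _
    rcases le_total (max 0 (g x)) (1 / 4) with h | h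
    · rw [min_eq_left h, min_eq_left (by linarith)]; constructor <;> linarith
    · rw [min_eq_right h]
      have h1 : 1 / 4 ≤ min (max 0 (g x)) (3 / 4) := le_min h (by norm_num)
      have h2 : min (max 0 (g x)) (3 / 4) ≤ 3 / 4 := min_le_right _ _
      constructor <;> linarith
  have hsupp : tsupport χ ⊆ tsupport ψ := by
    refine closure_mono fun x hx => ?_
    by_contra h
    rw [Function.notMem_support] at h
    have h1 := hgψ x
    rw [h, zero_sub, abs_neg] at h1
    have h2 : max 0 (g x) ≤ 1 / 4 := max_le (by norm_num) ((le_abs_self _).trans h1.le)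
    exact hx (by simp only [hχ]; rw [min_eq_left h2, min_eq_left (by linarith)]; ring)
  refine ⟨χ, ⟨hψc.of_isClosed_subset (isClosed_tsupport _) hsupp, ?_⟩, h01,
    ⟨interior L, isOpen_interior, hKL, fun x hx => ?_⟩, hsupp.trans hψU⟩
  · exact ((hg.2.trunc (c := 3 / 4) (by norm_num)).1.sub
      (hg.2.trunc (c := 1 / 4) (by norm_num)).1).smul 2
  · have h1 := hgψ x
    rw [hψ1 (interior_subset hx), Pi.one_apply] at h1
    have h2 : 3 / 4 ≤ g x := by linarith [(abs_lt.1 h1).2]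
    rw [hχ, max_eq_right (by linarith), min_eq_right h2, min_eq_right (by linarith)]
    norm_num

variable [BorelSpace X]

/-- The energy functional is positive but given only on `𝓒`. It extends positively to `C_c(X)` by M.
Riesz's theorem, since cut-off functions let a multiple of some `χ ∈ 𝓒` dominate any compactly
supported function. The Riesz–Markov–Kakutani theorem then represents the extension. -/
theorem exists_isEnergyMeasure (hE : E.IsRegular) {f : C(X, ℝ)} (hf : f ∈ E.dirichletAlgebra) :
    ∃ ν, E.IsEnergyMeasure f ν := by
  let D : Submodule ℝ C_c(X, ℝ) :=
    { carrier := {φ | E.Mem φ}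
      add_mem' := fun ha hb => ha.add hb
      zero_mem' := Mem.zero
      smul_mem' := fun c _ h => h.smul c }
  have hD : ∀ φ : D, (φ : C_c(X, ℝ)).toContinuousMap ∈ E.dirichletAlgebra :=
    fun φ => ⟨(φ : C_c(X, ℝ)).hasCompactSupport, φ.2⟩
  let L : D →ₗ[ℝ] ℝ :=
    { toFun := fun φ => E.energyFunctional f (φ : C_c(X, ℝ)).toContinuousMap
      map_add' := fun a b => energyFunctional_add hf (hD a) (hD b)
      map_smul' := fun c a => energyFunctional_smul c hf (hD a) }
  let s : PointedCone ℝ C_c(X, ℝ) :=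
    { carrier := {φ | ∀ x, 0 ≤ φ x}
      add_mem' := fun ha hb x => add_nonneg (ha x) (hb x)
      zero_mem' := fun x => le_rfl
      smul_mem' := fun c _ h x => mul_nonneg c.2 (h x) }
  obtain ⟨Λ, hΛ, hΛ0⟩ := riesz_extension s ⟨D, L⟩
    (fun φ h => energyFunctional_nonneg hf (hD φ) h) (fun y => by
      obtain ⟨χ, hχ, h01, ⟨V, -, hKV, hV⟩, -⟩ :=
        exists_cutoff hE y.hasCompactSupport isOpen_univ (subset_univ _)
      obtain ⟨C, hC⟩ := exists_abs_le (f := y.toContinuousMap) y.hasCompactSupport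
      refine ⟨⟨⟨C • χ, (smul_mem_dirichletAlgebra C hχ).1⟩, (smul_mem_dirichletAlgebra C hχ).2⟩,
        fun x => ?_⟩
      change 0 ≤ C * χ x + y x
      by_cases hx : x ∈ tsupport y
      · rw [hV x (hKV hx), mul_one]
        have : |y x| ≤ C := hC x
        linarith [neg_abs_le (y x)]
      · rw [image_eq_zero_of_notMem_tsupport hx, add_zero]
        exact mul_nonneg ((abs_nonneg _).trans (hC x)) (h01 x).1)
  refine ⟨RealRMK.rieszMeasure (PositiveLinearMap.mk₀ Λ hΛ0), inferInstance, fun φ hφ => ?_⟩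
  have h1 := RealRMK.integral_rieszMeasure (PositiveLinearMap.mk₀ Λ hΛ0) ⟨φ, hφ.1⟩
  have h2 := hΛ ⟨⟨φ, hφ.1⟩, hφ.2⟩
  exact h1.trans h2

theorem energyMeasure_spec (hE : E.IsRegular) {f : C(X, ℝ)} (hf : f ∈ E.dirichletAlgebra) :
    E.IsEnergyMeasure f (E.energyMeasure f) := by
  have h := exists_isEnergyMeasure hE hf
  rw [energyMeasure, dif_pos h]
  exact h.choose_spec

theorem integral_energyMeasure (hE : E.IsRegular) {f φ : C(X, ℝ)} (hf : f ∈ E.dirichletAlgebra)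
    (hφ : φ ∈ E.dirichletAlgebra) :
    ∫ x, φ x ∂(E.energyMeasure f) = E.energyFunctional f φ :=
  (energyMeasure_spec hE hf).2 φ hφ

theorem integrable_of_hasCompactSupport {ν : Measure X} [IsFiniteMeasureOnCompacts ν] {φ : C(X, ℝ)}
    (hφ : HasCompactSupport φ) : Integrable φ ν :=
  φ.continuous.integrable_of_hasCompactSupport hφ

/-- Comparison of a compact and an open set by a cut-off function. -/
theorem measure_le_of_forall_integral_le (hE : E.IsRegular) {ν₁ ν₂ : Measure X}
    [IsFiniteMeasureOnCompacts ν₁] [IsFiniteMeasureOnCompacts ν₂] {U : Set X} (hU : IsOpen U)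
    (h : ∀ φ ∈ E.dirichletAlgebra, tsupport φ ⊆ U → ∫ x, φ x ∂ν₁ ≤ ∫ x, φ x ∂ν₂)
    {K : Set X} (hK : IsCompact K) (hKU : K ⊆ U) : ν₁ K ≤ ν₂ U := by
  obtain ⟨χ, hχ, h01, ⟨V, -, hKV, hV⟩, hs⟩ := exists_cutoff hE hK hU hKU
  have h1 : ν₁ K ≤ ENNReal.ofReal (∫ x, χ x ∂ν₁) := by
    rw [ofReal_integral_eq_lintegral_ofReal (integrable_of_hasCompactSupport hχ.1)
      (.of_forall fun x => (h01 x).1), ← lintegral_indicator_one hK.measurableSet]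
    refine lintegral_mono fun x => ?_
    by_cases hx : x ∈ K
    · simp [hx, hV x (hKV hx)]
    · simp [hx]
  have h2 : ENNReal.ofReal (∫ x, χ x ∂ν₂) ≤ ν₂ U := by
    rw [ofReal_integral_eq_lintegral_ofReal (integrable_of_hasCompactSupport hχ.1)
      (.of_forall fun x => (h01 x).1), ← lintegral_indicator_one hU.measurableSet]
    refine lintegral_mono fun x => ?_
    by_cases hx : x ∈ U
    · simpa [hx] using (h01 x).2
    · simp [hx, image_eq_zero_of_notMem_tsupport (fun h => hx (hs h))]
  exact h1.trans ((ENNReal.ofReal_le_ofReal (h χ hχ hs)).trans h2)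

/-- Cut-off functions squeezed between a compact set and an open neighbourhood compare the measures
in both directions. Inner regularity then gives equality on open subsets of `G`, and outer
regularity on all Borel sets. -/
theorem restrict_eq_of_forall_integral_eq [SigmaCompactSpace X] (hE : E.IsRegular)
    {ν₁ ν₂ : Measure X} [IsFiniteMeasureOnCompacts ν₁] [IsFiniteMeasureOnCompacts ν₂]
    {G : Set X} (hG : IsOpen G)
    (h : ∀ φ ∈ E.dirichletAlgebra, tsupport φ ⊆ G → ∫ x, φ x ∂ν₁ = ∫ x, φ x ∂ν₂) :
    ν₁.restrict G = ν₂.restrict G := by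
  have := isLocallyFiniteMeasure_of_isFiniteMeasureOnCompacts (μ := ν₁)
  have := isLocallyFiniteMeasure_of_isFiniteMeasureOnCompacts (μ := ν₂)
  refine Measure.OuterRegular.ext_isOpen fun U hU => ?_
  rw [Measure.restrict_apply hU.measurableSet, Measure.restrict_apply hU.measurableSet]
  have hUG := hU.inter hG
  refine le_antisymm ?_ ?_
  · rw [hUG.measure_eq_iSup_isCompact ν₁]
    exact iSup_le fun K => iSup_le fun hKU => iSup_le fun hK =>
      measure_le_of_forall_integral_le hE hUG
        (fun φ hφ hs => (h φ hφ (hs.trans inter_subset_right)).le) hK hKU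
  · rw [hUG.measure_eq_iSup_isCompact ν₂]
    exact iSup_le fun K => iSup_le fun hKU => iSup_le fun hK =>
      measure_le_of_forall_integral_le hE hUG
        (fun φ hφ hs => (h φ hφ (hs.trans inter_subset_right)).ge) hK hKU

theorem energy_eq_zero_of_const (hE : E.IsStronglyLocal) {f g : C(X, ℝ)}
    (hf : f ∈ E.dirichletAlgebra) (hg : g ∈ E.dirichletAlgebra) {U : Set X} (hU : IsOpen U)
    (hgU : tsupport g ⊆ U) {c : ℝ} (hc : ∀ x ∈ U, f x = c) : E.energy f g = 0 :=
  hE.2 f hf g hg ⟨c, U, hU, hgU, hc⟩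

/-- Locality of the energy measures. -/
theorem energyMeasure_restrict_eq [SigmaCompactSpace X] (hE : E.IsStronglyLocal) {f g : C(X, ℝ)}
    (hf : f ∈ E.dirichletAlgebra) (hg : g ∈ E.dirichletAlgebra) {G : Set X} (hG : IsOpen G)
    (hfg : ∀ x ∈ G, f x = g x) :
    (E.energyMeasure f).restrict G = (E.energyMeasure g).restrict G := by
  have := (energyMeasure_spec hE.1 hf).1
  have := (energyMeasure_spec hE.1 hg).1
  refine restrict_eq_of_forall_integral_eq hE.1 hG fun φ hφ hs => ?_
  rw [integral_energyMeasure hE.1 hf hφ, integral_energyMeasure hE.1 hg hφ]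
  have e1 : φ * f = φ * g := by
    ext x
    by_cases hx : x ∈ G
    · simp [hfg x hx]
    · simp [image_eq_zero_of_notMem_tsupport fun h => hx (hs h)]
  have hs' : tsupport (φ * g : C(X, ℝ)) ⊆ G := (tsupport_mul_subset_left (f := φ)).trans hs
  have hφg := mul_mem_dirichletAlgebra hφ hg
  -- Both `f - g` and `f² - g²` vanish on `G`, which contains the supports of `φ g` and `φ`; strong
  -- locality removes the two differences.
  have h1 : E.energy (f - g : C(X, ℝ)) (φ * g : C(X, ℝ)) = 0 :=
    energy_eq_zero_of_const hE (sub_mem_dirichletAlgebra hf hg) hφg hG hs' (c := 0)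
      fun x hx => by simp [hfg x hx]
  have hff := mul_mem_dirichletAlgebra hf hf
  have hgg := mul_mem_dirichletAlgebra hg hg
  have h2 : E.energy (f * f - g * g : C(X, ℝ)) φ = 0 :=
    energy_eq_zero_of_const hE (sub_mem_dirichletAlgebra hff hgg) hφ hG hs (c := 0)
      fun x hx => by simp [hfg x hx]
  rw [ContinuousMap.coe_sub, energy_sub_left hf.2 hg.2 hφg.2] at h1
  rw [ContinuousMap.coe_sub, energy_sub_left hff.2 hgg.2 hφ.2] at h2
  rw [energyFunctional, energyFunctional, e1, energy_comm _ f, energy_comm _ g,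
    energy_comm φ, energy_comm φ]
  linarith

/-- `Γ(f)(K) ≤ 𝓔(f, f)`. -/
theorem energyMeasure_le (hE : E.IsStronglyLocal) {f : C(X, ℝ)} (hf : f ∈ E.dirichletAlgebra)
    {K : Set X} (hK : IsCompact K) :
    E.energyMeasure f K ≤ ENNReal.ofReal (E.energy f f) := by
  have := (energyMeasure_spec hE.1 hf).1
  -- The cut-off is `1` near `K` and near the support of `f`, so `χ f = f` and, by strong locality,
  -- `𝓔(χ, f²) = 0`.
  obtain ⟨χ, hχ, h01, ⟨V, hVo, hKV, hV⟩, hs⟩ := exists_cutoff hE.1 (hK.union hf.1) isOpen_univ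
    (subset_univ _)
  have h1 : E.energyMeasure f K ≤ ENNReal.ofReal (∫ x, χ x ∂(E.energyMeasure f)) := by
    rw [ofReal_integral_eq_lintegral_ofReal (integrable_of_hasCompactSupport hχ.1)
      (.of_forall fun x => (h01 x).1), ← lintegral_indicator_one hK.measurableSet]
    refine lintegral_mono fun x => ?_
    by_cases hx : x ∈ K
    · simp [hx, hV x (hKV (Or.inl hx))]
    · simp [hx]
  refine h1.trans (ENNReal.ofReal_le_ofReal ?_)
  rw [integral_energyMeasure hE.1 hf hχ, energyFunctional]
  have e1 : χ * f = f := by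
    ext x
    by_cases hx : x ∈ tsupport f
    · simp [hV x (hKV (Or.inr hx))]
    · simp [image_eq_zero_of_notMem_tsupport hx]
  have h2 : E.energy χ (f * f : C(X, ℝ)) = 0 :=
    energy_eq_zero_of_const hE hχ (mul_mem_dirichletAlgebra hf hf) hVo
      ((tsupport_mul_subset_left (f := f)).trans (subset_union_right.trans hKV)) hV
  rw [e1, h2]
  simp

end Topological

end DirichletForm

/-! ## Local energy measures -/

namespace DirichletForm

section Local

variable {X : Type u} [MetricSpace X] [LocallyCompactSpace X] [SigmaCompactSpace X]
  [MeasurableSpace X] [BorelSpace X] {μ : Measure X} {E : DirichletForm μ}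

/-- On the support of `χ` the function `f` is bounded and coincides a.e. with an element of `𝓕`.
That element may be unbounded elsewhere, so it is truncated at `±D` before the product rule for
bounded functions is used; `D` is large enough not to alter `f` on the support. -/
theorem mul_mem_of_mem_locContinuous {χ f : C(X, ℝ)} (hχ : χ ∈ E.dirichletAlgebra)
    (hf : f ∈ E.locContinuous) : χ * f ∈ E.dirichletAlgebra := by
  refine ⟨hχ.1.mul_right, ?_⟩
  have hc : HasCompactSupport (χ * f : C(X, ℝ)) := hχ.1.mul_right
  obtain ⟨B, hB⟩ := hχ.1.isCompact.exists_bound_of_continuousOn f.continuous.continuousOn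
  obtain ⟨C, hC⟩ := exists_abs_le hχ.1
  set D := max B 1
  have hD : 0 < D := by positivity
  obtain ⟨-, w, hw⟩ := hf.2 (tsupport χ) hχ.1
  set w₀ : X → ℝ := ((w : Lp ℝ 2 μ) : X → ℝ)
  have hw₀ : E.Mem w₀ := ⟨w, .rfl⟩
  have hv := (hw₀.trunc hD).1.sub ((hw₀.smul (-1)).trunc hD).1
  have hvD : ∀ x, |((fun x => min (max 0 (w₀ x)) D) -
      fun x => min (max 0 (((-1 : ℝ) • w₀) x)) D : X → ℝ) x| ≤ D + D := by
    intro x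
    refine (abs_sub _ _).trans (add_le_add ?_ ?_)
    all_goals
      rw [abs_of_nonneg (le_min (le_max_left _ _) hD.le)]
      exact min_le_right _ _
  refine (hχ.2.mul hv hC hvD).congr ?_
  rw [Filter.EventuallyEq, ae_restrict_iff' (isClosed_tsupport _).measurableSet] at hw
  filter_upwards [hw] with x hx
  simp only [Pi.mul_apply, ContinuousMap.coe_mul]
  by_cases h : x ∈ tsupport χ
  · congr 1
    have h1 : |f x| ≤ D := (hB x h).trans (le_max_left _ _)
    simp only [Pi.sub_apply, Pi.smul_apply, smul_eq_mul, neg_mul, one_mul]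
    rw [hx h]
    rcases le_total 0 (f x) with h2 | h2
    · rw [max_eq_right h2, min_eq_left ((le_abs_self _).trans h1), max_eq_left (by linarith),
        min_eq_left hD.le, sub_zero]
    · rw [max_eq_left h2, min_eq_left hD.le, max_eq_right (by linarith),
        min_eq_left ((neg_le_abs _).trans h1), zero_sub, neg_neg]
  · rw [image_eq_zero_of_notMem_tsupport h, zero_mul, zero_mul]

variable (E) in
/-- Multiplication by `χ ∈ 𝓒`, as a map from `𝓕_loc ∩ C(X)` to `𝓒`. -/
def cutoffMap {χ : C(X, ℝ)} (hχ : χ ∈ E.dirichletAlgebra) :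
    E.locContinuous →ₗ[ℝ] E.algebraSubmodule where
  toFun f := ⟨χ * f, mul_mem_of_mem_locContinuous hχ f.2⟩
  map_add' _ _ := Subtype.ext (mul_add _ _ _)
  map_smul' _ _ := Subtype.ext (mul_smul_comm _ _ _)

theorem mem_locContinuous_of_mem_dirichletAlgebra {f : C(X, ℝ)} (hf : f ∈ E.dirichletAlgebra) :
    f ∈ E.locContinuous := by
  obtain ⟨w, hw⟩ := hf.2
  have h : MemLp f 2 μ := (memLp_congr_ae hw).1 (Lp.memLp _)
  exact ⟨h.1, fun K _ => ⟨h.restrict K, w, ae_restrict_of_ae hw⟩⟩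

theorem exists_cutoff_nhds (hE : E.IsRegular) {K : Set X} (hK : IsCompact K) :
    ∃ G, IsOpen G ∧ K ⊆ G ∧ IsCompact (closure G) ∧ ∃ χ ∈ E.dirichletAlgebra, ∀ x ∈ G, χ x = 1 := by
  obtain ⟨χ, hχ, -, ⟨V, hV, hKV, hV1⟩, -⟩ := exists_cutoff hE hK isOpen_univ (subset_univ _)
  obtain ⟨W, hW, hKW, hWc⟩ := exists_isOpen_superset_and_isCompact_closure hK
  exact ⟨V ∩ W, hV.inter hW, subset_inter hKV hKW,
    hWc.of_isClosed_subset isClosed_closure (closure_mono inter_subset_right), χ, hχ,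
    fun x hx => hV1 x hx.1⟩

theorem exists_cutoff_exhaustion (hE : E.IsRegular) : ∃ G : ℕ → Set X, ∃ χ : ℕ → C(X, ℝ),
    (∀ n, IsOpen (G n)) ∧ (∀ n, IsCompact (closure (G n))) ∧ (⋃ n, G n) = univ ∧
      (∀ n, χ n ∈ E.dirichletAlgebra) ∧ ∀ n, ∀ x ∈ G n, χ n x = 1 := by
  choose G h1 h2 h3 χ h4 h5 using
    fun n => exists_cutoff_nhds hE ((CompactExhaustion.choice X).isCompact n)
  exact ⟨G, χ, h1, h3, univ_subset_iff.1 ((CompactExhaustion.choice X).iUnion_eq.symm.subset.trans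
    (iUnion_mono h2)), h4, h5⟩

/-- On the disjoint pieces of an exhaustion use the energy measures of `χ_n f`. Wherever `f` agrees
with some `w ∈ 𝓒` on an open set, locality identifies every piece with `Γ(w)`, so the sum does not
depend on the choices made. -/
theorem exists_isLocalEnergyMeasure (hE : E.IsStronglyLocal) {f : C(X, ℝ)}
    (hf : f ∈ E.locContinuous) : ∃ ν, E.IsLocalEnergyMeasure f ν := by
  obtain ⟨G, χ, hGo, hGc, hGu, hχ, hχ1⟩ := exists_cutoff_exhaustion hE.1
  have hw : ∀ n, χ n * f ∈ E.dirichletAlgebra := fun n => mul_mem_of_mem_locContinuous (hχ n) hf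
  have hdm : ∀ n, MeasurableSet (disjointed G n) :=
    fun n => MeasurableSet.disjointed (fun n => (hGo n).measurableSet) n
  set ν : Measure X :=
    Measure.sum fun n => (E.energyMeasure (χ n * f)).restrict (disjointed G n) with hν
  have key : ∀ U : Set X, IsOpen U → ∀ w ∈ E.dirichletAlgebra, (∀ x ∈ U, w x = f x) →
      ν.restrict U = (E.energyMeasure w).restrict U := by
    intro U hU w hwm hwf
    have h1 : (E.energyMeasure w).restrict U =
        Measure.sum fun n => (E.energyMeasure w).restrict (disjointed G n ∩ U) := by
      rw [← Measure.restrict_iUnion]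
      · rw [← iUnion_inter, iUnion_disjointed, hGu, univ_inter]
      · exact fun i j hij => (disjoint_disjointed G hij).mono inter_subset_left inter_subset_left
      · exact fun n => (hdm n).inter hU.measurableSet
    rw [h1, hν, Measure.restrict_sum _ hU.measurableSet]
    congr 1
    ext1 n
    rw [Measure.restrict_restrict hU.measurableSet]
    have h2 := energyMeasure_restrict_eq hE (hw n) hwm ((hGo n).inter hU) fun x hx => by
      simp [hχ1 n x hx.1, hwf x hx.2]
    have h3 : disjointed G n ∩ U ⊆ G n ∩ U := inter_subset_inter_left _ (disjointed_subset G n)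
    rw [inter_comm U, ← Measure.restrict_restrict_of_subset h3, h2,
      Measure.restrict_restrict_of_subset h3]
  have hfin : IsFiniteMeasureOnCompacts ν := by
    refine ⟨fun K hK => ?_⟩
    obtain ⟨U, hU, hKU, -, ψ, hψ, hψ1⟩ := exists_cutoff_nhds hE.1 hK
    have hm := mul_mem_of_mem_locContinuous hψ hf
    have := (energyMeasure_spec hE.1 hm).1
    have h1 := key U hU _ hm fun x hx => by simp [hψ1 x hx]
    have h2 : ν K = ν.restrict U K := by
      rw [Measure.restrict_apply hK.measurableSet, inter_eq_left.2 hKU]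
    rw [h2, h1]
    exact (Measure.restrict_apply_le _ _).trans_lt hK.measure_lt_top
  have := isLocallyFiniteMeasure_of_isFiniteMeasureOnCompacts (μ := ν)
  exact ⟨ν, inferInstance, fun U hU _ w hwm hwf => key U hU w hwm hwf⟩

theorem localEnergyMeasure_spec (hE : E.IsStronglyLocal) {f : C(X, ℝ)}
    (hf : f ∈ E.locContinuous) : E.IsLocalEnergyMeasure f (E.localEnergyMeasure f) := by
  have h := exists_isLocalEnergyMeasure hE hf
  rw [localEnergyMeasure, dif_pos h]
  exact h.choose_spec

theorem localEnergyMeasure_restrict (hE : E.IsStronglyLocal) {f w : C(X, ℝ)}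
    (hf : f ∈ E.locContinuous) (hw : w ∈ E.dirichletAlgebra) {G : Set X} (hG : IsOpen G)
    (hGc : IsCompact (closure G)) (hwf : ∀ x ∈ G, w x = f x) :
    (E.localEnergyMeasure f).restrict G = (E.energyMeasure w).restrict G :=
  (localEnergyMeasure_spec hE hf).2 G hG hGc w hw hwf

theorem localEnergyMeasure_regular (hE : E.IsStronglyLocal) {f : C(X, ℝ)}
    (hf : f ∈ E.locContinuous) : (E.localEnergyMeasure f).Regular :=
  (localEnergyMeasure_spec hE hf).1

/-- Energy dominance speaks only of `𝓒`; a countable exhaustion on whose members `f` agrees with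
elements of `𝓒` carries it over. -/
theorem localEnergyMeasure_ac (hE : E.IsStronglyLocal) {m : Measure X} (hm : E.IsEnergyDominant m)
    {f : C(X, ℝ)} (hf : f ∈ E.locContinuous) : E.localEnergyMeasure f ≪ m := by
  obtain ⟨G, χ, hGo, hGc, hGu, hχ, hχ1⟩ := exists_cutoff_exhaustion hE.1
  intro s hs
  have h1 : s = ⋃ n, s ∩ G n := by rw [← inter_iUnion, hGu, inter_univ]
  rw [h1]
  refine measure_iUnion_null fun n => ?_
  have h2 := localEnergyMeasure_restrict hE hf (mul_mem_of_mem_locContinuous (hχ n) hf) (hGo n)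
    (hGc n) fun x hx => by simp [hχ1 n x hx]
  rw [← Measure.restrict_apply' (hGo n).measurableSet, h2]
  exact Measure.absolutelyContinuous_of_le Measure.restrict_le_self
    (hm.2.2 _ (mul_mem_of_mem_locContinuous (hχ n) hf) hs)

/-! ### Quadratic identities -/

/-- Linear relations between energy measures, valid for all quadratic functionals. -/
theorem sum_localEnergyMeasure_eq (hE : E.IsStronglyLocal) {ι : Type*} [Fintype ι] (c : ι → ℝ)
    (f : ι → E.locContinuous)
    (hQ : ∀ B : LinearMap.BilinForm ℝ E.locContinuous, ∑ i, c i * B (f i) (f i) = 0) :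
    ∑ i, (c i).toNNReal • E.localEnergyMeasure (f i) =
      ∑ i, (-c i).toNNReal • E.localEnergyMeasure (f i) := by
  obtain ⟨G, χ, hGo, hGc, hGu, hχ, hχ1⟩ := exists_cutoff_exhaustion hE.1
  refine (Measure.ext_iff_of_iUnion_eq_univ hGu).2 fun n => ?_
  have hm : ∀ i, χ n * f i ∈ E.dirichletAlgebra :=
    fun i => mul_mem_of_mem_locContinuous (hχ n) (f i).2
  have hr : ∀ d : ι → NNReal, (∑ i, d i • E.localEnergyMeasure (f i)).restrict (G n) =
      (∑ i, d i • E.energyMeasure (χ n * f i)).restrict (G n) := by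
    intro d
    simp only [← Measure.restrictₗ_apply, map_sum]
    refine Finset.sum_congr rfl fun i _ => ?_
    simp only [Measure.restrictₗ_apply, Measure.restrict_smul]
    rw [localEnergyMeasure_restrict hE (f i).2 (hm i) (hGo n) (hGc n) fun x hx => by
      simp [hχ1 n x hx]]
  rw [hr, hr]
  have hreg : ∀ i, (E.energyMeasure (χ n * f i)).Regular :=
    fun i => (energyMeasure_spec hE.1 (hm i)).1
  have hfin : ∀ d : ι → NNReal,
      IsFiniteMeasureOnCompacts (∑ i, d i • E.energyMeasure (χ n * f i)) := by
    refine fun d => ⟨fun K hK => ?_⟩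
    rw [Measure.finsetSum_apply]
    refine ENNReal.sum_lt_top.2 fun i _ => ?_
    rw [Measure.smul_apply]
    exact ENNReal.mul_lt_top ENNReal.coe_lt_top hK.measure_lt_top
  have := hfin fun i => (c i).toNNReal
  have := hfin fun i => (-c i).toNNReal
  refine restrict_eq_of_forall_integral_eq hE.1 (hGo n) fun φ hφ _ => ?_
  have hint : ∀ d : ι → NNReal, ∫ x, φ x ∂(∑ i, d i • E.energyMeasure (χ n * f i)) =
      ∑ i, (d i : ℝ) * E.energyFunctional (χ n * f i) φ := by
    intro d
    rw [integral_finsetSum_measure fun i _ =>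
      (integrable_of_hasCompactSupport hφ.1).smul_measure_nnreal]
    refine Finset.sum_congr rfl fun i _ => ?_
    rw [integral_smul_nnreal_measure, integral_energyMeasure hE.1 (hm i) hφ]
    rfl
  rw [hint, hint, ← sub_eq_zero, ← Finset.sum_sub_distrib]
  -- For fixed `φ`, the quantity `f ↦ ∫ φ dΓ(χ_n f)` is a quadratic form on `𝓕_loc ∩ C(X)`, to which
  -- `hQ` applies. Splitting the coefficients into positive and negative parts served to keep both
  -- sides honest measures.
  obtain ⟨B, hB⟩ := exists_bilin_energyFunctional hφ
  rw [← hQ (B.compl₁₂ (E.cutoffMap (hχ n)) (E.cutoffMap (hχ n)))]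
  refine Finset.sum_congr rfl fun i _ => ?_
  rw [← sub_mul, Real.coe_toNNReal', Real.coe_toNNReal', LinearMap.compl₁₂_apply, hB]
  have h1 : max (c i) 0 - max (-c i) 0 = c i := by
    rcases le_total 0 (c i) with h | h
    · rw [max_eq_left h, max_eq_right (by linarith), sub_zero]
    · rw [max_eq_right h, max_eq_left (by linarith), zero_sub, neg_neg]
  rw [h1]
  rfl

/-! ### Densities -/

variable (E) in
/-- The density of the energy measure of `f` with respect to `m`. -/
def energyDensity (m : Measure X) (f : C(X, ℝ)) (x : X) : ℝ :=
  ((E.localEnergyMeasure f).rnDeriv m x).toReal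

theorem measurable_energyDensity (m : Measure X) (f : C(X, ℝ)) :
    Measurable (E.energyDensity m f) :=
  (Measure.measurable_rnDeriv _ _).ennreal_toReal

theorem energyDensity_nonneg (m : Measure X) (f : C(X, ℝ)) (x : X) : 0 ≤ E.energyDensity m f x :=
  ENNReal.toReal_nonneg

theorem setIntegral_energyDensity (hE : E.IsStronglyLocal) {m : Measure X}
    (hm : E.IsEnergyDominant m) {f : C(X, ℝ)} (hf : f ∈ E.locContinuous) (h : X → ℝ) {s : Set X}
    (hs : MeasurableSet s) :
    ∫ x in s, E.energyDensity m f x * h x ∂m = ∫ x in s, h x ∂(E.localEnergyMeasure f) := by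
  have := localEnergyMeasure_regular hE hf
  have := hm.1
  exact setIntegral_rnDeriv_smul (localEnergyMeasure_ac hE hm hf) hs

theorem integrableOn_energyDensity (hE : E.IsStronglyLocal) (m : Measure X)
    {f : C(X, ℝ)} (hf : f ∈ E.locContinuous) {K : Set X} (hK : IsCompact K) :
    IntegrableOn (E.energyDensity m f) K m := by
  have := localEnergyMeasure_regular hE hf
  exact Measure.integrableOn_toReal_rnDeriv hK.measure_lt_top.ne

/-- The source of all pointwise algebra below. The relation holds for the masses of every compact
set, and a locally integrable function whose integrals over all compact sets vanish is zero a.e. -/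
theorem sum_energyDensity_eq_zero (hE : E.IsStronglyLocal) {m : Measure X}
    (hm : E.IsEnergyDominant m) {ι : Type*} [Fintype ι] (c : ι → ℝ) (f : ι → E.locContinuous)
    (hQ : ∀ B : LinearMap.BilinForm ℝ E.locContinuous, ∑ i, c i * B (f i) (f i) = 0) :
    ∀ᵐ x ∂m, ∑ i, c i * E.energyDensity m (f i) x = 0 := by
  have hint : ∀ K : Set X, IsCompact K → ∀ i ∈ Finset.univ,
      IntegrableOn (fun x => c i * E.energyDensity m (f i) x) K m :=
    fun K hK i _ => (integrableOn_energyDensity hE m (f i).2 hK).const_mul (c i)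
  refine ae_eq_zero_of_forall_setIntegral_isCompact_eq_zero' ?_ fun K hK => ?_
  · refine (locallyIntegrable_iff).2 fun K hK => ?_
    exact integrable_finsetSum Finset.univ (hint K hK)
  · rw [integral_finsetSum _ (hint K hK)]
    have h1 : ∀ i, ∫ x in K, c i * E.energyDensity m (f i) x ∂m =
        c i * (E.localEnergyMeasure (f i) K).toReal := by
      intro i
      rw [integral_const_mul]
      congr 1
      have h2 := setIntegral_energyDensity hE hm (f i).2 (fun _ => 1) hK.measurableSet
      simpa [Measure.real] using h2
    simp only [h1]
    have hreg : ∀ i, (E.localEnergyMeasure (f i)).Regular :=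
      fun i => localEnergyMeasure_regular hE (f i).2
    have h2 := congrArg (fun ν : Measure X => (ν K).toReal) (sum_localEnergyMeasure_eq hE c f hQ)
    have h3 : ∀ d : ι → NNReal, ((∑ i, d i • E.localEnergyMeasure (f i)) K).toReal =
        ∑ i, (d i : ℝ) * (E.localEnergyMeasure (f i) K).toReal := by
      intro d
      rw [Measure.finsetSum_apply, ENNReal.toReal_sum]
      · refine Finset.sum_congr rfl fun i _ => ?_
        rw [Measure.smul_apply, ENNReal.smul_def, smul_eq_mul, ENNReal.toReal_mul,
          ENNReal.coe_toReal]
      · intro i _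
        rw [Measure.smul_apply]
        exact (ENNReal.mul_lt_top ENNReal.coe_lt_top hK.measure_lt_top).ne
    simp only [h3] at h2
    rw [← sub_eq_zero, ← Finset.sum_sub_distrib] at h2
    rw [← h2]
    refine Finset.sum_congr rfl fun i _ => ?_
    rw [← sub_mul, Real.coe_toNNReal', Real.coe_toNNReal', max_zero_sub_max_neg_zero_eq_self]

end Local

end DirichletForm

/-! ## The semi-inner product on `(𝓕_loc ∩ C(X)) ⊗ B_b(X)` -/

namespace DirichletForm

section Tensor

variable {X : Type u} [MetricSpace X] [LocallyCompactSpace X] [SigmaCompactSpace X]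
  [MeasurableSpace X] [BorelSpace X] {μ : Measure X} {E : DirichletForm μ}

variable (E) in
/-- The density of the mutual energy measure of `f` and `g` with respect to `m`. -/
def mutualDensity (m : Measure X) (f g : C(X, ℝ)) (x : X) : ℝ :=
  1 / 4 * (E.energyDensity m (f + g) x - E.energyDensity m (f - g) x)

theorem measurable_mutualDensity (m : Measure X) (f g : C(X, ℝ)) :
    Measurable (E.mutualDensity m f g) :=
  ((measurable_energyDensity m _).sub (measurable_energyDensity m _)).const_mul _

theorem integrableOn_mutualDensity (hE : E.IsStronglyLocal) (m : Measure X)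
    {f g : C(X, ℝ)} (hf : f ∈ E.locContinuous) (hg : g ∈ E.locContinuous) {K : Set X}
    (hK : IsCompact K) : IntegrableOn (E.mutualDensity m f g) K m :=
  ((integrableOn_energyDensity hE m (E.locContinuous.add_mem hf hg) hK).sub
    (integrableOn_energyDensity hE m (E.locContinuous.sub_mem hf hg) hK)).const_mul _

/-- Linear relations between densities, valid for all symmetric bilinear forms. -/
theorem sum_mutualDensity_eq_zero (hE : E.IsStronglyLocal) {m : Measure X}
    (hm : E.IsEnergyDominant m) {ι : Type*} [Fintype ι] (c : ι → ℝ) (f g : ι → E.locContinuous)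
    (hQ : ∀ B : LinearMap.BilinForm ℝ E.locContinuous, (∀ a b, B a b = B b a) →
      ∑ i, c i * B (f i) (g i) = 0) :
    ∀ᵐ x ∂m, ∑ i, c i * E.mutualDensity m (f i) (g i) x = 0 := by
  have h := sum_energyDensity_eq_zero hE hm (ι := ι ⊕ ι)
    (Sum.elim (fun i => 1 / 4 * c i) (fun i => -(1 / 4 * c i)))
    (Sum.elim (fun i => f i + g i) (fun i => f i - g i)) (fun B => by
      -- Polarisation of a possibly asymmetric `B` yields half of its symmetrisation, which is where
      -- `hQ` can be used.
      have h1 := hQ (B + B.flip) (fun a b => by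
        simp only [LinearMap.add_apply, LinearMap.BilinForm.flip_apply]
        ring)
      simp only [Fintype.sum_sum_type, Sum.elim_inl, Sum.elim_inr, ← Finset.sum_add_distrib]
      have h2 := congrArg (fun r => 1 / 2 * r) h1
      simp only [mul_zero, Finset.mul_sum] at h2
      rw [← h2]
      refine Finset.sum_congr rfl fun i _ => ?_
      simp only [map_add, map_sub, LinearMap.add_apply, LinearMap.sub_apply, LinearMap.BilinForm.flip_apply]
      ring)
  filter_upwards [h] with x hx
  simp only [Fintype.sum_sum_type, Sum.elim_inl, Sum.elim_inr, ← Finset.sum_add_distrib] at hx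
  rw [← hx]
  refine Finset.sum_congr rfl fun i _ => ?_
  simp only [mutualDensity, Submodule.coe_add, Submodule.coe_sub]
  ring

theorem mutualDensity_comm (hE : E.IsStronglyLocal) {m : Measure X} (hm : E.IsEnergyDominant m)
    (f g : E.locContinuous) : ∀ᵐ x ∂m, E.mutualDensity m f g x = E.mutualDensity m g f x := by
  filter_upwards [sum_mutualDensity_eq_zero hE hm ![1, -1] ![f, g] ![g, f] fun B hB => by
    simp [Fin.sum_univ_succ, hB f g]] with x hx
  simp [Fin.sum_univ_succ] at hx
  linarith

theorem mutualDensity_add (hE : E.IsStronglyLocal) {m : Measure X} (hm : E.IsEnergyDominant m)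
    (f f' g : E.locContinuous) : ∀ᵐ x ∂m, E.mutualDensity m (f + f' : E.locContinuous) g x =
      E.mutualDensity m f g x + E.mutualDensity m f' g x := by
  filter_upwards [sum_mutualDensity_eq_zero hE hm ![1, -1, -1] ![f + f', f, f'] ![g, g, g]
    fun B hB => by simp [Fin.sum_univ_succ]; ring] with x hx
  simp [Fin.sum_univ_succ] at hx ⊢
  linarith

theorem mutualDensity_smul (hE : E.IsStronglyLocal) {m : Measure X} (hm : E.IsEnergyDominant m)
    (c : ℝ) (f g : E.locContinuous) : ∀ᵐ x ∂m, E.mutualDensity m (c • f : E.locContinuous) g x =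
      c * E.mutualDensity m f g x := by
  filter_upwards [sum_mutualDensity_eq_zero hE hm ![1, -c] ![c • f, f] ![g, g]
    fun B hB => by simp [Fin.sum_univ_succ]] with x hx
  simp [Fin.sum_univ_succ] at hx ⊢
  linarith

theorem mutualDensity_self (hE : E.IsStronglyLocal) {m : Measure X} (hm : E.IsEnergyDominant m)
    (f : E.locContinuous) : ∀ᵐ x ∂m, E.mutualDensity m f f x = E.energyDensity m f x := by
  filter_upwards [sum_energyDensity_eq_zero hE hm ![1 / 4, -(1 / 4), -1] ![f + f, f - f, f]
    fun B => by simp [Fin.sum_univ_succ]; ring] with x hx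
  simp [Fin.sum_univ_succ, mutualDensity] at hx ⊢
  linarith

/-- The matrix of the densities of a finite family is almost everywhere nonnegative definite. -/
theorem mutualDensity_psd (hE : E.IsStronglyLocal) {m : Measure X} (hm : E.IsEnergyDominant m)
    {ι : Type*} [Fintype ι] (f : ι → E.locContinuous) :
    ∀ᵐ x ∂m, ∀ c : ι → ℝ, 0 ≤ ∑ i, ∑ j, c i * c j * E.mutualDensity m (f i) (f j) x := by
  have key : ∀ c : ι → ℚ, ∀ᵐ x ∂m,
      0 ≤ ∑ i, ∑ j, (c i : ℝ) * c j * E.mutualDensity m (f i) (f j) x := by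
    intro c
    set u : E.locContinuous := ∑ i, (c i : ℝ) • f i with hu
    -- The extra index subtracts the energy of `u = ∑ c_i f_i`. Thus the quadratic expression is the
    -- density of `Γ(u)`, which is nonnegative.
    have h := sum_mutualDensity_eq_zero hE hm (ι := (ι × ι) ⊕ Unit)
      (Sum.elim (fun p => (c p.1 : ℝ) * c p.2) (fun _ => -1))
      (Sum.elim (fun p => f p.1) (fun _ => u)) (Sum.elim (fun p => f p.2) (fun _ => u))
      (fun B _ => by
        simp only [Fintype.sum_sum_type, Sum.elim_inl, Sum.elim_inr, Fintype.sum_prod_type,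
          Finset.univ_unique, Finset.sum_singleton, hu, map_sum, LinearMap.sum_apply, map_smul,
          LinearMap.smul_apply, smul_eq_mul, Finset.mul_sum, neg_mul, one_mul,
          Finset.sum_neg_distrib]
        rw [Finset.sum_comm, add_neg_eq_zero]
        refine Finset.sum_congr rfl fun i _ => Finset.sum_congr rfl fun j _ => ?_
        ring)
    filter_upwards [h, mutualDensity_self hE hm u] with x h1 h2
    simp only [Fintype.sum_sum_type, Sum.elim_inl, Sum.elim_inr, Fintype.sum_prod_type,
      Finset.univ_unique, Finset.sum_singleton, h2] at h1
    linarith [energyDensity_nonneg (E := E) m u x]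
  -- Rational coefficients need only countably many null sets; continuity in `c` gives all real ones
  -- outside the same null set.
  filter_upwards [ae_all_iff.2 key] with x hx c
  have hd : DenseRange (fun (q : ι → ℚ) (i : ι) => (q i : ℝ)) :=
    DenseRange.piMap fun _ => Rat.denseRange_cast
  exact hd.induction_on c (isClosed_le continuous_const (by fun_prop)) hx

/-! ### Pointwise densities of the semi-inner product on tensors -/

theorem integrableOn_boundedBorel_mul {m : Measure X} {q : X → ℝ} {K : Set X}
    (hq : IntegrableOn q K m) (h : boundedBorel X) :
    IntegrableOn (fun x => q x * (h : X → ℝ) x) K m := by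
  obtain ⟨h, hh, C, hC⟩ := h
  exact hq.mul_bdd (c := C) hh.aestronglyMeasurable (.of_forall hC)

theorem mutualIntegral_eq (hE : E.IsStronglyLocal) {m : Measure X} (hm : E.IsEnergyDominant m)
    (K : Compacts X) (h : boundedBorel X) (f g : E.locContinuous) :
    E.mutualIntegral K h f g =
      ∫ x in (K : Set X), E.mutualDensity m f g x * (h : X → ℝ) x ∂m := by
  have ha := E.locContinuous.add_mem f.2 g.2
  have hs := E.locContinuous.sub_mem f.2 g.2
  have hK := K.isCompact
  rw [mutualIntegral, ← setIntegral_energyDensity hE hm ha _ hK.measurableSet,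
    ← setIntegral_energyDensity hE hm hs _ hK.measurableSet,
    ← integral_sub (integrableOn_boundedBorel_mul (integrableOn_energyDensity hE m ha hK) h)
      (integrableOn_boundedBorel_mul (integrableOn_energyDensity hE m hs hK) h),
    ← integral_const_mul]
  refine integral_congr_ae (.of_forall fun x => ?_)
  simp only [mutualDensity]
  ring

/-- The product in `B_b(X)`. -/
def boundedBorelProd (g h : boundedBorel X) : boundedBorel X := boundedBorelMul h g

theorem mutualIntegral_prod_eq (hE : E.IsStronglyLocal) {m : Measure X}
    (hm : E.IsEnergyDominant m) (K : Compacts X) (g g' : boundedBorel X) (f f' : E.locContinuous) :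
    E.mutualIntegral K (fun x => (g : X → ℝ) x * (g' : X → ℝ) x) f f' =
      ∫ x in (K : Set X), E.mutualDensity m f f' x * ((g : X → ℝ) x * (g' : X → ℝ) x) ∂m :=
  mutualIntegral_eq hE hm K (boundedBorelProd g g') f f'

theorem integrableOn_mutualDensity_mul (hE : E.IsStronglyLocal) (m : Measure X) (K : Compacts X)
    (g g' : boundedBorel X) (f f' : E.locContinuous) :
    IntegrableOn (fun x => E.mutualDensity m f f' x * ((g : X → ℝ) x * (g' : X → ℝ) x)) K m :=
  integrableOn_boundedBorel_mul (integrableOn_mutualDensity hE m f.2 f'.2 K.isCompact)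
    (boundedBorelProd g g')

variable (E) in
/-- A density of the seminorm of an element of `(𝓕_loc ∩ C(X)) ⊗ B_b(X)`. -/
theorem exists_density (hE : E.IsStronglyLocal) {m : Measure X} (hm : E.IsEnergyDominant m)
    (t : E.locContinuous ⊗[ℝ] boundedBorel X) : ∃ q : X → ℝ, (∀ᵐ x ∂m, 0 ≤ q x) ∧
      (∀ K : Compacts X, IntegrableOn q K m) ∧ ∀ (K : Compacts X)
        (B : LinearMap.BilinForm ℝ (E.locContinuous ⊗[ℝ] boundedBorel X)),
        (∀ (f f' : E.locContinuous) (g g' : boundedBorel X), B (f ⊗ₜ g) (f' ⊗ₜ g') =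
          E.mutualIntegral K (fun x => (g : X → ℝ) x * (g' : X → ℝ) x) (f : C(X, ℝ)) f') →
        ∀ h : boundedBorel X, B (E.rightMul h t) (E.rightMul h t) =
          ∫ x in (K : Set X), q x * ((h : X → ℝ) x * (h : X → ℝ) x) ∂m := by
  obtain ⟨n, f, g, rfl⟩ := TensorProduct.exists_sum_tmul_eq t
  refine ⟨fun x => ∑ i, ∑ j, E.mutualDensity m (f i) (f j) x * ((g i : X → ℝ) x * (g j : X → ℝ) x),
    ?_, fun K => ?_, fun K B hB h => ?_⟩
  -- The coefficients are the values `g_i(x)`, which vary with `x`. Definiteness is therefore needed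
  -- for all coefficient vectors outside a single null set.
  · filter_upwards [mutualDensity_psd hE hm f] with x hx
    have := hx fun i => (g i : X → ℝ) x
    simpa only [mul_comm] using this
  · exact integrable_finsetSum _ fun i _ => integrable_finsetSum _ fun j _ =>
      integrableOn_mutualDensity_mul hE m K _ _ _ _
  · have hi : ∀ i j, IntegrableOn (fun x => E.mutualDensity m (f i) (f j) x *
        ((g i : X → ℝ) x * (g j : X → ℝ) x) * ((h : X → ℝ) x * (h : X → ℝ) x)) K m := fun i j =>
      integrableOn_boundedBorel_mul (integrableOn_mutualDensity_mul hE m K (g i) (g j) (f i) (f j))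
        (boundedBorelProd h h)
    simp only [Finset.sum_mul]
    rw [integral_finsetSum _ fun i _ => integrable_finsetSum _ fun j _ => hi i j]
    simp only [map_sum, LinearMap.sum_apply]
    rw [Finset.sum_comm]
    refine Finset.sum_congr rfl fun i _ => ?_
    rw [integral_finsetSum _ fun j _ => hi i j]
    refine Finset.sum_congr rfl fun j _ => ?_
    simp only [rightMul, LinearMap.lTensor_tmul]
    rw [hB, mutualIntegral_prod_eq hE hm]
    refine integral_congr_ae (.of_forall fun x => ?_)
    simp only [boundedBorelMul, LinearMap.coe_mk, AddHom.coe_mk]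
    ring

theorem rightMul_one (t : E.locContinuous ⊗[ℝ] boundedBorel X) :
    E.rightMul (boundedBorelOne X) t = t := by
  have : boundedBorelMul (boundedBorelOne X) = LinearMap.id := by
    ext g x
    simp [boundedBorelMul, boundedBorelOne]
  rw [rightMul, this, LinearMap.lTensor_id, LinearMap.id_apply]

/-- The prescription on elementary tensors extends because the mutual density is a.e. bilinear and
symmetric, so the integrals are multilinear. Nonnegativity is the pointwise one of the density,
integrated over `K`. -/
theorem exists_isTensorForm (hE : E.IsStronglyLocal) {m : Measure X} (hm : E.IsEnergyDominant m)
    (K : Compacts X) : ∃ B, E.IsTensorForm K B := by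
  let I : E.locContinuous → boundedBorel X → E.locContinuous → boundedBorel X → ℝ :=
    fun f g f' g' =>
      ∫ x in (K : Set X), E.mutualDensity m f f' x * ((g : X → ℝ) x * (g' : X → ℝ) x) ∂m
  have hint := fun f g f' g' => integrableOn_mutualDensity_mul hE m K g g' f f'
  have hsymm : ∀ f g f' g', I f g f' g' = I f' g' f g := fun f g f' g' => by
    refine integral_congr_ae (ae_restrict_of_ae ?_)
    filter_upwards [mutualDensity_comm hE hm f f'] with x hx
    rw [hx]
    ring
  have hadd : ∀ f₁ f₂ g f' g', I (f₁ + f₂) g f' g' = I f₁ g f' g' + I f₂ g f' g' :=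
    fun f₁ f₂ g f' g' => by
      simp only [I]
      rw [← integral_add (hint _ _ _ _) (hint _ _ _ _)]
      refine integral_congr_ae (ae_restrict_of_ae ?_)
      filter_upwards [mutualDensity_add hE hm f₁ f₂ f'] with x hx
      rw [hx]
      ring
  have hsmul : ∀ (c : ℝ) f g f' g', I (c • f) g f' g' = c * I f g f' g' := fun c f g f' g' => by
    simp only [I]
    rw [← integral_const_mul]
    refine integral_congr_ae (ae_restrict_of_ae ?_)
    filter_upwards [mutualDensity_smul hE hm c f f'] with x hx
    rw [hx]
    ring
  have hadd' : ∀ f g₁ g₂ f' g', I f (g₁ + g₂) f' g' = I f g₁ f' g' + I f g₂ f' g' :=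
    fun f g₁ g₂ f' g' => by
      simp only [I]
      rw [← integral_add (hint _ _ _ _) (hint _ _ _ _)]
      refine integral_congr_ae (.of_forall fun x => ?_)
      simp only [Submodule.coe_add, Pi.add_apply]
      ring
  have hsmul' : ∀ (c : ℝ) f g f' g', I f (c • g) f' g' = c * I f g f' g' := fun c f g f' g' => by
    simp only [I]
    rw [← integral_const_mul]
    refine integral_congr_ae (.of_forall fun x => ?_)
    simp only [Submodule.coe_smul, Pi.smul_apply, smul_eq_mul]
    ring
  let J : E.locContinuous → boundedBorel X → E.locContinuous ⊗[ℝ] boundedBorel X →ₗ[ℝ] ℝ :=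
    fun f g => TensorProduct.lift (LinearMap.mk₂ ℝ (fun f' g' => I f g f' g')
      (fun f₁ f₂ g' => by simp only [hsymm f g, hadd])
      (fun c f' g' => by simp only [hsymm f g, hsmul, smul_eq_mul])
      (fun f' g₁ g₂ => by simp only [hsymm f g, hadd'])
      (fun c f' g' => by simp only [hsymm f g, hsmul', smul_eq_mul]))
  have hJ : ∀ f g f' g', J f g (f' ⊗ₜ g') = I f g f' g' := fun f g f' g' => rfl
  let B : LinearMap.BilinForm ℝ (E.locContinuous ⊗[ℝ] boundedBorel X) :=
    TensorProduct.lift (LinearMap.mk₂ ℝ J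
      (fun f₁ f₂ g => TensorProduct.ext' fun f' g' => by simp only [LinearMap.add_apply, hJ, hadd])
      (fun c f g => TensorProduct.ext' fun f' g' => by
        simp only [LinearMap.smul_apply, hJ, hsmul, smul_eq_mul])
      (fun f g₁ g₂ => TensorProduct.ext' fun f' g' => by simp only [LinearMap.add_apply, hJ, hadd'])
      (fun c f g => TensorProduct.ext' fun f' g' => by
        simp only [LinearMap.smul_apply, hJ, hsmul', smul_eq_mul]))
  have hB : ∀ f g f' g', B (f ⊗ₜ g) (f' ⊗ₜ g') = I f g f' g' := fun f g f' g' => rfl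
  have htmul : ∀ (f f' : E.locContinuous) (g g' : boundedBorel X), B (f ⊗ₜ g) (f' ⊗ₜ g') =
      E.mutualIntegral K (fun x => (g : X → ℝ) x * (g' : X → ℝ) x) (f : C(X, ℝ)) f' :=
    fun f f' g g' => by rw [hB, mutualIntegral_prod_eq hE hm]
  refine ⟨B, htmul, fun s t => ?_, fun t => ?_⟩
  · have : B = B.flip := by
      refine TensorProduct.ext' fun f g => TensorProduct.ext' fun f' g' => ?_
      rw [LinearMap.BilinForm.flip_apply, hB, hB, hsymm]
    conv_lhs => rw [this]
    rfl
  · obtain ⟨q, hq, -, hqB⟩ := E.exists_density hE hm t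
    have h := hqB K B htmul (boundedBorelOne X)
    rw [rightMul_one] at h
    rw [h]
    refine integral_nonneg_of_ae (ae_restrict_of_ae ?_)
    filter_upwards [hq] with x hx
    exact mul_nonneg hx (mul_self_nonneg _)

/-! ### Norms in `𝓗(K)` -/

theorem tensorForm_spec (hE : E.IsStronglyLocal) {m : Measure X} (hm : E.IsEnergyDominant m)
    (K : Compacts X) : E.IsTensorForm K (E.tensorForm K) := by
  have h := exists_isTensorForm hE hm K
  rw [tensorForm, dif_pos h]
  exact h.choose_spec

theorem inner_toOneForms (K : Compacts X) (s t : E.locContinuous ⊗[ℝ] boundedBorel X) :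
    Inner.inner ℝ (E.toOneForms K s) (E.toOneForms K t) = E.tensorForm K s t :=
  UniformSpace.Completion.inner_coe (𝕜 := ℝ) (E := E.TensorSpace K) s t

theorem norm_toOneForms_sq (K : Compacts X) (t : E.locContinuous ⊗[ℝ] boundedBorel X) :
    ‖E.toOneForms K t‖ ^ 2 = E.tensorForm K t t := by
  rw [← real_inner_self_eq_norm_sq, inner_toOneForms]

theorem denseRange_toOneForms (K : Compacts X) : DenseRange (E.toOneForms K) :=
  UniformSpace.Completion.denseRange_coe (α := E.TensorSpace K)

theorem norm_tmul_sq (hE : E.IsStronglyLocal) {m : Measure X} (hm : E.IsEnergyDominant m)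
    (K : Compacts X) (f : E.locContinuous) (g : boundedBorel X) :
    ‖E.toOneForms K (f ⊗ₜ g)‖ ^ 2 =
      ∫ x in (K : Set X), E.energyDensity m f x * ((g : X → ℝ) x * (g : X → ℝ) x) ∂m := by
  rw [norm_toOneForms_sq, (tensorForm_spec hE hm K).tmul, mutualIntegral_prod_eq hE hm]
  refine integral_congr_ae (ae_restrict_of_ae ?_)
  filter_upwards [mutualDensity_self hE hm f] with x hx
  rw [hx]

/-- One nonnegative density serves all compact sets at once, so the squared seminorm grows with the
domain of integration. -/
theorem norm_toOneForms_mono (hE : E.IsStronglyLocal) {m : Measure X} (hm : E.IsEnergyDominant m)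
    {K K' : Compacts X} (hK : K ≤ K') (t : E.locContinuous ⊗[ℝ] boundedBorel X) :
    ‖E.toOneForms K t‖ ≤ ‖E.toOneForms K' t‖ := by
  refine (sq_le_sq₀ (norm_nonneg _) (norm_nonneg _)).1 ?_
  rw [norm_toOneForms_sq, norm_toOneForms_sq]
  obtain ⟨q, hq, hqi, hqB⟩ := E.exists_density hE hm t
  have h1 := hqB K _ (tensorForm_spec hE hm K).tmul (boundedBorelOne X)
  have h2 := hqB K' _ (tensorForm_spec hE hm K').tmul (boundedBorelOne X)
  rw [rightMul_one] at h1 h2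
  rw [h1, h2]
  refine setIntegral_mono_set ?_ ?_ (LE.le.eventuallyLE hK)
  · exact integrableOn_boundedBorel_mul (hqi K') (boundedBorelProd _ _)
  · refine ae_restrict_of_ae ?_
    filter_upwards [hq] with x hx
    exact mul_nonneg hx (mul_self_nonneg _)

theorem norm_toOneForms_rightMul_le (hE : E.IsStronglyLocal) {m : Measure X}
    (hm : E.IsEnergyDominant m) (K : Compacts X) (h : boundedBorel X) {C : ℝ} (hC0 : 0 ≤ C)
    (hC : ∀ x, |(h : X → ℝ) x| ≤ C) (t : E.locContinuous ⊗[ℝ] boundedBorel X) :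
    ‖E.toOneForms K (E.rightMul h t)‖ ≤ C * ‖E.toOneForms K t‖ := by
  refine (sq_le_sq₀ (norm_nonneg _) (by positivity)).1 ?_
  rw [mul_pow, norm_toOneForms_sq, norm_toOneForms_sq]
  obtain ⟨q, hq, hqi, hqB⟩ := E.exists_density hE hm t
  have h1 := hqB K _ (tensorForm_spec hE hm K).tmul (boundedBorelOne X)
  rw [rightMul_one] at h1
  rw [h1, hqB K _ (tensorForm_spec hE hm K).tmul h, ← integral_const_mul]
  refine integral_mono_ae (integrableOn_boundedBorel_mul (hqi K) (boundedBorelProd h h))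
    ((integrableOn_boundedBorel_mul (hqi K) (boundedBorelProd _ _)).const_mul _)
    (ae_restrict_of_ae ?_)
  filter_upwards [hq] with x hx
  have h2 : (h : X → ℝ) x * (h : X → ℝ) x ≤ C ^ 2 := by
    rw [← sq, ← sq_abs]
    exact pow_le_pow_left₀ (abs_nonneg _) (hC x) 2
  simp only [boundedBorelOne, mul_one]
  nlinarith

/-! ### Restriction and action as single-valued relations -/

/-- A closed relation dominated in norm is single-valued. -/
theorem norm_le_of_mem_closure_range {V H₁ H₂ : Type*} [AddCommMonoid V] [Module ℝ V]
    [NormedAddCommGroup H₁] [NormedSpace ℝ H₁] [NormedAddCommGroup H₂] [NormedSpace ℝ H₂]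
    {S : V →ₗ[ℝ] H₁} {T : V →ₗ[ℝ] H₂} {C : ℝ} (h : ∀ v, ‖T v‖ ≤ C * ‖S v‖) {p : H₁ × H₂}
    (hp : p ∈ (LinearMap.range (S.prod T)).topologicalClosure) : ‖p.2‖ ≤ C * ‖p.1‖ := by
  have hcl : IsClosed {p : H₁ × H₂ | ‖p.2‖ ≤ C * ‖p.1‖} :=
    isClosed_le (by fun_prop) (by fun_prop)
  refine closure_minimal ?_ hcl hp
  rintro _ ⟨v, rfl⟩
  exact h v

theorem eq_of_mem_closure_range {V H₁ H₂ : Type*} [AddCommMonoid V] [Module ℝ V]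
    [NormedAddCommGroup H₁] [NormedSpace ℝ H₁] [NormedAddCommGroup H₂] [NormedSpace ℝ H₂]
    {S : V →ₗ[ℝ] H₁} {T : V →ₗ[ℝ] H₂} {C : ℝ} (h : ∀ v, ‖T v‖ ≤ C * ‖S v‖) {a : H₁} {b c : H₂}
    (hb : (a, b) ∈ (LinearMap.range (S.prod T)).topologicalClosure)
    (hc : (a, c) ∈ (LinearMap.range (S.prod T)).topologicalClosure) : b = c := by
  have h1 := norm_le_of_mem_closure_range h (Submodule.sub_mem _ hb hc)
  simp only [Prod.fst_sub, Prod.snd_sub, sub_self, norm_zero, mul_zero] at h1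
  exact sub_eq_zero.1 (norm_le_zero_iff.1 h1)

/-- The closure of the graph of a contraction is still the graph of a map. Membership in
`restrictionGraph` can therefore be used as an equation. -/
theorem eq_of_mem_restrictionGraph (hE : E.IsStronglyLocal) {m : Measure X}
    (hm : E.IsEnergyDominant m) {K K' : Compacts X} (hK : K ≤ K') {a : E.OneForms K'}
    {b c : E.OneForms K} (hb : (a, b) ∈ E.restrictionGraph K K')
    (hc : (a, c) ∈ E.restrictionGraph K K') : b = c :=
  eq_of_mem_closure_range (C := 1)
    (fun v => by rw [one_mul]; exact norm_toOneForms_mono hE hm hK v) hb hc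

theorem eq_of_mem_actionGraph (hE : E.IsStronglyLocal) {m : Measure X}
    (hm : E.IsEnergyDominant m) {K : Compacts X} {h : boundedBorel X} {a b c : E.OneForms K}
    (hb : (a, b) ∈ E.actionGraph K h) (hc : (a, c) ∈ E.actionGraph K h) : b = c := by
  obtain ⟨C, hC⟩ := h.2.2
  exact eq_of_mem_closure_range (C := |C|) (fun v => norm_toOneForms_rightMul_le hE hm K h
    (abs_nonneg C) (fun x => (hC x).trans (le_abs_self C)) v) hb hc

end Tensor

end DirichletForm

/-! ## Direct integrals -/

/-- The indicator function of a measurable set, as a bounded Borel function. -/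
def boundedBorelIndicator {X : Type u} [MeasurableSpace X] {A : Set X} (hA : MeasurableSet A) :
    boundedBorel X :=
  ⟨A.indicator fun _ => 1, measurable_const.indicator hA, 1, fun x => by
    by_cases h : x ∈ A <;> simp [h]⟩

namespace HilbertField

section Integral

variable {X : Type u} [MeasurableSpace X] (H : HilbertField.{u, v} X)

/-- Gluing countably many measurable sections. -/
theorem mem_sections_of_piecewise {a : ∀ x, H.fibre x} (s : ℕ → Set X)
    (hs : ∀ n, MeasurableSet (s n)) (hu : ∀ x, ∃ n, x ∈ s n) (b : ℕ → ∀ x, H.fibre x)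
    (hb : ∀ n, b n ∈ H.sections) (hab : ∀ n, ∀ x ∈ s n, a x = b n x) : a ∈ H.sections := by
  refine H.mem_sections _ fun c hc => ?_
  intro t ht
  have : (fun x => Inner.inner ℝ (a x) (c x)) ⁻¹' t =
      ⋃ n, s n ∩ (fun x => Inner.inner ℝ (b n x) (c x)) ⁻¹' t := by
    ext x
    simp only [mem_preimage, mem_iUnion, mem_inter_iff]
    constructor
    · intro h
      obtain ⟨n, hn⟩ := hu x
      exact ⟨n, hn, by rwa [← hab n x hn]⟩
    · rintro ⟨n, hn, h⟩
      rwa [hab n x hn]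
  rw [this]
  exact MeasurableSet.iUnion fun n => (hs n).inter (H.measurable_inner (hb n) hc ht)

variable [TopologicalSpace X] (m : Measure X) {K : Compacts X}

theorem inner_toDirectIntegral (a b : H.l2 m K) :
    Inner.inner ℝ (H.toDirectIntegral m K a) (H.toDirectIntegral m K b) =
      ∫ x in (K : Set X), Inner.inner ℝ (a.1 x) (b.1 x) ∂m :=
  SeparationQuotient.inner_mk_mk (𝕜 := ℝ) (E := H.L2Sections m K) a b

theorem norm_toDirectIntegral_sq (a : H.l2 m K) :
    ‖H.toDirectIntegral m K a‖ ^ 2 = ∫ x in (K : Set X), ‖a.1 x‖ ^ 2 ∂m := by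
  rw [← real_inner_self_eq_norm_sq, inner_toDirectIntegral]
  simp only [real_inner_self_eq_norm_sq]

/-- The class in the direct integral, as a linear map. -/
def toDirectIntegralₗ (K : Compacts X) : H.l2 m K →ₗ[ℝ] H.DirectIntegral m K where
  toFun := H.toDirectIntegral m K
  map_add' _ _ := rfl
  map_smul' _ _ := rfl

theorem toDirectIntegral_sub (a b : H.l2 m K) :
    H.toDirectIntegral m K (a - b) = H.toDirectIntegral m K a - H.toDirectIntegral m K b :=
  map_sub (H.toDirectIntegralₗ m K) a b

theorem toDirectIntegral_surjective : Function.Surjective (H.toDirectIntegral m K) :=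
  SeparationQuotient.surjective_mk (X := H.L2Sections m K)

theorem toDirectIntegral_eq_iff (a b : H.l2 m K) :
    H.toDirectIntegral m K a = H.toDirectIntegral m K b ↔
      ∀ᵐ x ∂(m.restrict K), a.1 x = b.1 x := by
  rw [← sub_eq_zero, ← toDirectIntegral_sub, ← norm_eq_zero, ← sq_eq_zero_iff,
    norm_toDirectIntegral_sq, integral_eq_zero_iff_of_nonneg (fun x => sq_nonneg _) (a - b).2.2]
  refine eventually_congr (.of_forall fun x => ?_)
  change ‖a.1 x - b.1 x‖ ^ 2 = 0 ↔ _
  rw [sq_eq_zero_iff, norm_eq_zero, sub_eq_zero]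

/-- The direct integrals are complete. -/
theorem complete_directIntegral [IsFiniteMeasureOnCompacts m] :
    CompleteSpace (H.DirectIntegral m K) := by
  have hfin : IsFiniteMeasure (m.restrict K) := ⟨by
    rw [Measure.restrict_apply_univ]; exact K.isCompact.measure_lt_top⟩
  -- It suffices to treat sequences with distances below `2^{-N}`; this rate makes the increments
  -- summable almost everywhere.
  refine Metric.complete_of_convergent_controlled_sequences (fun n => (1 / 2 : ℝ) ^ n)
    (fun n => by positivity) fun u hu => ?_
  choose a ha using fun n => H.toDirectIntegral_surjective m (u n)
  have hdist : ∀ N i j, N ≤ i → N ≤ j →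
      ∫ x in (K : Set X), ‖(a i).1 x - (a j).1 x‖ ^ 2 ∂m ≤ ((1 / 2 : ℝ) ^ N) ^ 2 := by
    intro N i j hi hj
    have h := hu N i j hi hj
    rw [dist_eq_norm, ← ha i, ← ha j, ← toDirectIntegral_sub] at h
    have h2 := pow_le_pow_left₀ (norm_nonneg _) h.le 2
    rwa [norm_toDirectIntegral_sq] at h2
  have hmeas : ∀ i j, Measurable fun x => ‖(a i).1 x - (a j).1 x‖ :=
    fun i j => H.measurable_norm _ (H.sections.sub_mem (a i).2.1 (a j).2.1)
  have hsq : ∀ i j, IntegrableOn (fun x => ‖(a i).1 x - (a j).1 x‖ ^ 2) K m :=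
    fun i j => (a i - a j).2.2
  -- summability of the increments
  set d : ℕ → X → ENNReal := fun n x => ENNReal.ofReal ‖(a (n + 1)).1 x - (a n).1 x‖ with hd
  have hdm : ∀ n, Measurable (d n) := fun n => (hmeas _ _).ennreal_ofReal
  set M : ℝ := 1 / 2 * ((m.restrict K).real univ + 1)
  have hM : 0 ≤ M := by positivity
  have hdb : ∀ n, ∫⁻ x in (K : Set X), d n x ∂m ≤ ENNReal.ofReal ((1 / 2 : ℝ) ^ n * M) := by
    intro n
    -- The weights `2^{-n}` and `2^n` are balanced: the integral of the squared increment is at most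
    -- `4^{-n}`, so both terms integrate to a multiple of `2^{-n}`, the measure of `K` being finite.
    have hle : ∀ x, ‖(a (n + 1)).1 x - (a n).1 x‖ ≤
        1 / 2 * ((1 / 2 : ℝ) ^ n + 2 ^ n * ‖(a (n + 1)).1 x - (a n).1 x‖ ^ 2) := by
      intro x
      have h1 : (1 / 2 : ℝ) ^ n * 2 ^ n = 1 := by rw [← mul_pow]; norm_num
      have h2 : (0 : ℝ) < 2 ^ n := by positivity
      generalize ‖(a (n + 1)).1 x - (a n).1 x‖ = r
      have h3 := mul_nonneg h2.le (sq_nonneg (r - (1 / 2 : ℝ) ^ n))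
      have h4 : 2 ^ n * (r - (1 / 2 : ℝ) ^ n) ^ 2 = 2 ^ n * r ^ 2 -
          2 * r * ((1 / 2 : ℝ) ^ n * 2 ^ n) + (1 / 2 : ℝ) ^ n * ((1 / 2 : ℝ) ^ n * 2 ^ n) := by ring
      rw [h1] at h4
      linarith
    have hint : Integrable (fun x => 1 / 2 * ((1 / 2 : ℝ) ^ n +
        2 ^ n * ‖(a (n + 1)).1 x - (a n).1 x‖ ^ 2)) (m.restrict K) :=
      ((integrable_const _).add ((hsq _ _).const_mul _)).const_mul _
    calc ∫⁻ x in (K : Set X), d n x ∂m ≤ ∫⁻ x in (K : Set X), ENNReal.ofReal (1 / 2 *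
          ((1 / 2 : ℝ) ^ n + 2 ^ n * ‖(a (n + 1)).1 x - (a n).1 x‖ ^ 2)) ∂m :=
          lintegral_mono fun x => ENNReal.ofReal_le_ofReal (hle x)
      _ = ENNReal.ofReal (∫ x in (K : Set X), 1 / 2 *
          ((1 / 2 : ℝ) ^ n + 2 ^ n * ‖(a (n + 1)).1 x - (a n).1 x‖ ^ 2) ∂m) :=
          (ofReal_integral_eq_lintegral_ofReal hint (.of_forall fun x => by positivity)).symm
      _ ≤ _ := by
        refine ENNReal.ofReal_le_ofReal ?_
        rw [integral_const_mul, integral_add (integrable_const _) ((hsq _ _).const_mul _),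
          integral_const, integral_const_mul, smul_eq_mul]
        have h1 := hdist n (n + 1) n (Nat.le_succ n) le_rfl
        have h2 : (1 / 2 : ℝ) ^ n * 2 ^ n = 1 := by rw [← mul_pow]; norm_num
        have h3 := mul_le_mul_of_nonneg_left h1 (by positivity : (0 : ℝ) ≤ 2 ^ n)
        have h4 : (2 : ℝ) ^ n * ((1 / 2 : ℝ) ^ n) ^ 2 = (1 / 2 : ℝ) ^ n := by
          rw [sq, ← mul_assoc, mul_comm ((2 : ℝ) ^ n), h2, one_mul]
        simp only [M]
        nlinarith
  have hsum : ∫⁻ x in (K : Set X), ∑' n, d n x ∂m ≠ ∞ := by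
    rw [lintegral_tsum fun n => (hdm n).aemeasurable]
    refine ne_top_of_le_ne_top ?_ (ENNReal.tsum_le_tsum hdb)
    have hs : Summable fun n : ℕ => (1 / 2 : ℝ) ^ n * M := summable_geometric_two.mul_right M
    rw [← ENNReal.ofReal_tsum_of_nonneg (fun n => by positivity) hs]
    exact ENNReal.ofReal_ne_top
  have htm : Measurable fun x => ∑' n, d n x := Measurable.tsum hdm
  set S : Set X := {x | ∑' n, d n x < ∞} with hS
  have hSm : MeasurableSet S := measurableSet_lt htm measurable_const
  have hSae : ∀ᵐ x ∂(m.restrict K), x ∈ S := ae_lt_top htm hsum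
  have hlim : ∀ x ∈ S, ∃ l, Tendsto (fun n => (a n).1 x) atTop (𝓝 l) := by
    intro x hx
    refine cauchySeq_tendsto_of_complete (cauchySeq_of_summable_dist ?_)
    have h1 := ENNReal.summable_toReal (ne_of_lt hx)
    refine h1.congr fun n => ?_
    rw [hd, ENNReal.toReal_ofReal (norm_nonneg _), dist_comm, dist_eq_norm]
  classical
  -- The pointwise limit on the measurable convergence set, and `0` elsewhere to keep the section
  -- measurable.
  let b : ∀ x, H.fibre x := fun x => if h : x ∈ S then (hlim x h).choose else 0
  have hb : ∀ x ∈ S, Tendsto (fun n => (a n).1 x) atTop (𝓝 (b x)) := by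
    intro x hx
    simp only [b, dif_pos hx]
    exact (hlim x hx).choose_spec
  have hb0 : ∀ x ∉ S, b x = 0 := fun x hx => by simp only [b, dif_neg hx]
  have hbs : b ∈ H.sections := by
    refine H.mem_sections _ fun c hc => ?_
    refine measurable_of_tendsto_metrizable (f := fun n => S.indicator fun x =>
      Inner.inner ℝ ((a n).1 x) (c x))
      (fun n => (H.measurable_inner (a n).2.1 hc).indicator hSm) ?_
    rw [tendsto_pi_nhds]
    intro x
    by_cases hx : x ∈ S
    · simp only [indicator_of_mem hx]
      exact (hb x hx).inner tendsto_const_nhds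
    · simp only [indicator_of_notMem hx, hb0 x hx, inner_zero_left]
      exact tendsto_const_nhds
  have hdm2 : ∀ N, Measurable fun x => ‖b x - (a N).1 x‖ :=
    fun N => H.measurable_norm _ (H.sections.sub_mem hbs (a N).2.1)
  -- Fatou's lemma turns the mutual distances of the sequence into distances to the limit section.
  -- This also shows that `b` is square integrable.
  have hfatou : ∀ N, ∫⁻ x in (K : Set X), ENNReal.ofReal (‖b x - (a N).1 x‖ ^ 2) ∂m ≤
      ENNReal.ofReal (((1 / 2 : ℝ) ^ N) ^ 2) := by
    intro N
    calc _ ≤ ∫⁻ x in (K : Set X), liminf (fun n => ENNReal.ofReal (‖(a n).1 x - (a N).1 x‖ ^ 2))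
            atTop ∂m := by
          refine lintegral_mono_ae ?_
          filter_upwards [hSae] with x hx
          refine le_of_eq (Tendsto.liminf_eq ?_).symm
          exact ENNReal.tendsto_ofReal ((((hb x hx).sub tendsto_const_nhds).norm).pow 2)
      _ ≤ liminf (fun n => ∫⁻ x in (K : Set X), ENNReal.ofReal (‖(a n).1 x - (a N).1 x‖ ^ 2) ∂m)
            atTop := lintegral_liminf_le fun n => ((hmeas n N).pow_const 2).ennreal_ofReal
      _ ≤ _ := by
          refine liminf_le_of_frequently_le' (Eventually.frequently ?_)
          filter_upwards [eventually_ge_atTop N] with n hn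
          rw [← ofReal_integral_eq_lintegral_ofReal (hsq n N) (.of_forall fun x => sq_nonneg _)]
          exact ENNReal.ofReal_le_ofReal (hdist N n N hn le_rfl)
  have hbN : ∀ N, b - (a N).1 ∈ H.l2 m K := by
    refine fun N => ⟨H.sections.sub_mem hbs (a N).2.1,
      ((hdm2 N).pow_const 2).aestronglyMeasurable, ?_⟩
    rw [hasFiniteIntegral_iff_ofReal (.of_forall fun x => sq_nonneg _)]
    exact (hfatou N).trans_lt ENNReal.ofReal_lt_top
  have hbl : b ∈ H.l2 m K := by
    have := (H.l2 m K).add_mem (hbN 0) (a 0).2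
    rwa [sub_add_cancel] at this
  refine ⟨H.toDirectIntegral m K ⟨b, hbl⟩, ?_⟩
  rw [tendsto_iff_dist_tendsto_zero]
  refine squeeze_zero (fun n => dist_nonneg) (fun n => ?_)
    (tendsto_pow_atTop_nhds_zero_of_lt_one (r := (1 / 2 : ℝ)) (by norm_num) (by norm_num))
  rw [dist_comm, dist_eq_norm, ← ha n, ← toDirectIntegral_sub]
  refine (sq_le_sq₀ (norm_nonneg _) (by positivity)).1 ?_
  rw [norm_toDirectIntegral_sq]
  have h1 : ∫⁻ x in (K : Set X), ENNReal.ofReal (‖(b - (a n).1) x‖ ^ 2) ∂m ≤ _ := hfatou n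
  rw [← ofReal_integral_eq_lintegral_ofReal (hbN n).2 (.of_forall fun x => sq_nonneg _)] at h1
  exact (ENNReal.ofReal_le_ofReal_iff (by positivity)).1 h1

/-- Multiples of a sequence of sections that is total in every fibre are total in the direct
integral. -/
theorem dense_of_total [OpensMeasurableSpace X] [R1Space X] [IsFiniteMeasureOnCompacts m]
    {ι : Type*} [Countable ι] (e : ι → H.l2 m K)
    (he : ∀ x, Dense (Submodule.span ℝ (range fun n => (e n).1 x) : Set (H.fibre x)))
    (W : Submodule ℝ (H.DirectIntegral m K))
    (hW : ∀ n h, H.toDirectIntegral m K (H.l2Mul m h (e n)) ∈ W) :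
    Dense (W : Set (H.DirectIntegral m K)) := by
  have := H.complete_directIntegral m (K := K)
  rw [Submodule.dense_iff_topologicalClosure_eq_top, Submodule.topologicalClosure_eq_top_iff,
    Submodule.eq_bot_iff]
  intro v hv
  obtain ⟨a, rfl⟩ := H.toDirectIntegral_surjective m v
  rw [Submodule.mem_orthogonal] at hv
  -- Orthogonality to `𝟏_s e_n` for every measurable `s` annihilates the scalar function `⟨e_n, a⟩`.
  -- Since the index set is countable, one null set works for all `n`, and fibrewise totality gives
  -- `a = 0` off it.
  have h1 : ∀ n, ∀ᵐ x ∂(m.restrict K), Inner.inner ℝ ((e n).1 x) (a.1 x) = 0 := by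
    intro n
    have hi := H.integrable_inner m (e n) a
    refine hi.ae_eq_zero_of_forall_setIntegral_eq_zero fun s hs _ => ?_
    have h2 := hv _ (hW n (boundedBorelIndicator hs))
    rw [inner_toDirectIntegral] at h2
    rw [← integral_indicator hs, ← h2]
    refine integral_congr_ae (.of_forall fun x => ?_)
    simp only [l2Mul, boundedBorelIndicator, real_inner_smul_left]
    by_cases hx : x ∈ s <;> simp [hx]
  have h3 : ∀ᵐ x ∂(m.restrict K), a.1 x = (0 : H.l2 m K).1 x := by
    filter_upwards [ae_all_iff.2 h1] with x hx
    refine (he x).eq_zero_of_inner_left ℝ fun w hw => ?_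
    induction hw using Submodule.span_induction with
    | mem y hy =>
      obtain ⟨n, rfl⟩ := hy
      rw [real_inner_comm]
      exact hx n
    | zero => simp
    | add y z _ _ h1 h2 => rw [inner_add_right, h1, h2, add_zero]
    | smul c y _ h1 => rw [inner_smul_right, h1, mul_zero]
  exact (H.toDirectIntegral_eq_iff m a 0).2 h3

end Integral

end HilbertField

/-! ## The measurable field defined by a Gram matrix -/

/-- The bilinear form on finitely supported sequences with matrix `g`. -/
def gramForm (g : ℕ → ℕ → ℝ) : LinearMap.BilinForm ℝ (ℕ →₀ ℝ) :=
  Finsupp.linearCombination ℝ fun i => Finsupp.linearCombination ℝ (g i)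

theorem gramForm_single (g : ℕ → ℕ → ℝ) (i j : ℕ) (a b : ℝ) :
    gramForm g (Finsupp.single i a) (Finsupp.single j b) = a * (b * g i j) := by
  simp [gramForm, Finsupp.linearCombination_single]

theorem gramForm_eq_sum (g : ℕ → ℕ → ℝ) (a : ℕ →₀ ℝ) :
    gramForm g a a = ∑ i ∈ a.support, ∑ j ∈ a.support, a i * a j * g i j := by
  simp [gramForm, Finsupp.linearCombination_apply, Finsupp.sum, LinearMap.sum_apply,
    Finset.mul_sum, mul_assoc]

/-- A symmetric, nonnegative definite infinite matrix. -/
structure GramMatrix where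
  /-- the entries -/
  entry : ℕ → ℕ → ℝ
  symm : ∀ i j, entry i j = entry j i
  nonneg : ∀ a, 0 ≤ gramForm entry a a

namespace GramMatrix

/-- Finitely supported sequences with the semi-inner product defined by `g`. -/
def PreSpace (_g : GramMatrix) : Type := ℕ →₀ ℝ

variable (g : GramMatrix)

instance : AddCommGroup g.PreSpace := inferInstanceAs (AddCommGroup (ℕ →₀ ℝ))

instance : Module ℝ g.PreSpace := inferInstanceAs (Module ℝ (ℕ →₀ ℝ))

theorem gramForm_symm (a b : ℕ →₀ ℝ) : gramForm g.entry a b = gramForm g.entry b a := by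
  have h : gramForm g.entry = (gramForm g.entry).flip := by
    refine Finsupp.lhom_ext fun i r => Finsupp.lhom_ext fun j s => ?_
    rw [LinearMap.BilinForm.flip_apply, gramForm_single, gramForm_single, g.symm]
    ring
  conv_lhs => rw [h]
  rfl

/-- The semi-inner product defined by `g`. -/
@[reducible] def core : PreInnerProductSpace.Core ℝ g.PreSpace where
  inner a b := gramForm g.entry a b
  conj_inner_symm a b := g.gramForm_symm b a
  re_inner_nonneg a := g.nonneg a
  add_left a b c := LinearMap.map_add₂ (gramForm g.entry) a b c
  smul_left a b r := LinearMap.map_smul₂ (gramForm g.entry) r a b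

instance : SeminormedAddCommGroup g.PreSpace :=
  @InnerProductSpace.Core.toSeminormedAddCommGroup ℝ _ _ _ _ g.core

instance : InnerProductSpace ℝ g.PreSpace := InnerProductSpace.ofCore g.core

/-- The Hilbert space with Gram matrix `g`. -/
abbrev Space : Type := UniformSpace.Completion g.PreSpace

/-- The class of a finitely supported sequence. -/
def vec : (ℕ →₀ ℝ) →ₗ[ℝ] g.Space :=
  (UniformSpace.Completion.toComplₗᵢ (𝕜 := ℝ) (E := g.PreSpace)).toLinearMap

theorem inner_vec (a b : ℕ →₀ ℝ) : Inner.inner ℝ (g.vec a) (g.vec b) = gramForm g.entry a b :=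
  UniformSpace.Completion.inner_coe (𝕜 := ℝ) (E := g.PreSpace) a b

theorem denseRange_vec : DenseRange g.vec :=
  UniformSpace.Completion.denseRange_coe (α := g.PreSpace)

theorem vec_eq_sum (a : ℕ →₀ ℝ) : g.vec a = a.sum fun i r => r • g.vec (Finsupp.single i 1) := by
  conv_lhs => rw [← Finsupp.sum_single a]
  rw [Finsupp.sum, map_sum, Finsupp.sum]
  refine Finset.sum_congr rfl fun i _ => ?_
  rw [← map_smul, Finsupp.smul_single, smul_eq_mul, mul_one]

theorem dense_span_single :
    Dense (Submodule.span ℝ (range fun n => g.vec (Finsupp.single n 1)) : Set g.Space) := by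
  refine g.denseRange_vec.mono ?_
  rintro _ ⟨a, rfl⟩
  rw [vec_eq_sum]
  exact Submodule.sum_mem _ fun i _ => Submodule.smul_mem _ _ (Submodule.subset_span ⟨i, rfl⟩)

/-- Finitely supported rational sequences are dense. -/
theorem denseRange_vec_rat :
    DenseRange fun c : ℕ →₀ ℚ => g.vec (c.mapRange (fun q : ℚ => (q : ℝ)) Rat.cast_zero) := by
  let φ : (ℕ →₀ ℚ) →+ g.Space :=
    g.vec.toAddMonoidHom.comp (Finsupp.mapRange.addMonoidHom (Rat.castHom ℝ).toAddMonoidHom)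
  change Dense (range φ)
  have h1 : ∀ a : ℕ →₀ ℝ, g.vec a ∈ closure (φ.range : Set g.Space) := by
    intro a
    rw [vec_eq_sum, ← AddSubgroup.topologicalClosure_coe]
    refine AddSubgroup.sum_mem _ fun i _ => ?_
    change a i • g.vec (Finsupp.single i 1) ∈ closure (φ.range : Set g.Space)
    refine Rat.denseRange_cast.induction_on (p := fun r : ℝ => r • g.vec (Finsupp.single i 1) ∈
      closure (φ.range : Set g.Space)) (a i) (isClosed_closure.preimage (by fun_prop)) fun q => ?_
    refine subset_closure ⟨Finsupp.single i q, ?_⟩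
    rw [← map_smul, Finsupp.smul_single, smul_eq_mul, mul_one]
    simp [φ]
  have h2 : closure (range g.vec) ⊆ closure (φ.range : Set g.Space) :=
    closure_minimal (range_subset_iff.2 h1) isClosed_closure
  intro y
  exact h2 (g.denseRange_vec y)

/-- Completing the square gives `2⟨b, y⟩ - ‖y‖² = ‖b‖² - ‖b - y‖²`. The supremum over a countable
dense family of `y` makes the norm of a section measurable as soon as its pairings with the
generators are. -/
theorem norm_sq_eq_iSup (b : g.Space) : ‖b‖ ^ 2 = ⨆ c : ℕ →₀ ℚ,
    (2 * Inner.inner ℝ b (g.vec (c.mapRange (fun q : ℚ => (q : ℝ)) Rat.cast_zero)) -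
      ‖g.vec (c.mapRange (fun q : ℚ => (q : ℝ)) Rat.cast_zero)‖ ^ 2) := by
  have key : ∀ y : g.Space, 2 * Inner.inner ℝ b y - ‖y‖ ^ 2 = ‖b‖ ^ 2 - ‖b - y‖ ^ 2 := by
    intro y
    rw [norm_sub_sq_real]
    ring
  have hbdd : BddAbove (range fun c : ℕ →₀ ℚ =>
      (2 * Inner.inner ℝ b (g.vec (c.mapRange (fun q : ℚ => (q : ℝ)) Rat.cast_zero)) -
        ‖g.vec (c.mapRange (fun q : ℚ => (q : ℝ)) Rat.cast_zero)‖ ^ 2)) := by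
    refine ⟨‖b‖ ^ 2, ?_⟩
    rintro _ ⟨c, rfl⟩
    simp only [key]
    linarith [sq_nonneg ‖b - g.vec (c.mapRange (fun q : ℚ => (q : ℝ)) Rat.cast_zero)‖]
  refine le_antisymm ?_ (ciSup_le fun c => ?_)
  · refine le_of_forall_pos_le_add fun ε hε => ?_
    obtain ⟨c, hc⟩ := g.denseRange_vec_rat.exists_dist_lt b (Real.sqrt_pos.2 hε)
    rw [dist_eq_norm, Real.lt_sqrt (norm_nonneg _)] at hc
    have h1 := le_ciSup hbdd c
    simp only [key] at h1 ⊢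
    linarith
  · rw [key]
    linarith [sq_nonneg ‖b - g.vec (c.mapRange (fun q : ℚ => (q : ℝ)) Rat.cast_zero)‖]

end GramMatrix

/-- The measurable field of Hilbert spaces with measurable Gram matrices `g`. -/
def gramField {X : Type u} [MeasurableSpace X] (g : X → GramMatrix)
    (hg : ∀ i j, Measurable fun x => (g x).entry i j) : HilbertField.{u, 0} X where
  fibre x := (g x).Space
  sections :=
    { carrier := {b | ∀ i, Measurable fun x =>
        Inner.inner ℝ (b x) ((g x).vec (Finsupp.single i 1))}
      add_mem' := fun ha hb i => by
        simp only [Pi.add_apply, inner_add_left]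
        exact (ha i).add (hb i)
      zero_mem' := fun i => by
        simp only [Pi.zero_apply, inner_zero_left]
        exact measurable_const
      smul_mem' := fun c a ha i => by
        simp only [Pi.smul_apply, real_inner_smul_left]
        exact (ha i).const_mul c }
  measurable_norm := fun b hb => by
    have hv : ∀ a a' : ℕ →₀ ℝ, Measurable fun x =>
        Inner.inner ℝ ((g x).vec a) ((g x).vec a') := by
      intro a a'
      simp only [GramMatrix.inner_vec, gramForm, Finsupp.linearCombination_apply, Finsupp.sum,
        LinearMap.sum_apply, LinearMap.smul_apply, smul_eq_mul]
      fun_prop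
    have h1 : Measurable fun x => ‖b x‖ ^ 2 := by
      rw [show (fun x => ‖b x‖ ^ 2) = _ from funext fun x => (g x).norm_sq_eq_iSup (b x)]
      refine Measurable.iSup fun c => ?_
      refine Measurable.sub (Measurable.const_mul ?_ 2) ?_
      · set a : ℕ →₀ ℝ := c.mapRange (fun q : ℚ => (q : ℝ)) Rat.cast_zero
        rw [show (fun x => Inner.inner ℝ (b x) ((g x).vec a)) = fun x => ∑ i ∈ a.support,
            a i * Inner.inner ℝ (b x) ((g x).vec (Finsupp.single i 1)) from funext fun x => by
          rw [GramMatrix.vec_eq_sum, Finsupp.sum, inner_sum]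
          simp only [inner_smul_right]]
        exact Finset.measurable_sum _ fun i _ => (hb i).const_mul _
      · simp only [← real_inner_self_eq_norm_sq]
        exact hv _ _
    have h2 := h1.sqrt
    simpa only [Real.sqrt_sq (norm_nonneg _)] using h2
  mem_sections := fun b hb i => by
    refine hb (fun x => (g x).vec (Finsupp.single i 1)) fun j => ?_
    simp only [GramMatrix.inner_vec, gramForm_single, one_mul]
    exact hg i j
  total := by
    refine ⟨fun n x => (g x).vec (Finsupp.single n 1), fun i j => ?_,
      fun x => (g x).dense_span_single⟩
    simp only [GramMatrix.inner_vec, gramForm_single, one_mul]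
    exact hg i j

theorem gramField_vec_mem {X : Type u} [MeasurableSpace X] (g : X → GramMatrix)
    (hg : ∀ i j, Measurable fun x => (g x).entry i j) (i : ℕ) :
    (fun x => (g x).vec (Finsupp.single i 1)) ∈ (gramField g hg).sections := by
  intro j
  simp only [GramMatrix.inner_vec, gramForm_single, one_mul]
  exact hg i j

/-! ## Existence of a field of 1-form fibres -/

namespace HilbertField

section Integral

variable {X : Type u} [TopologicalSpace X] [MeasurableSpace X] (H : HilbertField.{u, v} X)
  (m : Measure X) {K : Compacts X}

/-- Multiplication of sections by bounded Borel functions, as a bilinear map. -/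
def l2Mulₗ (K : Compacts X) : boundedBorel X →ₗ[ℝ] H.l2 m K →ₗ[ℝ] H.l2 m K :=
  LinearMap.mk₂ ℝ (fun h a => H.l2Mul m h a)
    (fun _ _ _ => Subtype.ext (funext fun _ => add_smul _ _ _))
    (fun _ _ _ => Subtype.ext (funext fun _ => mul_smul _ _ _))
    (fun _ _ _ => Subtype.ext (funext fun _ => smul_add _ _ _))
    (fun _ _ _ => Subtype.ext (funext fun _ => smul_comm _ _ _))

theorem norm_toDirectIntegral_l2Mul_le (h : boundedBorel X) {C : ℝ} (hC0 : 0 ≤ C)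
    (hC : ∀ x, |(h : X → ℝ) x| ≤ C) (a : H.l2 m K) :
    ‖H.toDirectIntegral m K (H.l2Mul m h a)‖ ≤ C * ‖H.toDirectIntegral m K a‖ := by
  refine (sq_le_sq₀ (norm_nonneg _) (by positivity)).1 ?_
  rw [mul_pow, norm_toDirectIntegral_sq, norm_toDirectIntegral_sq, ← integral_const_mul]
  refine integral_mono (H.l2Mul m h a).2.2 (a.2.2.const_mul _) fun x => ?_
  simp only [l2Mul, norm_smul, mul_pow, Real.norm_eq_abs]
  exact mul_le_mul_of_nonneg_right (pow_le_pow_left₀ (abs_nonneg _) (hC x) 2) (by positivity)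

theorem norm_toDirectIntegral_mono {K' : Compacts X} (h : K ≤ K') (a : H.l2 m K') :
    ‖H.toDirectIntegral m K ⟨a.1, H.l2_mono m h a.2⟩‖ ≤ ‖H.toDirectIntegral m K' a‖ := by
  refine (sq_le_sq₀ (norm_nonneg _) (norm_nonneg _)).1 ?_
  rw [norm_toDirectIntegral_sq, norm_toDirectIntegral_sq]
  exact setIntegral_mono_set a.2.2 (.of_forall fun x => sq_nonneg _) (LE.le.eventuallyLE h)

/-- A closed linear relation satisfied by a bounded map on multiples of a sequence of sections
that is total in every fibre is satisfied on all sections. -/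
theorem mem_of_total [OpensMeasurableSpace X] [R1Space X] [IsFiniteMeasureOnCompacts m]
    {ι : Type*} [Countable ι] (e : ι → H.l2 m K)
    (he : ∀ x, Dense (Submodule.span ℝ (range fun n => (e n).1 x) : Set (H.fibre x)))
    {K' : Compacts X} (T : H.l2 m K →ₗ[ℝ] H.l2 m K') {C : ℝ}
    (hT : ∀ a, ‖H.toDirectIntegral m K' (T a)‖ ≤ C * ‖H.toDirectIntegral m K a‖)
    {V V' : Type*} [NormedAddCommGroup V] [NormedSpace ℝ V] [NormedAddCommGroup V']
    [NormedSpace ℝ V'] (Φ : H.DirectIntegral m K ≃ₗᵢ[ℝ] V) (Φ' : H.DirectIntegral m K' ≃ₗᵢ[ℝ] V')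
    (G : Submodule ℝ (V × V')) (hG : IsClosed (G : Set (V × V')))
    (hgen : ∀ n h, (Φ (H.toDirectIntegral m K (H.l2Mul m h (e n))),
      Φ' (H.toDirectIntegral m K' (T (H.l2Mul m h (e n))))) ∈ G) (a : H.l2 m K) :
    (Φ (H.toDirectIntegral m K a), Φ' (H.toDirectIntegral m K' (T a))) ∈ G := by
  let L : H.l2 m K →ₗ[ℝ] V × V' :=
    (Φ.toLinearEquiv.toLinearMap ∘ₗ H.toDirectIntegralₗ m K).prod
      (Φ'.toLinearEquiv.toLinearMap ∘ₗ H.toDirectIntegralₗ m K' ∘ₗ T)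
  -- The sections satisfying the relation form a subspace whose classes contain all generators,
  -- hence are dense. The bound on `T` and closedness of `G` carry the relation to limits.
  have hd := H.dense_of_total m e he ((G.comap L).map (H.toDirectIntegralₗ m K))
    fun n h => ⟨_, hgen n h, rfl⟩
  obtain ⟨s, hs, hsa⟩ := mem_closure_iff_seq_limit.1 (hd (H.toDirectIntegral m K a))
  choose b hb hbs using hs
  have hbs' : ∀ n, H.toDirectIntegral m K (b n) = s n := hbs
  have h1 : Tendsto (fun n => H.toDirectIntegral m K' (T (b n))) atTop
      (𝓝 (H.toDirectIntegral m K' (T a))) := by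
    rw [tendsto_iff_dist_tendsto_zero] at hsa ⊢
    refine squeeze_zero (fun n => dist_nonneg) (fun n => ?_) (by simpa using hsa.const_mul C)
    rw [dist_eq_norm, dist_eq_norm, ← hbs' n, ← toDirectIntegral_sub, ← toDirectIntegral_sub,
      ← map_sub]
    exact hT _
  refine hG.mem_of_tendsto (((Φ.continuous.tendsto _).comp hsa).prodMk_nhds
    ((Φ'.continuous.tendsto _).comp h1)) (.of_forall fun n => ?_)
  have := hb n
  simp only [Function.comp_apply, ← hbs' n]
  exact this

end Integral

end HilbertField

/-! ### The direct integral of the Gram field and `𝓗(K)` -/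

namespace DirichletForm

section Existence

variable {X : Type u} [MetricSpace X] [LocallyCompactSpace X] [SigmaCompactSpace X]
  [MeasurableSpace X] [BorelSpace X] {μ : Measure X} {E : DirichletForm μ}

variable (E) in
/-- The Dirichlet algebra is separable for the energy seminorm. -/
theorem exists_countable_dense_dirichletAlgebra [μ.Regular] : ∃ f : ℕ → C(X, ℝ),
    (∀ i, f i ∈ E.dirichletAlgebra) ∧
      ∀ w ∈ E.dirichletAlgebra, ∀ ε > 0, ∃ i, E.energy (w - f i : C(X, ℝ)) (w - f i : C(X, ℝ)) < ε := by
  have : SecondCountableTopology X := UniformSpace.secondCountable_of_separable X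
  have : Fact ((2 : ℝ≥0∞) ≠ ∞) := ⟨by simp⟩
  have : SecondCountableTopology (Lp ℝ 2 μ) := inferInstance
  -- `𝓕` inherits separability from `L²`, being the closure of the image of `L²` under the
  -- continuous resolvent.
  have : SeparableSpace (E.FormDomain 1) :=
    (E.dense_range_resolvent one_pos).separableSpace (E.exists_resolvent one_pos).choose.continuous
  have : SecondCountableTopology (E.FormDomain 1) := UniformSpace.secondCountable_of_separable _
  let S : Set (E.FormDomain 1) := {v | ∃ c ∈ E.dirichletAlgebra,
    ((E.formEquiv 1 v : Lp ℝ 2 μ) : X → ℝ) =ᵐ[μ] c}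
  have : Nonempty S := ⟨⟨0, 0, E.algebraSubmodule.zero_mem, by
    simpa using Lp.coeFn_zero ℝ 2 μ⟩⟩
  choose c hc hcs using fun i => (denseSeq S i).2
  refine ⟨c, hc, fun w hw ε hε => ?_⟩
  obtain ⟨v, hv⟩ := hw.2
  obtain ⟨i, hi⟩ := (denseRange_denseSeq S).exists_dist_lt
    ⟨(E.formEquiv 1).symm v, w, hw, by simpa using hv⟩ (Real.sqrt_pos.2 hε)
  refine ⟨i, ?_⟩
  rw [Subtype.dist_eq, dist_eq_norm, Real.lt_sqrt (norm_nonneg _), formDomain_norm_sq] at hi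
  have h1 := sub_ae hv (hcs i)
  rw [ContinuousMap.coe_sub, energy_eq h1 h1]
  simp only [map_sub, LinearEquiv.apply_symm_apply, NNReal.coe_one, one_mul] at hi ⊢
  have := sq_nonneg ‖((v - E.formEquiv 1 (denseSeq S i) : E.domain) : Lp ℝ 2 μ)‖
  linarith

/-- The defining properties of a Gram matrix hold only almost everywhere. A measurable null set
containing the exceptions receives the zero matrix, which keeps the entries measurable. -/
theorem exists_gramMatrix (hE : E.IsStronglyLocal) {m : Measure X} (hm : E.IsEnergyDominant m)
    (f : ℕ → E.locContinuous) : ∃ g : X → GramMatrix,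
      (∀ i j, Measurable fun x => (g x).entry i j) ∧
        ∀ᵐ x ∂m, ∀ i j, (g x).entry i j = E.mutualDensity m (f i) (f j) x := by
  have h1 : ∀ᵐ x ∂m, (∀ i j, E.mutualDensity m (f i) (f j) x = E.mutualDensity m (f j) (f i) x) ∧
      ∀ a, 0 ≤ gramForm (fun i j => E.mutualDensity m (f i) (f j) x) a a := by
    have h2 : ∀ᵐ x ∂m, ∀ s : Finset ℕ, ∀ c : s → ℝ,
        0 ≤ ∑ i : s, ∑ j : s, c i * c j * E.mutualDensity m (f i) (f j) x :=
      ae_all_iff.2 fun s => mutualDensity_psd hE hm fun i : s => f i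
    filter_upwards [ae_all_iff.2 fun i => ae_all_iff.2 fun j => mutualDensity_comm hE hm (f i) (f j),
      h2] with x hx hx2
    refine ⟨hx, fun a => ?_⟩
    rw [gramForm_eq_sum]
    have := hx2 a.support fun i => a i
    rw [Finset.sum_coe_sort a.support fun i => ∑ j : a.support,
      a i * a j * E.mutualDensity m (f i) (f j) x] at this
    refine this.trans_eq (Finset.sum_congr rfl fun i _ => ?_)
    exact Finset.sum_coe_sort a.support fun j => a i * a j * E.mutualDensity m (f i) (f j) x
  classical
  set N := toMeasurable m {x | ¬ ((∀ i j,
    E.mutualDensity m (f i) (f j) x = E.mutualDensity m (f j) (f i) x) ∧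
      ∀ a, 0 ≤ gramForm (fun i j => E.mutualDensity m (f i) (f j) x) a a)} with hN
  have hN0 : m N = 0 := by rw [hN, measure_toMeasurable]; exact h1
  have hNm : MeasurableSet N := measurableSet_toMeasurable _ _
  have hNx : ∀ x ∉ N, (∀ i j,
      E.mutualDensity m (f i) (f j) x = E.mutualDensity m (f j) (f i) x) ∧
      ∀ a, 0 ≤ gramForm (fun i j => E.mutualDensity m (f i) (f j) x) a a := by
    intro x hx
    by_contra h
    exact hx (subset_toMeasurable _ _ h)
  refine ⟨fun x => if h : x ∈ N then ⟨fun _ _ => 0, fun _ _ => rfl, fun a => by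
    rw [gramForm_eq_sum]; simp⟩ else ⟨fun i j => E.mutualDensity m (f i) (f j) x, (hNx x h).1,
      (hNx x h).2⟩, fun i j => ?_, ?_⟩
  · have : (fun x => GramMatrix.entry (if h : x ∈ N then ⟨fun _ _ => 0, fun _ _ => rfl, fun a => by
        rw [gramForm_eq_sum]; simp⟩ else ⟨fun i j => E.mutualDensity m (f i) (f j) x, (hNx x h).1,
        (hNx x h).2⟩) i j) = Nᶜ.indicator (E.mutualDensity m (f i) (f j)) := by
      ext x
      by_cases h : x ∈ N <;> simp [h]
    rw [this]
    exact (measurable_mutualDensity m _ _).indicator hNm.compl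
  · filter_upwards [compl_mem_ae_iff.2 hN0] with x hx i j
    rw [dif_neg hx]

/-- Approximation of `f ⊗ g` in `𝓗(K)`. -/
theorem dense_of_dirichletAlgebra (hE : E.IsStronglyLocal) {m : Measure X}
    (hm : E.IsEnergyDominant m) (K : Compacts X) {f : ℕ → E.locContinuous}
    (hf : ∀ i, (f i : C(X, ℝ)) ∈ E.dirichletAlgebra)
    (hfd : ∀ w ∈ E.dirichletAlgebra, ∀ ε > 0,
      ∃ i, E.energy (w - f i : C(X, ℝ)) (w - f i : C(X, ℝ)) < ε)
    (W : Submodule ℝ (E.OneForms K)) (hW : ∀ i h, E.toOneForms K (f i ⊗ₜ h) ∈ W) :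
    Dense (W : Set (E.OneForms K)) := by
  have key : ∀ u g, E.toOneForms K (u ⊗ₜ g) ∈ W.topologicalClosure := by
    intro u g
    obtain ⟨G, hGo, hKG, hGc, χ, hχ, hχ1⟩ := exists_cutoff_nhds hE.1 K.isCompact
    obtain ⟨C, hC⟩ := g.2.2
    have hw := mul_mem_of_mem_locContinuous hχ u.2
    change _ ∈ closure (W : Set (E.OneForms K))
    rw [Metric.mem_closure_iff]
    intro ε hε
    -- With `|g| ≤ C`, the squared norm of `(u - f_i) ⊗ g` is at most `C²` times the energy of `χ u
    -- - f_i`; the `+ 1` covers `C = 0`.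
    obtain ⟨i, hi⟩ := hfd _ hw (ε ^ 2 / (C ^ 2 + 1)) (by positivity)
    refine ⟨_, hW i g, ?_⟩
    rw [dist_eq_norm, ← map_sub, ← TensorProduct.sub_tmul]
    refine (sq_lt_sq₀ (norm_nonneg _) hε.le).1 ?_
    have hwi := sub_mem_dirichletAlgebra hw (hf i)
    -- Near `K` the functions `u - f_i` and `χ u - f_i ∈ 𝓒` agree, so by locality their energy
    -- measures agree there.
    have h1 := localEnergyMeasure_restrict hE (u - f i).2 hwi hGo hGc fun x hx => by
      simp [hχ1 x hx]
    have h2 : E.localEnergyMeasure (u - f i : E.locContinuous) K ≤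
        ENNReal.ofReal (E.energy (χ * u - f i : C(X, ℝ)) (χ * u - f i : C(X, ℝ))) := by
      rw [← inter_eq_left.2 hKG, ← Measure.restrict_apply K.isCompact.measurableSet, h1,
        Measure.restrict_apply K.isCompact.measurableSet, inter_eq_left.2 hKG]
      exact energyMeasure_le hE hwi K.isCompact
    have h3 : (E.localEnergyMeasure (u - f i : E.locContinuous)).real K < ε ^ 2 / (C ^ 2 + 1) := by
      refine lt_of_le_of_lt ?_ hi
      exact ENNReal.toReal_le_of_le_ofReal (energy_self_nonneg _) h2
    have := localEnergyMeasure_regular hE (u - f i).2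
    rw [norm_tmul_sq hE hm, setIntegral_energyDensity hE hm (u - f i).2 _ K.isCompact.measurableSet]
    have h4 : ∀ x, (g : X → ℝ) x * (g : X → ℝ) x ≤ C ^ 2 := fun x => by
      rw [← sq, ← sq_abs]
      exact pow_le_pow_left₀ (abs_nonneg _) (hC x) 2
    have h5 : ∫ x in (K : Set X), (g : X → ℝ) x * (g : X → ℝ) x
        ∂(E.localEnergyMeasure (u - f i : E.locContinuous)) ≤
        (E.localEnergyMeasure (u - f i : E.locContinuous)).real K * C ^ 2 := by
      refine (integral_mono_of_nonneg (.of_forall fun x => mul_self_nonneg _)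
        (integrableOn_const K.isCompact.measure_lt_top.ne (C := C ^ 2)) (.of_forall h4)).trans_eq ?_
      simp
    rw [lt_div_iff₀ (by positivity)] at h3
    have h6 : 0 ≤ (E.localEnergyMeasure (u - f i : E.locContinuous)).real K := measureReal_nonneg
    nlinarith
  have h2 : range (E.toOneForms K) ⊆ closure (W : Set (E.OneForms K)) := by
    rintro _ ⟨t, rfl⟩
    change _ ∈ W.topologicalClosure
    induction t using TensorProduct.induction_on with
    | zero => rw [map_zero]; exact Submodule.zero_mem _
    | tmul u g => exact key u g
    | add a b ha hb => rw [map_add]; exact Submodule.add_mem _ ha hb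
  intro y
  exact closure_minimal h2 isClosed_closure (denseRange_toOneForms K y)

/-- Two dense linear maps with the same Gram matrices are related by an isometry. -/
theorem exists_linearIsometryEquiv {ι V H₁ H₂ : Type*} [AddCommGroup V] [Module ℝ V]
    [NormedAddCommGroup H₁] [InnerProductSpace ℝ H₁] [CompleteSpace H₁]
    [NormedAddCommGroup H₂] [InnerProductSpace ℝ H₂] [CompleteSpace H₂]
    (a : ι → V →ₗ[ℝ] H₁) (b : ι → V →ₗ[ℝ] H₂)
    (ha : ∀ W : Submodule ℝ H₁, (∀ i v, a i v ∈ W) → Dense (W : Set H₁))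
    (hb : ∀ W : Submodule ℝ H₂, (∀ i v, b i v ∈ W) → Dense (W : Set H₂))
    (hab : ∀ i v j w, Inner.inner ℝ (b i v) (b j w) = Inner.inner ℝ (a i v) (a j w)) :
    ∃ Φ : H₁ ≃ₗᵢ[ℝ] H₂, ∀ i v, Φ (a i v) = b i v := by
  let A : (ι →₀ V) →ₗ[ℝ] H₁ := Finsupp.lsum ℝ a
  let B : (ι →₀ V) →ₗ[ℝ] H₂ := Finsupp.lsum ℝ b
  have hA1 : ∀ i v, A (Finsupp.single i v) = a i v := fun i v => by simp [A]
  have hB1 : ∀ i v, B (Finsupp.single i v) = b i v := fun i v => by simp [B]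
  have hA : DenseRange A := ha (LinearMap.range A) fun i v => ⟨_, hA1 i v⟩
  have hB : DenseRange B := hb (LinearMap.range B) fun i v => ⟨_, hB1 i v⟩
  have hAB : (innerₗ H₂).compl₁₂ B B = (innerₗ H₁).compl₁₂ A A := by
    refine Finsupp.lhom_ext fun i v => Finsupp.lhom_ext fun j w => ?_
    simp only [LinearMap.compl₁₂_apply, innerₗ_apply_apply, hA1, hB1, hab]
  have hnorm : ∀ x, ‖B (LinearEquiv.refl ℝ (ι →₀ V) x)‖ = ‖A x‖ := by
    intro x
    have h := LinearMap.congr_fun₂ hAB x x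
    simp only [LinearMap.compl₁₂_apply, innerₗ_apply_apply, real_inner_self_eq_norm_sq] at h
    exact (sq_eq_sq₀ (norm_nonneg _) (norm_nonneg _)).1 h
  refine ⟨(LinearEquiv.refl ℝ (ι →₀ V)).extendOfIsometry A B hA hB hnorm, fun i v => ?_⟩
  rw [← hA1, LinearEquiv.extendOfIsometry_eq, LinearEquiv.refl_apply, hB1]

/-- A measurable field whose sections `e i` have the Gram matrix of `∂(f i)` represents the
1-forms. -/
theorem exists_iso (hE : E.IsStronglyLocal) {m : Measure X} (hm : E.IsEnergyDominant m)
    (K : Compacts X) {f : ℕ → E.locContinuous} (hf : ∀ i, (f i : C(X, ℝ)) ∈ E.dirichletAlgebra)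
    (hfd : ∀ w ∈ E.dirichletAlgebra, ∀ ε > 0,
      ∃ i, E.energy (w - f i : C(X, ℝ)) (w - f i : C(X, ℝ)) < ε)
    (H : HilbertField.{u, v} X) (e : ℕ → H.l2 m K)
    (he : ∀ x, Dense (Submodule.span ℝ (range fun n => (e n).1 x) : Set (H.fibre x)))
    (hef : ∀ᵐ x ∂m, ∀ i j, Inner.inner ℝ ((e i).1 x) ((e j).1 x) =
      E.mutualDensity m (f i) (f j) x) :
    ∃ Φ : H.DirectIntegral m K ≃ₗᵢ[ℝ] E.OneForms K, ∀ i h,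
      Φ (H.toDirectIntegral m K (H.l2Mul m h (e i))) = E.toOneForms K (f i ⊗ₜ h) := by
  have := hm.1
  have := H.complete_directIntegral m (K := K)
  refine exists_linearIsometryEquiv
    (fun i => H.toDirectIntegralₗ m K ∘ₗ (H.l2Mulₗ m K).flip (e i))
    (fun i => E.toOneForms K ∘ₗ TensorProduct.mk ℝ E.locContinuous (boundedBorel X) (f i))
    (fun W hW => H.dense_of_total m e he W hW)
    (fun W hW => dense_of_dirichletAlgebra hE hm K hf hfd W hW) fun i h j h' => ?_
  refine (inner_toOneForms K _ _).trans ?_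
  refine Eq.trans ?_ (H.inner_toDirectIntegral m (H.l2Mul m h (e i)) (H.l2Mul m h' (e j))).symm
  rw [TensorProduct.mk_apply, TensorProduct.mk_apply, (tensorForm_spec hE hm K).tmul,
    mutualIntegral_prod_eq hE hm]
  refine integral_congr_ae (ae_restrict_of_ae ?_)
  filter_upwards [hef] with x hx
  simp only [HilbertField.l2Mul, inner_smul_left, inner_smul_right, hx, conj_trivial]
  ring

/-- The same sections `s i` serve as generators over every compact set. Hence the isomorphisms all
send `h s_i` to `f_i ⊗ h`, and both compatibility relations are evident on generators. -/
theorem nonempty_oneFormField [μ.Regular] (hE : E.IsStronglyLocal) {m : Measure X}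
    (hm : E.IsEnergyDominant m) : Nonempty (OneFormField.{u, 0} E m) := by
  have := hm.1
  obtain ⟨f₀, hf₀, hfd⟩ := E.exists_countable_dense_dirichletAlgebra
  let f : ℕ → E.locContinuous := fun i => ⟨f₀ i, mem_locContinuous_of_mem_dirichletAlgebra (hf₀ i)⟩
  obtain ⟨g, hg, hgf⟩ := exists_gramMatrix hE hm f
  let H : HilbertField.{u, 0} X := gramField g hg
  let s : ℕ → ∀ x, H.fibre x := fun i x => (g x).vec (Finsupp.single i 1)
  have hinner : ∀ i j x, Inner.inner ℝ (s i x) (s j x) = (g x).entry i j := by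
    intro i j x
    refine ((g x).inner_vec _ _).trans ?_
    rw [gramForm_single, one_mul, one_mul]
  have hs : ∀ (K : Compacts X) i, s i ∈ H.l2 m K := by
    refine fun K i => ⟨gramField_vec_mem g hg i, ?_⟩
    refine (integrableOn_energyDensity hE m (f i).2 K.isCompact).congr (ae_restrict_of_ae ?_)
    filter_upwards [hgf, mutualDensity_self hE hm (f i)] with x h1 h2
    rw [← real_inner_self_eq_norm_sq, hinner, h1, h2]
  let e : ∀ K : Compacts X, ℕ → H.l2 m K := fun K i => ⟨s i, hs K i⟩
  have he : ∀ K x, Dense (Submodule.span ℝ (range fun n => (e K n).1 x) : Set (H.fibre x)) :=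
    fun K x => (g x).dense_span_single
  have hef : ∀ K, ∀ᵐ x ∂m, ∀ i j, Inner.inner ℝ ((e K i).1 x) ((e K j).1 x) =
      E.mutualDensity m (f i) (f j) x := by
    intro K
    filter_upwards [hgf] with x hx i j
    exact (hinner i j x).trans (hx i j)
  choose Φ hΦ using fun K => exists_iso hE hm K (f := f) hf₀ hfd H (e K) (he K) (hef K)
  refine ⟨{ H with iso := Φ, iso_mul := fun K h a => ?_, iso_restrict := fun K K' hK a => ?_ }⟩
  · obtain ⟨C, hC⟩ := h.2.2
    refine H.mem_of_total m (e K) (he K) (H.l2Mulₗ m K h) (C := |C|)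
      (H.norm_toDirectIntegral_l2Mul_le m h (abs_nonneg C)
        fun x => (hC x).trans (le_abs_self C)) (Φ K) (Φ K) (E.actionGraph K h)
      (Submodule.isClosed_topologicalClosure _) (fun n h' => ?_) a
    refine Submodule.le_topologicalClosure _ ⟨f n ⊗ₜ h', ?_⟩
    have : H.l2Mulₗ m K h (H.l2Mul m h' (e K n)) = H.l2Mul m (boundedBorelMul h h') (e K n) :=
      Subtype.ext (funext fun x => by
        simp only [HilbertField.l2Mulₗ, LinearMap.mk₂_apply, HilbertField.l2Mul, smul_smul,
          boundedBorelMul, LinearMap.coe_mk, AddHom.coe_mk, mul_comm])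
    rw [this, hΦ, hΦ]
    rfl
  · refine H.mem_of_total m (e K') (he K') (Submodule.inclusion (H.l2_mono m hK)) (C := 1)
      (fun b => by rw [one_mul]; exact H.norm_toDirectIntegral_mono m hK b) (Φ K') (Φ K)
      (E.restrictionGraph K K') (Submodule.isClosed_topologicalClosure _) (fun n h' => ?_) a
    refine Submodule.le_topologicalClosure _ ⟨f n ⊗ₜ h', ?_⟩
    have : Submodule.inclusion (H.l2_mono m hK) (H.l2Mul m h' (e K' n)) =
        H.l2Mul m h' (e K n) := rfl
    rw [this, hΦ, hΦ]
    rfl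

end Existence

end DirichletForm

/-! ## Bounded vector fields and the intrinsic metric -/

namespace OneFormField

variable {X : Type u} [MetricSpace X] [LocallyCompactSpace X] [SigmaCompactSpace X]
  [MeasurableSpace X] [BorelSpace X] {μ : Measure X} {E : DirichletForm μ} {m : Measure X}
  (H : OneFormField.{u, v} E m)

/-- The action is prescribed only through membership in a closed graph; single-valuedness of that
graph turns it into an equation on images of tensors. -/
theorem iso_l2Mul (hE : E.IsStronglyLocal) (hm : E.IsEnergyDominant m) {K : Compacts X}
    {a : H.toHilbertField.l2 m K} {t : E.locContinuous ⊗[ℝ] boundedBorel X}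
    (ha : H.iso K (H.toHilbertField.toDirectIntegral m K a) = E.toOneForms K t)
    (h : boundedBorel X) :
    H.iso K (H.toHilbertField.toDirectIntegral m K (H.toHilbertField.l2Mul m h a)) =
      E.toOneForms K (E.rightMul h t) := by
  have h1 := H.iso_mul K h a
  rw [ha] at h1
  exact DirichletForm.eq_of_mem_actionGraph hE hm h1 (Submodule.le_topologicalClosure _ ⟨t, rfl⟩)

/-- The norms of a section representing `∂f` are determined by the density of `Γ(f)`. -/
theorem norm_sq_eq_of_represents (hE : E.IsStronglyLocal) (hm : E.IsEnergyDominant m)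
    {f : E.locContinuous} {a : ∀ x, H.fibre x} (ha : H.Represents a (E.gradient f)) :
    ∀ᵐ x ∂m, ‖a x‖ ^ 2 = E.energyDensity m f x := by
  have key : ∀ K : Compacts X, ∀ᵐ x ∂(m.restrict K), ‖a x‖ ^ 2 = E.energyDensity m f x := by
    intro K
    obtain ⟨haK, hiso⟩ := ha K
    refine Integrable.ae_eq_of_forall_setIntegral_eq _ _ haK.2
      (DirichletForm.integrableOn_energyDensity hE m f.2 K.isCompact) fun s hs _ => ?_
    -- Localisation to `s`: the norms of `𝟏_s a` and of `f ⊗ 𝟏_s` agree, so `‖a_x‖²` and the energy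
    -- density have the same integral over every `s`.
    have h1 := H.iso_l2Mul hE hm hiso (boundedBorelIndicator hs)
    have h2 := congrArg (fun v => ‖v‖ ^ 2) h1
    simp only [LinearIsometryEquiv.norm_map] at h2
    rw [HilbertField.norm_toDirectIntegral_sq, DirichletForm.rightMul, LinearMap.lTensor_tmul,
      DirichletForm.norm_tmul_sq hE hm] at h2
    rw [← integral_indicator hs, ← integral_indicator hs]
    refine Eq.trans ?_ (h2.trans ?_)
    all_goals
      refine integral_congr_ae (.of_forall fun x => ?_)
      by_cases hx : x ∈ s <;>
        simp [HilbertField.l2Mul, boundedBorelIndicator, boundedBorelMul, boundedBorelOne, hx]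
  have h := (ae_restrict_iUnion_iff (compactCovering X)
    fun x => ‖a x‖ ^ 2 = E.energyDensity m f x).2 fun n => key ⟨_, isCompact_compactCovering X n⟩
  rwa [iUnion_compactCovering, Measure.restrict_univ] at h

theorem iso_mono (hE : E.IsStronglyLocal) (hm : E.IsEnergyDominant m) (w : E.OneFormsLoc)
    {K K' : Compacts X} (hK : K ≤ K') {a : H.toHilbertField.l2 m K'}
    (ha : H.iso K' (H.toHilbertField.toDirectIntegral m K' a) = w.1 K') :
    H.iso K (H.toHilbertField.toDirectIntegral m K ⟨a.1, H.l2_mono m hK a.2⟩) = w.1 K := by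
  have h1 := H.iso_restrict K K' hK a
  rw [ha] at h1
  exact DirichletForm.eq_of_mem_restrictionGraph hE hm hK h1 (w.2 K K' hK)

/-- Every element of `𝓗_loc` is represented by a measurable section. -/
theorem exists_represents (hE : E.IsStronglyLocal) (hm : E.IsEnergyDominant m)
    (w : E.OneFormsLoc) : ∃ a : ∀ x, H.fibre x, H.Represents a w := by
  classical
  have h0 : ∀ K : Compacts X, ∃ a : H.toHilbertField.l2 m K,
      H.iso K (H.toHilbertField.toDirectIntegral m K a) = w.1 K := by
    intro K
    obtain ⟨v, hv⟩ := (H.iso K).surjective (w.1 K)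
    obtain ⟨a, rfl⟩ := H.toDirectIntegral_surjective m v
    exact ⟨a, hv⟩
  choose b hb using h0
  let k : ℕ → Compacts X := fun n => ⟨_, isCompact_compactCovering X n⟩
  have hk : ∀ x, ∃ n, x ∈ (k n : Set X) := exists_mem_compactCovering
  have hkm : Measurable fun x => Nat.find (hk x) :=
    measurable_find hk fun n => (k n).isCompact.measurableSet
  -- At `x` take the section chosen for the first compact set of the covering that contains `x`; the
  -- first-index function is measurable.
  let a : ∀ x, H.fibre x := fun x => (b (k (Nat.find (hk x)))).1 x
  have ha : a ∈ H.sections := H.mem_sections_of_piecewise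
    (fun n => (fun x => Nat.find (hk x)) ⁻¹' {n}) (fun n => hkm (measurableSet_singleton n))
    (fun x => ⟨_, rfl⟩) (fun n => (b (k n)).1) (fun n => (b (k n)).2.1) fun n x hx => by
      have hx' : Nat.find (hk x) = n := hx
      change (b (k (Nat.find (hk x)))).1 x = _
      rw [hx']
  have hab : ∀ K : Compacts X, ∀ᵐ x ∂(m.restrict K), a x = (b K).1 x := by
    intro K
    -- Restricted to `K ∩ k n`, both sections correspond to the same component of `w`. Injectivity
    -- of the isomorphism makes them equal a.e. there.
    have h1 : ∀ n, ∀ᵐ x ∂(m.restrict (K ⊓ k n : Compacts X)), (b (k n)).1 x = (b K).1 x := by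
      intro n
      refine (H.toDirectIntegral_eq_iff m (K := K ⊓ k n)
        ⟨_, H.l2_mono m inf_le_right (b (k n)).2⟩ ⟨_, H.l2_mono m inf_le_left (b K).2⟩).1 ?_
      refine (H.iso (K ⊓ k n)).injective ?_
      rw [H.iso_mono hE hm w inf_le_right (hb (k n)), H.iso_mono hE hm w inf_le_left (hb K)]
    have h2 : ∀ n, ∀ᵐ x ∂m, x ∈ (K : Set X) ∩ k n → (b (k n)).1 x = (b K).1 x := by
      intro n
      rw [← ae_restrict_iff' (K.isCompact.measurableSet.inter (k n).isCompact.measurableSet)]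
      exact h1 n
    rw [ae_restrict_iff' K.isCompact.measurableSet]
    filter_upwards [ae_all_iff.2 h2] with x hx hxK
    exact hx _ ⟨hxK, Nat.find_spec (hk x)⟩
  refine ⟨a, fun K => ?_⟩
  have haK : a ∈ H.toHilbertField.l2 m K := by
    refine ⟨ha, (b K).2.2.congr ?_⟩
    filter_upwards [hab K] with x hx
    rw [hx]
  refine ⟨haK, ?_⟩
  rw [(H.toDirectIntegral_eq_iff m ⟨a, haK⟩ (b K)).2 (hab K), hb]

/-- All representatives give the same essential supremum, so the infimum is that common value. A
representative must exist, for an empty infimum would be `∞`. -/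
theorem lInftyNorm_gradient (hE : E.IsStronglyLocal) (hm : E.IsEnergyDominant m)
    (f : E.locContinuous) : H.lInftyNorm (E.gradient f) =
      essSup (fun x => ENNReal.ofReal √(E.energyDensity m f x)) m := by
  have h1 : ∀ a, H.Represents a (E.gradient f) →
      essSup (fun x => ‖a x‖ₑ) m = essSup (fun x => ENNReal.ofReal √(E.energyDensity m f x)) m := by
    intro a ha
    refine essSup_congr_ae ?_
    filter_upwards [H.norm_sq_eq_of_represents hE hm ha] with x hx
    rw [← hx, Real.sqrt_sq (norm_nonneg _), ofReal_norm]
  obtain ⟨a, ha⟩ := H.exists_represents hE hm (E.gradient f)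
  refine le_antisymm ((iInf₂_le a ha).trans_eq (h1 a ha)) (le_iInf₂ fun b hb => (h1 b hb).ge)

/-- The square root does not affect a comparison with `1`, and the density is a.e. finite, so
passing to real values loses nothing. Absolute continuity is automatic for an energy dominant `m`,
and an essentially bounded density follows from the bound `1`. -/
theorem lInftyNorm_gradient_le_one_iff (hE : E.IsStronglyLocal) (hm : E.IsEnergyDominant m)
    (f : E.locContinuous) : H.lInftyNorm (E.gradient f) ≤ 1 ↔
      (f : C(X, ℝ)) ∈ E.lipschitzClass m ∧ E.EnergyLe m f := by
  have := hm.1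
  have := DirichletForm.localEnergyMeasure_regular hE f.2
  have hac := DirichletForm.localEnergyMeasure_ac hE hm f.2
  have h1 : H.lInftyNorm (E.gradient f) ≤ 1 ↔
      ∀ᵐ x ∂m, (E.localEnergyMeasure f).rnDeriv m x ≤ 1 := by
    have h2 : (∀ᵐ x ∂m, ENNReal.ofReal √(E.energyDensity m f x) ≤ 1) ↔
        ∀ᵐ x ∂m, (E.localEnergyMeasure f).rnDeriv m x ≤ 1 := by
      refine eventually_congr ?_
      filter_upwards [Measure.rnDeriv_lt_top (E.localEnergyMeasure f) m] with x hx
      rw [ENNReal.ofReal_le_one, Real.sqrt_le_one, DirichletForm.energyDensity,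
        ← ENNReal.toReal_one, ENNReal.toReal_le_toReal hx.ne ENNReal.one_ne_top]
    rw [H.lInftyNorm_gradient hE hm, ← h2]
    refine ⟨fun h => ?_, fun h => essSup_le_of_ae_le 1 h⟩
    filter_upwards [ENNReal.ae_le_essSup fun x => ENNReal.ofReal √(E.energyDensity m f x)] with x hx
    exact hx.trans h
  rw [h1]
  refine ⟨fun h => ⟨⟨f.2, hac, ?_⟩, hac, h⟩, fun h => h.2.2⟩
  exact (essSup_le_of_ae_le 1 h).trans_lt ENNReal.one_lt_top

theorem intrinsicMetric_eq (hE : E.IsStronglyLocal) (hm : E.IsEnergyDominant m) (x y : X) :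
    E.intrinsicMetric m x y = ⨆ f ∈ {f : E.locContinuous | H.lInftyNorm (E.gradient f) ≤ 1},
      ((f.1 x - f.1 y : ℝ) : EReal) := by
  refine le_antisymm (iSup₂_le fun f hf => ?_) (iSup₂_le fun f hf => ?_)
  · exact le_iSup₂_of_le ⟨f, hf.1.1⟩ ((H.lInftyNorm_gradient_le_one_iff hE hm ⟨f, hf.1.1⟩).2 hf)
      le_rfl
  · exact le_iSup₂_of_le f.1 ((H.lInftyNorm_gradient_le_one_iff hE hm f).1 hf) le_rfl

end OneFormField

end

theorem mainTheorem6 {X : Type u} [MetricSpace X] [LocallyCompactSpace X] [SeparableSpace X]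
    [MeasurableSpace X] [BorelSpace X]
    (μ : Measure X) [μ.Regular] [μ.IsOpenPosMeasure]
    (E : DirichletForm μ) (hE : E.IsStronglyLocal)
    (m : Measure X) (hm : E.IsEnergyDominant m) :
    Nonempty (OneFormField.{u, 0} E m) ∧
    ∀ (H : OneFormField.{u, v} E m) (x y : X),
      E.intrinsicMetric m x y =
        ⨆ f ∈ {f : E.locContinuous | H.lInftyNorm (E.gradient f) ≤ 1},
          ((f.1 x - f.1 y : ℝ) : EReal) := by
  -- Together with local compactness this gives σ-compactness, which every exhaustion argument uses.
  have : SecondCountableTopology X := UniformSpace.secondCountable_of_separable X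
  have : SigmaCompactSpace X := inferInstance
  exact ⟨DirichletForm.nonempty_oneFormField hE hm, fun H x y => H.intrinsicMetric_eq hE hm x y⟩
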